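/- Work in the Hilbert space $\mathcal H=L^2(\mathbb R^3)$ with $\mathbf p=-i\nabla$; $\mathbf x$ is multiplication by the coordinates. Let $\mathbf a_0:\mathbb R^3\to\mathbb R^3$ and $\mathbf e:(-\pi/2,\pi/2)\times\mathbb R^3\to\mathbb R^3$ be measurable, with $\mathbf a_0,\ \nabla\cdot\mathbf a_0\in L^\infty(\mathbb R^3)$ and $\mathbf e,\ \nabla\cdot\mathbf e\in L^\infty(I\times\mathbb R^3)$ for every compact interval $I\subset(-\pi/2,\pi/2)$ (spatial divergences in the distributional sense). Put $$\mathbf a(\tau,\mathbf x)=\mathbf a_0(\mathbf x)-\int_0^\tau\mathbf e(\rho,\mathbf x)\,d\rho ,\qquad h(\tau)=\tfrac12\big[(\mathbf p-\mathbf a(\tau,\cdot))^2+\mathbf x^2\big],\qquad h_0=\tfrac12[\mathbf p^2+\mathbf x^2],$$ where $h(\tau)$ is the self-adjoint operator determined by the closed form $\tfrac12((\mathbf p-\mathbf a)\varphi,(\mathbf p-\mathbf a)\psi)+\tfrac12(\mathbf x\varphi,\mathbf x\psi)$ on $\{\psi\in\mathcal H:\ \mathbf p\psi\in\mathcal H,\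 \mathbf x\psi\in\mathcal H\}$, and $h_0$ is the case $\mathbf a=0$. Let $u(\tau,\sigma)$, $\tau,\sigma\in(-\pi/2,\pi/2)$, be the unitary propagator of the family $h(\tau)$: $u(\tau,\tau)=1$, $u(\tau,\sigma)u(\sigma,\rho)=u(\tau,\rho)$, $u$ is jointly strongly continuous, $u(\tau,\sigma)\mathcal D(h_0)=\mathcal D(h_0)$, and for $\psi\in\mathcal D(h_0)$ the map $(\tau,\sigma)\mapsto u(\tau,\sigma)\psi$ is $C^1$ in norm with $i\partial_\tau u(\tau,\sigma)\psi=h(\tau)u(\tau,\sigma)\psi$ and $i\partial_\sigma u(\tau,\sigma)\psi=-u(\tau,\sigma)h(\sigma)\psi$. Write $\tilde{\mathbf x}(\tau)=u(0,\tau)\,\mathbf x\,u(\tau,0)$, so that $f(\tilde{\mathbf x}(\tau))=u(0,\tau)f(\mathbf x)u(\tau,0)$ for bounded continuous $f$. **Theorem.** If $$\int_{-\pi/2}^{\pi/2}\big(\tfrac{\pi}{2}-|\tau|\big)\,\|\mathbf e(\tau,\cdot)\|_\infty\,d\tau<\infty ,$$ then the asymptotic position operators exist: there is a unique triple $\tilde{\mathbf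 x}_+$ and a unique triple $\tilde{\mathbf x}_-$ of strongly commuting self-adjoint operators (that is, self-adjoint operators with a joint spectral measure on $\mathbb R^3$) such that $$e^{i\mathbf q\cdot\tilde{\mathbf x}_\pm}=\mathop{\mathrm{s\text{-}lim}}_{\tau\to\pm\pi/2}e^{i\mathbf q\cdot\tilde{\mathbf x}(\tau)}\qquad\text{for all }\mathbf q\in\mathbb R^3 .$$ Moreover $f(\tilde{\mathbf x}_\pm)=\mathop{\mathrm{s\text{-}lim}}_{\tau\to\pm\pi/2}f(\tilde{\mathbf x}(\tau))$ for every Schwartz function $f$ on $\mathbb R^3$. In the Schrödinger picture these are the asymptotic velocity operators: with $\langle t\rangle=\sqrt{t^2+1}$, $$[N(t)\chi](\mathbf x)=\langle t\rangle^{-3/2}\exp\Big[\frac{it}{2}\Big(\frac{|\mathbf x|}{\langle t\rangle}\Big)^2\Big]\chi\Big(\frac{\mathbf x}{\langle t\rangle}\Big),\qquad U(t,s)=N(t)\,u(\arctan t,\arctan s)\,N(s)^*,$$ one has $$e^{i\mathbf q\cdot\tilde{\mathbf x}_\pm}=\mathop{\mathrm{s\text{-}lim}}_{t\to\pm\infty}U(0,t)\exp\Big[i\mathbf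 q\cdot\frac{\mathbf x}{\langle t\rangle}\Big]U(t,0)\qquad\text{for all }\mathbf q\in\mathbb R^3 .$$ -/

import Mathlib

open MeasureTheory Filter Topology Set
open scoped ENNReal ContDiff BoundedContinuousFunction

noncomputable section

namespace OscScatt

/-- Physical space. -/
abbrev E3 : Type := EuclideanSpace ℝ (Fin 3)

/-- The Hilbert space of square-integrable complex functions on physical space. -/
abbrev Hs : Type := Lp ℂ 2 (volume : Measure E3)

/-! ### Projection-valued measures and commuting self-adjoint operators -/

/-- A projection-valued measure on the measurable space `α`, acting in the Hilbert space `H`: every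
measurable set is sent to an orthogonal projection, the whole space to the identity, and disjoint
countable unions to strongly convergent sums. -/
structure ProjMeasure (α : Type*) [MeasurableSpace α] (H : Type*) [NormedAddCommGroup H]
    [InnerProductSpace ℂ H] [CompleteSpace H] where
  /-- The projection attached to a set (relevant for measurable sets only). -/
  proj : Set α → H →L[ℂ] H
  isStarProjection : ∀ s, MeasurableSet s → IsStarProjection (proj s)
  proj_univ : proj univ = 1
  hasSum_proj : ∀ s : ℕ → Set α, (∀ n, MeasurableSet (s n)) →
    Pairwise (fun m n => Disjoint (s m) (s n)) →
    ∀ ψ : H, HasSum (fun n => proj (s n) ψ) (proj (⋃ n, s n) ψ)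

namespace ProjMeasure

variable {α : Type*} [MeasurableSpace α] {H : Type*} [NormedAddCommGroup H]
  [InnerProductSpace ℂ H] [CompleteSpace H]

theorem proj_empty (P : ProjMeasure α H) (ψ : H) : P.proj ∅ ψ = 0 := by
  have h := P.hasSum_proj (fun _ => ∅) (fun _ => MeasurableSet.empty) (fun _ _ _ => by simp) ψ
  simpa using (summable_const_iff (a := P.proj ∅ ψ)).1 h.summable

theorem inner_proj (P : ProjMeasure α H) (ψ : H) {s : Set α} (hs : MeasurableSet s) :
    RCLike.re (inner ℂ ψ (P.proj s ψ)) = ‖P.proj s ψ‖ ^ 2 := by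
  have h := P.isStarProjection s hs
  have h1 : P.proj s (P.proj s ψ) = P.proj s ψ := by
    have := congrArg (fun T : H →L[ℂ] H => T ψ) h.isIdempotentElem.eq
    simpa using this
  have h2 : inner ℂ (P.proj s ψ) (P.proj s ψ) = inner ℂ ψ (P.proj s (P.proj s ψ)) :=
    (ContinuousLinearMap.isSelfAdjoint_iff_isSymmetric.1 h.isSelfAdjoint) ψ (P.proj s ψ)
  rw [h1] at h2
  rw [← h2, inner_self_eq_norm_sq]

/-- The spectral measure `B ↦ ⟪ψ, P(B) ψ⟫ = ‖P(B) ψ‖²` of the vector `ψ`. -/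
def measure (P : ProjMeasure α H) (ψ : H) : Measure α :=
  Measure.ofMeasurable (fun s _ => ENNReal.ofReal (‖P.proj s ψ‖ ^ 2))
    (by simp [P.proj_empty ψ])
    (by
      intro f hf hd
      have h := P.hasSum_proj f hf hd ψ
      have h1 : HasSum (fun n => ‖P.proj (f n) ψ‖ ^ 2) (‖P.proj (⋃ n, f n) ψ‖ ^ 2) := by
        have h2 := (h.mapL (innerSL ℂ ψ)).mapL RCLike.reCLM
        simp only [innerSL_apply_apply, RCLike.reCLM_apply] at h2
        rw [P.inner_proj ψ (MeasurableSet.iUnion hf)] at h2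
        simpa only [P.inner_proj ψ (hf _)] using h2
      rw [← h1.tsum_eq, ENNReal.ofReal_tsum_of_nonneg (fun n => by positivity) h1.summable])

theorem measure_apply (P : ProjMeasure α H) (ψ : H) {s : Set α} (hs : MeasurableSet s) :
    P.measure ψ s = ENNReal.ofReal (‖P.proj s ψ‖ ^ 2) := by
  rw [measure, Measure.ofMeasurable_apply s hs]

/-- The bounded operator `T` is `∫ f dP`, for a bounded measurable function `f`. The quadratic form
determines `T`. -/
def IsIntegral (P : ProjMeasure α H) (f : α → ℂ) (T : H →L[ℂ] H) : Prop :=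
  ∀ ψ : H, inner ℂ ψ (T ψ) = ∫ y, f y ∂(P.measure ψ)

end ProjMeasure

/-- `P` is the joint spectral measure of the triple `X` of operators, that is `X j = ∫ y_j dP(y)`
with its natural domain. Then `T = f(X)` means `P.IsIntegral f T`. -/
def IsJointSpectralMeasure (P : ProjMeasure E3 Hs) (X : Fin 3 → Hs →ₗ.[ℂ] Hs) : Prop :=
  ∀ j, (∀ ψ : Hs, ψ ∈ (X j).domain ↔ Integrable (fun y : E3 => y j ^ 2) (P.measure ψ)) ∧
    ∀ ψ : (X j).domain,
      inner ℂ (ψ : Hs) (X j ψ) = ((∫ y : E3, y j ∂(P.measure (ψ : Hs)) : ℝ) : ℂ)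

/-! ### Multiplication operators -/

theorem memLp_mul (f : E3 →ᵇ ℂ) (ψ : Hs) : MemLp (fun x => f x * ψ x) 2 (volume : Measure E3) :=
  (Lp.memLp ψ).of_le_mul (c := ‖f‖)
    (f.continuous.aestronglyMeasurable.mul (Lp.aestronglyMeasurable ψ))
    (Eventually.of_forall fun x => by
      rw [norm_mul]
      exact mul_le_mul_of_nonneg_right (f.norm_coe_le_norm x) (norm_nonneg _))

/-- The operator `f(x)` of multiplication by a bounded continuous function `f`. -/
def mulOp (f : E3 →ᵇ ℂ) (ψ : Hs) : Hs := (memLp_mul f ψ).toLp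

/-- The function `x ↦ exp(i q·x)`. -/
def planeWave (q : E3) : E3 →ᵇ ℂ :=
  BoundedContinuousFunction.ofNormedAddCommGroup
    (fun x => Complex.exp (((inner ℝ q x : ℝ) : ℂ) * Complex.I))
    (by fun_prop) 1 (fun x => by rw [Complex.norm_exp_ofReal_mul_I])

/-! ### The oscillator hamiltonian in a magnetic potential -/

/-- `η` is the weak partial derivative of `ψ` in the `j`-th coordinate direction. -/
def HasWeakPartial (j : Fin 3) (ψ η : Hs) : Prop :=
  ∀ φ : E3 → ℂ, ContDiff ℝ ∞ φ → HasCompactSupport φ →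
    ∫ x, ψ x * fderiv ℝ φ x (EuclideanSpace.single j 1) = -∫ x, η x * φ x

open Classical in
/-- The weak partial derivative in the `j`-th direction (zero if it is not in the Hilbert space). -/
def weakPartial (j : Fin 3) (ψ : Hs) : Hs :=
  if h : ∃ η, HasWeakPartial j ψ η then h.choose else 0

/-- The form domain of the oscillator: `p ψ` and `x ψ` are square integrable, componentwise. -/
def formDomain : Set Hs :=
  {ψ | ∀ j, (∃ η, HasWeakPartial j ψ η) ∧
    MemLp (fun x : E3 => ((x j : ℝ) : ℂ) * ψ x) 2 (volume : Measure E3)}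

/-- The `j`-th component of the kinetic momentum `(p - a) ψ`, with `p = -i∇`. -/
def kinMom (a : E3 → E3) (j : Fin 3) (ψ : Hs) (x : E3) : ℂ :=
  -Complex.I * weakPartial j ψ x - ((a x j : ℝ) : ℂ) * ψ x

/-- The sesquilinear form
`q(φ, ψ) = ½ ((p - a) φ, (p - a) ψ) + ½ (x φ, x ψ)`, used on `formDomain`. -/
def hForm (a : E3 → E3) (φ ψ : Hs) : ℂ :=
  (1 / 2) * (∑ j, ∫ x, starRingEnd ℂ (kinMom a j φ x) * kinMom a j ψ x) +
    (1 / 2) * ∫ x, ((‖x‖ ^ 2 : ℝ) : ℂ) * (starRingEnd ℂ (φ x) * ψ x)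

/-- The graph of the operator `h = ½ ((p - a)² + x²)` determined by the form `hForm a`:
`ψ` is in the domain of `h` and `h ψ = η`. -/
def IsHam (a : E3 → E3) (ψ η : Hs) : Prop :=
  ψ ∈ formDomain ∧ ∀ φ ∈ formDomain, hForm a φ ψ = inner ℂ φ η

/-- The domain of the free oscillator hamiltonian `h₀ = ½ (p² + x²)`. -/
def domH0 : Set Hs := {ψ | ∃ η, IsHam 0 ψ η}

/-! ### Potentials and fields -/

/-- The open time interval of the oscillator picture. -/
def timeInt : Set ℝ := Ioo (-(Real.pi / 2)) (Real.pi / 2)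

/-- The vector potential with initial value `a₀`, electric field `e` and zero scalar potential:
`a(τ, x) = a₀(x) - ∫₀^τ e(ρ, x) dρ`. -/
def vecPot (a₀ : E3 → E3) (e : ℝ → E3 → E3) (τ : ℝ) (x : E3) : E3 :=
  a₀ x - ∫ ρ in (0 : ℝ)..τ, e ρ x

/-- `g` is the divergence of the vector field `F` in the sense of distributions. -/
def HasWeakDiv (F : E3 → E3) (g : E3 → ℝ) : Prop :=
  ∀ φ : E3 → ℝ, ContDiff ℝ ∞ φ → HasCompactSupport φ →
    ∫ x, fderiv ℝ φ x (F x) = -∫ x, g x * φ x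

/-- `a₀` and its divergence are essentially bounded; `e` and its spatial divergence are essentially
bounded on `I × ℝ³` for every compact interval `I` inside `timeInt`. -/
structure AdmissibleField (a₀ : E3 → E3) (e : ℝ → E3 → E3) : Prop where
  pot_bdd : MemLp a₀ ⊤ (volume : Measure E3)
  pot_div_bdd : ∃ g : E3 → ℝ, MemLp g ⊤ (volume : Measure E3) ∧ HasWeakDiv a₀ g
  field_bdd : ∀ α β : ℝ, Icc α β ⊆ timeInt →
    MemLp (fun z : ℝ × E3 => e z.1 z.2) ⊤
      ((volume.restrict (Icc α β)).prod (volume : Measure E3))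
  field_div_bdd : ∀ α β : ℝ, Icc α β ⊆ timeInt → ∃ g : ℝ → E3 → ℝ,
    MemLp (fun z : ℝ × E3 => g z.1 z.2) ⊤
      ((volume.restrict (Icc α β)).prod (volume : Measure E3)) ∧
    ∀ᵐ τ ∂(volume.restrict (Icc α β)), HasWeakDiv (e τ) (g τ)

/-! ### The evolution -/

/-- `u` is the unitary propagator on `timeInt` of the family of hamiltonians
`h(τ) = ½ ((p - a(τ))² + x²)`, i.e. the solution operator of `i ∂_τ ψ = h(τ) ψ`. -/
structure IsPropagator (a : ℝ → E3 → E3) (u : ℝ → ℝ → Hs ≃ₗᵢ[ℂ] Hs) : Prop where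
  refl : ∀ τ ∈ timeInt, ∀ ψ, u τ τ ψ = ψ
  comp : ∀ τ ∈ timeInt, ∀ σ ∈ timeInt, ∀ ρ ∈ timeInt, ∀ ψ, u τ σ (u σ ρ ψ) = u τ ρ ψ
  cont : ∀ ψ, ContinuousOn (fun z : ℝ × ℝ => u z.1 z.2 ψ) (timeInt ×ˢ timeInt)
  dom : ∀ τ ∈ timeInt, ∀ σ ∈ timeInt, (fun ψ => u τ σ ψ) '' domH0 = domH0
  contDiff : ∀ ψ ∈ domH0,
    ContDiffOn ℝ 1 (fun z : ℝ × ℝ => u z.1 z.2 ψ) (timeInt ×ˢ timeInt)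
  deriv_left : ∀ ψ ∈ domH0, ∀ τ ∈ timeInt, ∀ σ ∈ timeInt, ∃ η, IsHam (a τ) (u τ σ ψ) η ∧
    HasDerivAt (fun τ' => u τ' σ ψ) (-Complex.I • η) τ
  deriv_right : ∀ ψ ∈ domH0, ∀ τ ∈ timeInt, ∀ σ ∈ timeInt, ∃ η, IsHam (a σ) ψ η ∧
    HasDerivAt (fun σ' => u τ σ' ψ) (Complex.I • u τ σ η) σ

theorem hForm_conj (a : E3 → E3) (φ ψ : Hs) : starRingEnd ℂ (hForm a φ ψ) = hForm a ψ φ := by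
  simp only [hForm, map_add, map_mul, map_sum, ← integral_conj, Complex.conj_conj,
    Complex.conj_ofReal, map_div₀, map_one, map_ofNat]
  simp only [mul_comm (starRingEnd ℂ _)]

/-- The propagator is determined by its defining properties (on a dense domain). -/
theorem IsPropagator.unique {a : ℝ → E3 → E3} {u v : ℝ → ℝ → Hs ≃ₗᵢ[ℂ] Hs}
    (hu : IsPropagator a u) (hv : IsPropagator a v) {τ σ : ℝ} (hτ : τ ∈ timeInt)
    (hσ : σ ∈ timeInt) {ψ : Hs} (hψ : ψ ∈ domH0) : u τ σ ψ = v τ σ ψ := by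
  have hd : ∀ t ∈ timeInt,
      HasDerivAt (fun t => (inner ℂ (u t σ ψ) (v t σ ψ) : ℂ)) 0 t := by
    intro t ht
    obtain ⟨η, h1, h2⟩ := hu.deriv_left ψ hψ t ht σ hσ
    obtain ⟨ζ, h3, h4⟩ := hv.deriv_left ψ hψ t ht σ hσ
    have h5 := h2.inner ℂ h4
    have h6 : (inner ℂ (u t σ ψ) ζ : ℂ) = inner ℂ η (v t σ ψ) := by
      rw [← h3.2 _ h1.1, ← hForm_conj, h1.2 _ h3.1, inner_conj_symm]
    rw [inner_smul_left, inner_smul_right, h6] at h5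
    simpa using h5
  have hc : (inner ℂ (u τ σ ψ) (v τ σ ψ) : ℂ) = inner ℂ (u σ σ ψ) (v σ σ ψ) := by
    refine (convex_Ioo (-(Real.pi / 2)) (Real.pi / 2)).is_const_of_fderivWithin_eq_zero (𝕜 := ℝ)
      (f := fun t => (inner ℂ (u t σ ψ) (v t σ ψ) : ℂ))
      (fun t ht => (hd t ht).differentiableAt.differentiableWithinAt) (fun t ht => ?_) hτ hσ
    rw [fderivWithin_eq_fderiv (isOpen_Ioo.uniqueDiffWithinAt ht) (hd t ht).differentiableAt]
    ext
    simp [(hd t ht).deriv]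
  rw [hu.refl σ hσ, hv.refl σ hσ] at hc
  rw [← sub_eq_zero, ← norm_eq_zero, ← sq_eq_zero_iff, @norm_sub_sq ℂ, hc,
    inner_self_eq_norm_sq, LinearIsometryEquiv.norm_map, LinearIsometryEquiv.norm_map]
  ring

/-- `f(x̃(τ))`, where `x̃(τ) = u(0, τ) x u(τ, 0)`. -/
def heisenberg (u : ℝ → ℝ → Hs ≃ₗᵢ[ℂ] Hs) (f : E3 →ᵇ ℂ) (τ : ℝ) (ψ : Hs) : Hs :=
  u 0 τ (mulOp f (u τ 0 ψ))

/-! ### The Schrödinger picture -/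

/-- The bracket `⟨t⟩ = √(t² + 1)`. -/
def bracket (t : ℝ) : ℝ := Real.sqrt (t ^ 2 + 1)

theorem bracket_pos (t : ℝ) : 0 < bracket t := Real.sqrt_pos.2 (by positivity)

theorem memLp_dilate {c : ℝ} (hc : c ≠ 0) (w : E3 → ℂ) (hw : Continuous w) (K : ℝ)
    (hK : ∀ x, ‖w x‖ ≤ K) (ψ : Hs) :
    MemLp (fun x => w x * ψ (c • x)) 2 (volume : Measure E3) := by
  have h1 : MemLp (fun x => ψ (c • x)) 2 (volume : Measure E3) := by
    have hm : MemLp ψ 2 (Measure.map (c • ·) (volume : Measure E3)) := by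
      rw [Measure.map_addHaar_smul _ hc]
      exact (Lp.memLp ψ).smul_measure ENNReal.ofReal_ne_top
    exact hm.comp_of_map (measurable_const_smul c).aemeasurable
  refine h1.of_le_mul (c := K) (hw.aestronglyMeasurable.mul h1.1)
    (Eventually.of_forall fun x => ?_)
  rw [norm_mul]
  exact mul_le_mul_of_nonneg_right (hK x) (norm_nonneg _)

/-- The transformation
`[N(t) χ](x) = ⟨t⟩^{-3/2} exp[(i t / 2) (|x| / ⟨t⟩)²] χ(x / ⟨t⟩)` of the Hilbert space. -/
def niederer (t : ℝ) (χ : Hs) : Hs :=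
  (memLp_dilate (inv_ne_zero (bracket_pos t).ne')
    (fun x => ((bracket t ^ (-(3 / 2) : ℝ) : ℝ) : ℂ) *
      Complex.exp (((t / 2 * (‖x‖ / bracket t) ^ 2 : ℝ) : ℂ) * Complex.I))
    (by fun_prop) (bracket t ^ (-(3 / 2) : ℝ))
    (fun x => by
      rw [norm_mul, Complex.norm_exp_ofReal_mul_I, mul_one, Complex.norm_real, Real.norm_eq_abs,
        abs_of_nonneg (Real.rpow_nonneg (bracket_pos t).le _)])
    χ).toLp

/-- The conjugate transformation
`[N(t)* ψ](y) = ⟨t⟩^{3/2} exp[-(i t / 2) |y|²] ψ(⟨t⟩ y)`. -/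
def niedererAdj (t : ℝ) (ψ : Hs) : Hs :=
  (memLp_dilate (bracket_pos t).ne'
    (fun y => ((bracket t ^ (3 / 2 : ℝ) : ℝ) : ℂ) *
      Complex.exp (((-(t / 2 * ‖y‖ ^ 2) : ℝ) : ℂ) * Complex.I))
    (by fun_prop) (bracket t ^ (3 / 2 : ℝ))
    (fun x => by
      rw [norm_mul, Complex.norm_exp_ofReal_mul_I, mul_one, Complex.norm_real, Real.norm_eq_abs,
        abs_of_nonneg (Real.rpow_nonneg (bracket_pos t).le _)])
    ψ).toLp

/-- The Schrödinger picture evolution `U(t, s) = N(t) u(arctan t, arctan s) N(s)*`. -/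
def schrEvol (u : ℝ → ℝ → Hs ≃ₗᵢ[ℂ] Hs) (t s : ℝ) (ψ : Hs) : Hs :=
  niederer t (u (Real.arctan t) (Real.arctan s) (niedererAdj s ψ))

/-! ### Asymptotic position -/

/-- `X` is the triple of asymptotic position operators of the evolution `u` for `τ` tending to its
limit along `l`, and `P` is its joint spectral measure: the `X j` are self-adjoint and strongly
commuting, and `exp(i q·X)` is the strong limit of `exp(i q·x̃(τ))` for all vectors `q`. -/
def IsAsymptoticPosition (u : ℝ → ℝ → Hs ≃ₗᵢ[ℂ] Hs) (l : Filter ℝ) (X : Fin 3 → Hs →ₗ.[ℂ] Hs)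
    (P : ProjMeasure E3 Hs) : Prop :=
  (∀ j, IsSelfAdjoint (X j)) ∧ IsJointSpectralMeasure P X ∧
  ∀ q : E3, ∃ T : Hs →L[ℂ] Hs, P.IsIntegral (planeWave q) T ∧
    ∀ ψ, Tendsto (fun τ => heisenberg u (planeWave q) τ ψ) l (𝓝 (T ψ))

/-- The asymptotic position operators exist and are unique for `τ` tending to its limit along `l`;
functions `f` of them, with `f` a Schwartz function, are the strong limits of `f(x̃(τ))`; and they
are the asymptotic velocity operators of the Schrödinger picture for `t` tending to infinity
along `l'`. -/
def HasAsymptoticPosition (u : ℝ → ℝ → Hs ≃ₗᵢ[ℂ] Hs) (l l' : Filter ℝ) : Prop :=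
  ∃ (X : Fin 3 → Hs →ₗ.[ℂ] Hs) (P : ProjMeasure E3 Hs),
    IsAsymptoticPosition u l X P ∧
    (∀ Y Q, IsAsymptoticPosition u l Y Q → Y = X) ∧
    (∀ f : SchwartzMap E3 ℂ, ∃ T : Hs →L[ℂ] Hs, P.IsIntegral f T ∧
      ∀ ψ, Tendsto (fun τ => heisenberg u f.toBoundedContinuousFunction τ ψ) l (𝓝 (T ψ))) ∧
    (∀ q : E3, ∃ T : Hs →L[ℂ] Hs, P.IsIntegral (planeWave q) T ∧
      ∀ ψ, Tendsto (fun t => schrEvol u 0 t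
        (mulOp (planeWave ((bracket t)⁻¹ • q)) (schrEvol u t 0 ψ))) l' (𝓝 (T ψ)))

end OscScatt

end

/-! Everything rests on one a priori bound. Along an orbit ψ(τ) = u(τ,0)ψ the energy changes only
because a(τ) does, so the norm of the vector ((p − a)ψ, xψ) grows at most like 2‖ψ‖ times |∫₀^τ
‖e(ρ)‖∞ dρ| (`IsFormSolution.norm_le`, `IsPropagator.norm_potVec_le`). For smooth f with bounded
derivatives the commutator [h(τ), f] = −i∇f·(p − a) − ½Δf is of first order in the kinetic momentum
(`SmoothMultiplier.inner_formVec`), so the time derivative of f(x̃(τ))ψ, tested against vectors, is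
bounded by the derivatives of f times that norm plus ‖ψ‖. By Tonelli the integral of |∫₀^τ ‖e‖∞|
over the whole interval is at most twice that of (π/2 − |ρ|)‖e(ρ)‖∞
(`AdmissibleField.lintegral_le`). The hypothesis thus makes the bound integrable up to ±π/2, and
f(x̃(τ))ψ is Cauchy (`IsPropagator.exists_modulus`).

The same bound controls infinity. Cutoffs at scale n have derivatives of order 1/n and hardly move
between time 0 and any τ, so no mass escapes, uniformly in τ
(`IsPropagator.eventually_norm_cutoff_sub_le`). With uniform approximation of compactly supported
functions by smooth ones, the strong limit exists for every bounded continuous f. It is a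
*-representation Φ in which the cutoffs still tend strongly to 1.

Riesz–Markov turns Φ into finite spectral measures (`exists_isSpectralFamily`). The L² extension of
Φ yields the spectral projections and the operators Φ(y_j), self-adjoint because 1/(y_j ± i) is
bounded and continuous (`IsSpectralFamily.exists_resolvent`). Plane waves and Schwartz functions are
special cases of f. Uniqueness follows from characteristic functions and polarization. The
Schrödinger picture is an exact conjugation identity (`niedererAdj_mulOp_niederer`). -/

noncomputable section

namespace OscScatt

/-! ### Functional calculus of a representation of the bounded continuous functions -/

section SpectralCalculus

variable {α : Type*} [MetricSpace α] [MeasurableSpace α] [BorelSpace α]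
  {H : Type*} [NormedAddCommGroup H] [InnerProductSpace ℂ H] [CompleteSpace H]

/-- The measures `μ ψ` are the spectral measures of the representation `Φ` of the bounded
continuous functions: `⟪ψ, Φ(f) ψ⟫ = ∫ f d(μ ψ)`. -/
def IsSpectralFamily (Φ : (α →ᵇ ℂ) →⋆ₐ[ℂ] (H →L[ℂ] H)) (μ : H → Measure α) : Prop :=
  ∀ ψ f, inner ℂ ψ (Φ f ψ) = ∫ x, f x ∂(μ ψ)

theorem ext_of_forall_integral_complex {μ ν : Measure α} [IsFiniteMeasure μ] [IsFiniteMeasure ν]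
    (h : ∀ f : α →ᵇ ℂ, ∫ x, f x ∂μ = ∫ x, f x ∂ν) : μ = ν := by
  refine ext_of_forall_integral_eq_of_IsFiniteMeasure fun f => ?_
  have h1 := h (BoundedContinuousFunction.ofNormedAddCommGroup (fun x => (f x : ℂ))
    (by fun_prop) ‖f‖ (fun x => by simpa using f.norm_coe_le_norm x))
  simp only [BoundedContinuousFunction.coe_ofNormedAddCommGroup, integral_complex_ofReal] at h1
  exact_mod_cast h1

variable {Φ : (α →ᵇ ℂ) →⋆ₐ[ℂ] (H →L[ℂ] H)} {μ : H → Measure α}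

omit [MeasurableSpace α] [BorelSpace α] in
theorem inner_starAlgHom_apply (Φ : (α →ᵇ ℂ) →⋆ₐ[ℂ] (H →L[ℂ] H)) (f : α →ᵇ ℂ) (φ ψ : H) :
    (inner ℂ (Φ f φ) ψ : ℂ) = inner ℂ φ (Φ (star f) ψ) := by
  rw [map_star, ContinuousLinearMap.star_eq_adjoint, ContinuousLinearMap.adjoint_inner_right]

section

variable [∀ ψ, IsFiniteMeasure (μ ψ)]

/-- Both squares equal ∫ |f|² d(μ ψ), because Φ(f)* Φ(f) = Φ(f̄ f). This isometry identifies the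
closed cyclic subspace of ψ with L²(μ ψ) and lets Φ extend to unbounded functions. -/
theorem IsSpectralFamily.norm_apply (hμ : IsSpectralFamily Φ μ) (f : α →ᵇ ℂ) (ψ : H) :
    ‖Φ f ψ‖ = ‖BoundedContinuousFunction.toLp 2 (μ ψ) ℂ f‖ := by
  have h1 : (inner ℂ (Φ f ψ) (Φ f ψ) : ℂ) = inner ℂ
      (BoundedContinuousFunction.toLp 2 (μ ψ) ℂ f)
      (BoundedContinuousFunction.toLp 2 (μ ψ) ℂ f) := by
    rw [inner_starAlgHom_apply, ← mul_apply_eq_comp, ← map_mul, hμ, L2.inner_def]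
    refine integral_congr_ae ?_
    filter_upwards [BoundedContinuousFunction.coeFn_toLp (μ ψ) (p := 2) (𝕜 := ℂ) f] with x hx
    rw [hx]
    simp only [BoundedContinuousFunction.coe_mul, BoundedContinuousFunction.coe_star, Pi.mul_apply,
      Pi.star_apply, RCLike.inner_apply, Complex.star_def]
    ring
  rw [inner_self_eq_norm_sq_to_K, inner_self_eq_norm_sq_to_K] at h1
  have h2 : ‖Φ f ψ‖ ^ 2 = ‖BoundedContinuousFunction.toLp 2 (μ ψ) ℂ f‖ ^ 2 := by exact_mod_cast h1
  exact (pow_left_inj₀ (norm_nonneg _) (norm_nonneg _) two_ne_zero).1 h2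

variable (Φ) in
/-- The linear map `f ↦ Φ(f) ψ`. -/
def orbitMap (ψ : H) : (α →ᵇ ℂ) →ₗ[ℂ] H where
  toFun f := Φ f ψ
  map_add' f g := by rw [map_add]; rfl
  map_smul' c f := by rw [map_smul]; rfl

variable (Φ μ) in
/-- The isometry `g ↦ Φ(g) ψ` of `L²(μ ψ)` into the Hilbert space. -/
def cyclicMap (ψ : H) : Lp ℂ 2 (μ ψ) →L[ℂ] H :=
  LinearMap.extendOfNorm (orbitMap Φ ψ)
    (BoundedContinuousFunction.toLp (α := α) (E := ℂ) 2 (μ ψ) ℂ).toLinearMap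

theorem IsSpectralFamily.cyclicMap_toLp (hμ : IsSpectralFamily Φ μ) (f : α →ᵇ ℂ) (ψ : H) :
    cyclicMap Φ μ ψ (BoundedContinuousFunction.toLp 2 (μ ψ) ℂ f) = Φ f ψ := by
  have hd : DenseRange (BoundedContinuousFunction.toLp (α := α) (E := ℂ) 2 (μ ψ) ℂ).toLinearMap :=
    BoundedContinuousFunction.toLp_denseRange ℂ (μ ψ) ℂ ENNReal.ofNat_ne_top
  have hn : ∃ C, ∀ x, ‖orbitMap Φ ψ x‖ ≤ C * ‖(BoundedContinuousFunction.toLp (α := α) (E := ℂ) 2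
      (μ ψ) ℂ).toLinearMap x‖ :=
    ⟨1, fun x => by rw [one_mul]; exact (hμ.norm_apply x ψ).le⟩
  exact LinearMap.extendOfNorm_eq hd hn f

theorem IsSpectralFamily.norm_cyclicMap (hμ : IsSpectralFamily Φ μ) (ψ : H) (g : Lp ℂ 2 (μ ψ)) :
    ‖cyclicMap Φ μ ψ g‖ = ‖g‖ := by
  refine (BoundedContinuousFunction.toLp_denseRange ℂ (μ ψ) ℂ (by simp)).induction_on
    (p := fun g => ‖cyclicMap Φ μ ψ g‖ = ‖g‖) g ?_ fun f => ?_
  · exact isClosed_eq (by fun_prop) (by fun_prop)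
  · rw [hμ.cyclicMap_toLp, hμ.norm_apply]

open Classical in
variable (Φ μ) in
/-- The vector `Φ(g) ψ`, for `g` square integrable with respect to the spectral measure of `ψ`. -/
def calcVec (g : α → ℂ) (ψ : H) : H :=
  if h : MemLp g 2 (μ ψ) then cyclicMap Φ μ ψ h.toLp else 0

theorem calcVec_of_memLp {g : α → ℂ} {ψ : H} (h : MemLp g 2 (μ ψ)) :
    calcVec Φ μ g ψ = cyclicMap Φ μ ψ h.toLp := by
  rw [calcVec, dif_pos h]

theorem memLp_coe (ν : Measure α) [IsFiniteMeasure ν] (f : α →ᵇ ℂ) : MemLp f 2 ν :=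
  MemLp.of_bound f.continuous.aestronglyMeasurable ‖f‖ (Eventually.of_forall f.norm_coe_le_norm)

theorem IsSpectralFamily.calcVec_coe (hμ : IsSpectralFamily Φ μ) (f : α →ᵇ ℂ) (ψ : H) :
    calcVec Φ μ f ψ = Φ f ψ := by
  rw [calcVec_of_memLp (memLp_coe _ f), ← hμ.cyclicMap_toLp]
  rfl

theorem calcVec_sub {g k : α → ℂ} {ψ : H} (hg : MemLp g 2 (μ ψ)) (hk : MemLp k 2 (μ ψ)) :
    calcVec Φ μ (g - k) ψ = calcVec Φ μ g ψ - calcVec Φ μ k ψ := by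
  rw [calcVec_of_memLp hg, calcVec_of_memLp hk, calcVec_of_memLp (hg.sub hk), MemLp.toLp_sub hg hk,
    map_sub]

theorem calcVec_add {g k : α → ℂ} {ψ : H} (hg : MemLp g 2 (μ ψ)) (hk : MemLp k 2 (μ ψ)) :
    calcVec Φ μ (g + k) ψ = calcVec Φ μ g ψ + calcVec Φ μ k ψ := by
  rw [calcVec_of_memLp hg, calcVec_of_memLp hk, calcVec_of_memLp (hg.add hk), MemLp.toLp_add hg hk,
    map_add]

theorem IsSpectralFamily.norm_calcVec (hμ : IsSpectralFamily Φ μ) {g : α → ℂ} {ψ : H}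
    (hg : MemLp g 2 (μ ψ)) : ‖calcVec Φ μ g ψ‖ = (eLpNorm g 2 (μ ψ)).toReal := by
  rw [calcVec_of_memLp hg, hμ.norm_cyclicMap, Lp.norm_toLp]

theorem IsSpectralFamily.tendsto_calcVec (hμ : IsSpectralFamily Φ μ) {ι : Type*} {l : Filter ι}
    {f : ι → α → ℂ} {g : α → ℂ} {ψ : H} (hf : ∀ n, MemLp (f n) 2 (μ ψ)) (hg : MemLp g 2 (μ ψ))
    (h : Tendsto (fun n => eLpNorm (f n - g) 2 (μ ψ)) l (𝓝 0)) :
    Tendsto (fun n => calcVec Φ μ (f n) ψ) l (𝓝 (calcVec Φ μ g ψ)) := by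
  rw [tendsto_iff_norm_sub_tendsto_zero]
  have : ∀ n, ‖calcVec Φ μ (f n) ψ - calcVec Φ μ g ψ‖ = (eLpNorm (f n - g) 2 (μ ψ)).toReal := by
    intro n
    rw [← calcVec_sub (hf n) hg, hμ.norm_calcVec ((hf n).sub hg)]
  simp only [this]
  exact (ENNReal.tendsto_toReal ENNReal.zero_ne_top).comp h

theorem exists_seq_tendsto_eLpNorm {ν : Measure α} [IsFiniteMeasure ν] {g : α → ℂ}
    (hg : MemLp g 2 ν) : ∃ f : ℕ → (α →ᵇ ℂ),
      Tendsto (fun n => eLpNorm (⇑(f n) - g) 2 ν) atTop (𝓝 0) := by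
  obtain ⟨u, -, hu, hu0⟩ := exists_seq_strictAnti_tendsto' (zero_lt_one' ENNReal)
  have h1 := fun n => hg.exists_boundedContinuous_eLpNorm_sub_le (by simp) (hu n).1.ne'
  choose f hf _ using h1
  refine ⟨f, tendsto_of_tendsto_of_tendsto_of_le_of_le tendsto_const_nhds hu0
    (fun n => zero_le) (fun n => ?_)⟩
  rw [eLpNorm_sub_comm]
  exact hf n

/-- Approximation of `Φ(g) θ` by `Φ(f n) θ` with continuous `f n`, simultaneously for all vectors
with spectral measure below `ν`. -/
theorem IsSpectralFamily.exists_seq (hμ : IsSpectralFamily Φ μ) {ν : Measure α} [IsFiniteMeasure ν]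
    {g : α → ℂ} (hg : MemLp g 2 ν) : ∃ f : ℕ → (α →ᵇ ℂ), ∀ θ, μ θ ≤ ν →
      Tendsto (fun n => Φ (f n) θ) atTop (𝓝 (calcVec Φ μ g θ)) ∧
      Tendsto (fun n => Φ (star (f n)) θ) atTop (𝓝 (calcVec Φ μ (star g) θ)) := by
  obtain ⟨f, hf⟩ := exists_seq_tendsto_eLpNorm hg
  refine ⟨f, fun θ hθ => ?_⟩
  have h1 : Tendsto (fun n => eLpNorm (⇑(f n) - g) 2 (μ θ)) atTop (𝓝 0) :=
    tendsto_of_tendsto_of_tendsto_of_le_of_le tendsto_const_nhds hf (fun n => zero_le)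
      fun n => eLpNorm_mono_measure _ hθ
  constructor
  · have := hμ.tendsto_calcVec (fun n => memLp_coe (μ θ) (f n)) (hg.mono_measure hθ) h1
    simpa only [hμ.calcVec_coe] using this
  · have := hμ.tendsto_calcVec (ψ := θ) (f := fun n => ⇑(star (f n))) (g := star g) (l := atTop)
      (fun n => memLp_coe (μ θ) (star (f n))) (hg.mono_measure hθ).star (by
        refine h1.congr fun n => ?_
        refine eLpNorm_congr_norm_ae (Eventually.of_forall fun x => ?_)
        rw [Pi.sub_apply, Pi.sub_apply, Pi.star_apply, BoundedContinuousFunction.coe_star,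
          Pi.star_apply, ← star_sub, norm_star])
    simpa only [hμ.calcVec_coe] using this

/-- The parallelogram law of the forms ⟪ψ, Φ(f) ψ⟫, read as an identity of measures. The domination
that it implies makes the domains of unbounded functions closed under addition. -/
theorem IsSpectralFamily.measure_add (hμ : IsSpectralFamily Φ μ) (φ ψ : H) :
    μ (φ + ψ) + μ (φ - ψ) = (2 : ENNReal) • (μ φ + μ ψ) := by
  have : IsFiniteMeasure ((2 : ENNReal) • (μ φ + μ ψ)) := Measure.smul_finite _ (by simp)
  refine ext_of_forall_integral_complex fun f => ?_
  have hi : ∀ ψ, Integrable f (μ ψ) := fun ψ => f.integrable (μ ψ)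
  rw [integral_add_measure (hi _) (hi _), integral_smul_measure, integral_add_measure (hi _) (hi _),
    ← hμ, ← hμ, ← hμ, ← hμ]
  simp only [map_add, map_sub, inner_add_left, inner_add_right, inner_sub_left, inner_sub_right,
    ENNReal.toReal_ofNat, Complex.real_smul]
  push_cast
  ring

theorem IsSpectralFamily.measure_add_le (hμ : IsSpectralFamily Φ μ) (φ ψ : H) :
    μ (φ + ψ) ≤ (2 : ENNReal) • (μ φ + μ ψ) :=
  hμ.measure_add φ ψ ▸ Measure.le_add_right le_rfl

theorem IsSpectralFamily.measure_smul (hμ : IsSpectralFamily Φ μ) (c : ℂ) (ψ : H) :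
    μ (c • ψ) = ENNReal.ofReal (‖c‖ ^ 2) • μ ψ := by
  have : IsFiniteMeasure (ENNReal.ofReal (‖c‖ ^ 2) • μ ψ) := Measure.smul_finite _ (by simp)
  refine ext_of_forall_integral_complex fun f => ?_
  rw [integral_smul_measure, ← hμ, ← hμ, map_smul, inner_smul_left, inner_smul_right, ← mul_assoc,
    ENNReal.toReal_ofReal (by positivity), Complex.real_smul, mul_comm (starRingEnd ℂ c),
    Complex.mul_conj, Complex.normSq_eq_norm_sq]

omit [MetricSpace α] [BorelSpace α] in
theorem memLp_two_add_measure {μ ν : Measure α} {g : α → ℂ} (h1 : MemLp g 2 μ) (h2 : MemLp g 2 ν) :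
    MemLp g 2 (μ + ν) := by
  refine ⟨h1.1.add_measure h2.1, ?_⟩
  have h3 := h1.2
  have h4 := h2.2
  rw [eLpNorm_lt_top_iff_lintegral_rpow_enorm_lt_top (by simp) (by simp)] at *
  rw [lintegral_add_measure]
  exact ENNReal.add_lt_top.2 ⟨h3, h4⟩

theorem IsSpectralFamily.memLp_add (hμ : IsSpectralFamily Φ μ) {g : α → ℂ} {φ ψ : H}
    (h1 : MemLp g 2 (μ φ)) (h2 : MemLp g 2 (μ ψ)) : MemLp g 2 (μ (φ + ψ)) :=
  ((memLp_two_add_measure h1 h2).smul_measure (by simp)).mono_measure (hμ.measure_add_le φ ψ)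

theorem IsSpectralFamily.memLp_smul (hμ : IsSpectralFamily Φ μ) {g : α → ℂ} {ψ : H}
    (h1 : MemLp g 2 (μ ψ)) (c : ℂ) : MemLp g 2 (μ (c • ψ)) := by
  rw [hμ.measure_smul]
  exact h1.smul_measure (by simp)

/-- `calcVec` is built separately in each L²(μ ψ), so its linearity in the vector is not automatic.
A single sequence of continuous functions, converging in L² of a measure above all the spectral
measures involved, reduces it to the linearity of Φ (f n). -/
theorem IsSpectralFamily.calcVec_add_vec (hμ : IsSpectralFamily Φ μ) {g : α → ℂ} {φ ψ : H}
    (h1 : MemLp g 2 (μ φ)) (h2 : MemLp g 2 (μ ψ)) :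
    calcVec Φ μ g (φ + ψ) = calcVec Φ μ g φ + calcVec Φ μ g ψ := by
  obtain ⟨f, hf⟩ := hμ.exists_seq (memLp_two_add_measure (memLp_two_add_measure h1 h2)
    (hμ.memLp_add h1 h2))
  have h3 := (hf φ ((Measure.le_add_right le_rfl).trans (Measure.le_add_right le_rfl))).1
  have h4 := (hf ψ ((Measure.le_add_left le_rfl).trans (Measure.le_add_right le_rfl))).1
  have h5 := (hf (φ + ψ) (Measure.le_add_left le_rfl)).1
  refine tendsto_nhds_unique h5 ?_
  simpa only [map_add] using h3.add h4

theorem IsSpectralFamily.calcVec_smul_vec (hμ : IsSpectralFamily Φ μ) {g : α → ℂ} {ψ : H}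
    (h1 : MemLp g 2 (μ ψ)) (c : ℂ) :
    calcVec Φ μ g (c • ψ) = c • calcVec Φ μ g ψ := by
  obtain ⟨f, hf⟩ := hμ.exists_seq (memLp_two_add_measure h1 (hμ.memLp_smul h1 c))
  have h4 := (hf ψ (Measure.le_add_right le_rfl)).1
  have h5 := (hf (c • ψ) (Measure.le_add_left le_rfl)).1
  refine tendsto_nhds_unique h5 ?_
  simpa only [map_smul] using h4.const_smul c

theorem IsSpectralFamily.inner_calcVec_left (hμ : IsSpectralFamily Φ μ) {g : α → ℂ} {φ ψ : H}
    (h1 : MemLp g 2 (μ φ)) (h2 : MemLp g 2 (μ ψ)) :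
    (inner ℂ (calcVec Φ μ g φ) ψ : ℂ) = inner ℂ φ (calcVec Φ μ (star g) ψ) := by
  obtain ⟨f, hf⟩ := hμ.exists_seq (memLp_two_add_measure h1 h2)
  have h3 := (hf φ (Measure.le_add_right le_rfl)).1
  have h4 := (hf ψ (Measure.le_add_left le_rfl)).2
  refine tendsto_nhds_unique (h3.inner tendsto_const_nhds) ?_
  simpa only [inner_starAlgHom_apply] using tendsto_const_nhds.inner h4

theorem IsSpectralFamily.inner_calcVec (hμ : IsSpectralFamily Φ μ) {g : α → ℂ} {ψ : H}
    (h : MemLp g 2 (μ ψ)) : (inner ℂ ψ (calcVec Φ μ g ψ) : ℂ) = ∫ x, g x ∂(μ ψ) := by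
  obtain ⟨f, hf⟩ := exists_seq_tendsto_eLpNorm h
  have h1 := hμ.tendsto_calcVec (fun n => memLp_coe (μ ψ) (f n)) h hf
  simp only [hμ.calcVec_coe] at h1
  refine tendsto_nhds_unique (tendsto_const_nhds.inner h1) ?_
  simp only [hμ ψ]
  refine tendsto_integral_of_L1' _ h.1 (Eventually.of_forall fun n =>
    (f n).integrable (μ ψ)) ?_
  -- For a finite measure, convergence in L² implies convergence in L¹.
  have h2 : Tendsto (fun n => eLpNorm (⇑(f n) - g) 2 (μ ψ) *
      (μ ψ) univ ^ (1 / (1 : ENNReal).toReal - 1 / (2 : ENNReal).toReal)) atTop (𝓝 0) := by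
    have := ENNReal.Tendsto.mul_const (b := (μ ψ) univ ^ (1 / (1 : ENNReal).toReal -
      1 / (2 : ENNReal).toReal)) hf (Or.inr (ENNReal.rpow_ne_top_of_nonneg (by norm_num)
        (measure_ne_top _ _)))
    simpa using this
  refine tendsto_of_tendsto_of_tendsto_of_le_of_le tendsto_const_nhds h2 (fun n => zero_le)
    fun n => ?_
  exact eLpNorm_le_eLpNorm_mul_rpow_measure_univ (by norm_num)
    ((f n).continuous.aestronglyMeasurable.sub h.1)

/-- From ⟪Φ(f)ψ, Φ(k)Φ(f)ψ⟫ = ⟪ψ, Φ(f̄ k f)ψ⟫, valid for every bounded continuous k. -/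
theorem IsSpectralFamily.measure_apply_vec (hμ : IsSpectralFamily Φ μ) (f : α →ᵇ ℂ) (ψ : H) :
    μ (Φ f ψ) = (μ ψ).withDensity (fun x => ‖f x‖ₑ ^ 2) := by
  have hm : Measurable fun x => ‖f x‖₊ ^ 2 := by fun_prop
  have he : (fun x => ‖f x‖ₑ ^ 2) = fun x => ((‖f x‖₊ ^ 2 : NNReal) : ENNReal) := by
    ext x; simp [enorm]
  have : IsFiniteMeasure ((μ ψ).withDensity (fun x => ‖f x‖ₑ ^ 2)) := by
    refine isFiniteMeasure_withDensity ?_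
    refine (IsFiniteMeasure.lintegral_lt_top_of_bounded_to_ennreal _ ⟨‖f‖₊ ^ 2, fun x => ?_⟩).ne
    push_cast
    gcongr
    exact ENNReal.coe_le_coe.2 (f.norm_coe_le_norm x)
  refine ext_of_forall_integral_complex fun k => ?_
  rw [he, integral_withDensity_eq_integral_smul hm, ← hμ, inner_starAlgHom_apply,
    ← mul_apply_eq_comp, ← mul_apply_eq_comp, ← map_mul, ← map_mul, hμ]
  congr 1 with x
  simp only [BoundedContinuousFunction.coe_mul, BoundedContinuousFunction.coe_star, Pi.mul_apply,
    Pi.star_apply, NNReal.smul_def, NNReal.coe_pow, coe_nnnorm, Complex.real_smul,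
    Complex.ofReal_pow, ← Complex.conj_mul', Complex.star_def]
  ring

theorem IsSpectralFamily.eLpNorm_apply_vec (hμ : IsSpectralFamily Φ μ) (f : α →ᵇ ℂ) (ψ : H)
    (g : α → ℂ) : eLpNorm g 2 (μ (Φ f ψ)) = eLpNorm (fun x => g x * f x) 2 (μ ψ) := by
  have hm : Measurable fun x => ‖f x‖ₑ ^ 2 := by fun_prop
  rw [hμ.measure_apply_vec, eLpNorm_eq_lintegral_rpow_enorm_toReal (by simp) (by simp),
    eLpNorm_eq_lintegral_rpow_enorm_toReal (by simp) (by simp),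
    lintegral_withDensity_eq_lintegral_mul_non_measurable _ hm
      (Eventually.of_forall fun x => by simp)]
  congr 2
  ext x
  simp [enorm_mul, mul_pow, mul_comm]

theorem IsSpectralFamily.memLp_apply_vec (hμ : IsSpectralFamily Φ μ) (f : α →ᵇ ℂ) (ψ : H)
    {g : α → ℂ} (hgm : Measurable g) (hg : MemLp (fun x => g x * f x) 2 (μ ψ)) :
    MemLp g 2 (μ (Φ f ψ)) :=
  ⟨hgm.aestronglyMeasurable, by rw [hμ.eLpNorm_apply_vec]; exact hg.2⟩

/-- The rule Φ(g)Φ(f) = Φ(gf) for possibly unbounded g. Norms in L²(μ (Φ f ψ)) are weighted norms in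
L²(μ ψ), so the same continuous approximants of g serve on both sides. The resolvents of the
position operators come from this rule. -/
theorem IsSpectralFamily.calcVec_apply_vec (hμ : IsSpectralFamily Φ μ) (f : α →ᵇ ℂ) (ψ : H)
    {g : α → ℂ} (hgm : Measurable g) (hg : MemLp (fun x => g x * f x) 2 (μ ψ)) :
    calcVec Φ μ g (Φ f ψ) = calcVec Φ μ (fun x => g x * f x) ψ := by
  have h1 := hμ.memLp_apply_vec f ψ hgm hg
  obtain ⟨k, hk⟩ := exists_seq_tendsto_eLpNorm h1
  have h2 := hμ.tendsto_calcVec (fun n => memLp_coe _ (k n)) h1 hk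
  refine tendsto_nhds_unique h2 ?_
  have h3 := hμ.tendsto_calcVec (ψ := ψ) (f := fun n => ⇑(k n * f)) (l := atTop)
    (fun n => memLp_coe _ (k n * f)) hg (by
      refine hk.congr fun n => ?_
      rw [hμ.eLpNorm_apply_vec]
      congr 1
      ext x
      simp [sub_mul])
  refine h3.congr fun n => ?_
  rw [hμ.calcVec_coe, hμ.calcVec_coe, map_mul]
  rfl

end

end SpectralCalculus


/-! ### Spectral projections and self-adjoint operators of the calculus -/

section SpectralMeasure

/-- A symmetric operator `T` such that `T + i` and `T - i` are onto is self-adjoint. -/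
theorem isSelfAdjoint_of_surjective {H : Type*} [NormedAddCommGroup H] [InnerProductSpace ℂ H]
    [CompleteSpace H] (T : H →ₗ.[ℂ] H)
    (hsym : ∀ x y : T.domain, (inner ℂ (T x) (y : H) : ℂ) = inner ℂ (x : H) (T y))
    (hp : ∀ φ : H, ∃ ψ : T.domain, T ψ + Complex.I • (ψ : H) = φ)
    (hm : ∀ φ : H, ∃ ψ : T.domain, T ψ - Complex.I • (ψ : H) = φ) : IsSelfAdjoint T := by
  have hd : Dense (T.domain : Set H) := by
    rw [Submodule.dense_iff_topologicalClosure_eq_top, Submodule.topologicalClosure_eq_top_iff,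
      Submodule.eq_bot_iff]
    intro v hv
    -- For v orthogonal to the domain, v = (T + i)w and w = (T − i)θ give 0 = ⟪θ, v⟫ = ⟪(T − i)θ, w⟫
    -- = ‖w‖².
    obtain ⟨w, hw⟩ := hp v
    obtain ⟨θ, hθ⟩ := hm w
    have h1 : (inner ℂ (θ : H) v : ℂ) = 0 := (Submodule.mem_orthogonal _ _).1 hv θ θ.2
    have h2 : (inner ℂ (w : H) (w : H) : ℂ) = 0 := by
      rw [← hw, ← inner_conj_symm, map_eq_zero, inner_add_left, hsym, inner_smul_left] at h1
      nth_rewrite 2 [← hθ]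
      rw [inner_sub_right, inner_smul_right, ← h1, Complex.conj_I]
      ring
    have h3 : w = 0 := by
      ext
      simpa using h2
    rw [← hw, h3]
    simp
  have hle : T ≤ T.adjoint := LinearPMap.IsFormalAdjoint.le_adjoint hd fun x y => hsym x y
  refine (LinearPMap.eq_of_le_of_domain_eq hle (le_antisymm hle.1 fun ψ hψ => ?_)).symm
  -- For ψ in the domain of the adjoint, χ solves (T + i)χ = (T* + i)ψ. Then ψ − χ is orthogonal to
  -- the range of T − i, which is the whole space.
  obtain ⟨χ, hχ⟩ := hp (T.adjoint ⟨ψ, hψ⟩ + Complex.I • ψ)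
  obtain ⟨θ, hθ⟩ := hm (ψ - χ)
  have h1 : (inner ℂ (ψ - χ) (ψ - χ) : ℂ) = 0 := by
    nth_rewrite 2 [← hθ]
    have h2 : (inner ℂ (T.adjoint ⟨ψ, hψ⟩) (θ : H) : ℂ) = inner ℂ ψ (T θ) :=
      LinearPMap.adjoint_isFormalAdjoint hd ⟨ψ, hψ⟩ θ
    have h3 := hsym χ θ
    have h4 := congrArg (fun v => (inner ℂ v (θ : H) : ℂ)) hχ
    simp only [inner_add_left, inner_smul_left, Complex.conj_I, h2, h3] at h4
    simp only [inner_sub_left, inner_sub_right, inner_smul_right]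
    linear_combination (-1 : ℂ) * h4
  rw [inner_self_eq_zero, sub_eq_zero] at h1
  rw [h1]
  exact χ.2

variable {α : Type*} [MetricSpace α] [MeasurableSpace α] [BorelSpace α]
  {H : Type*} [NormedAddCommGroup H] [InnerProductSpace ℂ H] [CompleteSpace H]
  {Φ : (α →ᵇ ℂ) →⋆ₐ[ℂ] (H →L[ℂ] H)} {μ : H → Measure α} [∀ ψ, IsFiniteMeasure (μ ψ)]

omit [MetricSpace α] [BorelSpace α] in
theorem memLp_indicator_one (ν : Measure α) [IsFiniteMeasure ν] {s : Set α} (hs : MeasurableSet s) :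
    MemLp (s.indicator (1 : α → ℂ)) 2 ν :=
  (memLp_const (1 : ℂ)).indicator hs

omit [BorelSpace α] [∀ ψ, IsFiniteMeasure (μ ψ)] in
theorem IsSpectralFamily.measureReal_univ (hμ : IsSpectralFamily Φ μ) (ψ : H) :
    (μ ψ).real univ = ‖ψ‖ ^ 2 := by
  have h := hμ ψ 1
  rw [map_one] at h
  simp only [one_apply_eq_self, BoundedContinuousFunction.coe_one, Pi.one_apply, integral_const,
    Complex.real_smul, mul_one, inner_self_eq_norm_sq_to_K] at h
  refine Complex.ofReal_injective (h.symm.trans ?_)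
  push_cast
  rfl

theorem IsSpectralFamily.norm_sq_indicator (hμ : IsSpectralFamily Φ μ) (ψ : H) {s : Set α}
    (hs : MeasurableSet s) : ‖calcVec Φ μ (s.indicator 1) ψ‖ ^ 2 = (μ ψ).real s := by
  rw [hμ.norm_calcVec (memLp_indicator_one _ hs)]
  have h := eLpNorm_indicator_const (μ := μ ψ) (c := (1 : ℂ)) (p := 2) hs (by simp) (by simp)
  have h1 : (s.indicator (1 : α → ℂ)) = s.indicator fun _ => 1 := rfl
  rw [h1, h, ENNReal.toReal_mul, ← ENNReal.toReal_rpow, ← Measure.real]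
  simp only [enorm_one, ENNReal.toReal_one, one_mul, ENNReal.toReal_ofNat]
  rw [← Real.sqrt_eq_rpow, Real.sq_sqrt measureReal_nonneg]

theorem IsSpectralFamily.norm_indicator_le (hμ : IsSpectralFamily Φ μ) (ψ : H) {s : Set α}
    (hs : MeasurableSet s) : ‖calcVec Φ μ (s.indicator 1) ψ‖ ≤ ‖ψ‖ := by
  refine le_of_sq_le_sq ?_ (norm_nonneg _)
  rw [hμ.norm_sq_indicator ψ hs, ← hμ.measureReal_univ]
  exact measureReal_mono (subset_univ s)

/-- The spectral projection of a measurable set. -/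
def IsSpectralFamily.projCLM (hμ : IsSpectralFamily Φ μ) (s : Set α) (hs : MeasurableSet s) :
    H →L[ℂ] H :=
  LinearMap.mkContinuous
    { toFun := calcVec Φ μ (s.indicator 1)
      map_add' := fun φ ψ =>
        hμ.calcVec_add_vec (memLp_indicator_one _ hs) (memLp_indicator_one _ hs)
      map_smul' := fun c ψ => hμ.calcVec_smul_vec (memLp_indicator_one _ hs) c } 1
    fun ψ => by rw [one_mul]; exact hμ.norm_indicator_le ψ hs

theorem IsSpectralFamily.projCLM_apply (hμ : IsSpectralFamily Φ μ) {s : Set α}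
    (hs : MeasurableSet s) (ψ : H) : hμ.projCLM s hs ψ = calcVec Φ μ (s.indicator 1) ψ := rfl

/-- `calcVec_apply_vec` multiplies by continuous functions only, so idempotence is read off from
quadratic forms: ‖Pψ‖² = μ ψ (s) = ⟪ψ, Pψ⟫ and P is symmetric, while over ℂ an operator with
vanishing quadratic form is zero. -/
theorem IsSpectralFamily.isStarProjection_projCLM (hμ : IsSpectralFamily Φ μ) {s : Set α}
    (hs : MeasurableSet s) : IsStarProjection (hμ.projCLM s hs) := by
  have hstar : star (s.indicator (1 : α → ℂ)) = s.indicator 1 := by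
    ext x
    by_cases hx : x ∈ s <;> simp [hx]
  have hsym : ∀ φ ψ, (inner ℂ (hμ.projCLM s hs φ) ψ : ℂ) = inner ℂ φ (hμ.projCLM s hs ψ) := by
    intro φ ψ
    rw [hμ.projCLM_apply, hμ.projCLM_apply, hμ.inner_calcVec_left (memLp_indicator_one _ hs)
      (memLp_indicator_one _ hs), hstar]
  refine ⟨?_, ContinuousLinearMap.isSelfAdjoint_iff_isSymmetric.2 hsym⟩
  have h0 : (hμ.projCLM s hs * hμ.projCLM s hs - hμ.projCLM s hs).toLinearMap = 0 := by
    rw [← inner_map_self_eq_zero]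
    intro ψ
    have h1 : (inner ℂ (hμ.projCLM s hs ψ) (hμ.projCLM s hs ψ) : ℂ)
        = inner ℂ (hμ.projCLM s hs ψ) ψ := by
      rw [inner_self_eq_norm_sq_to_K, hsym, hμ.projCLM_apply,
        hμ.inner_calcVec (memLp_indicator_one _ hs), integral_indicator hs]
      have := hμ.norm_sq_indicator ψ hs
      simp only [Pi.one_apply, integral_const, measureReal_restrict_apply_univ, Complex.real_smul,
        mul_one]
      rw [← this]
      push_cast
      rfl
    rw [hsym] at h1
    change (inner ℂ (hμ.projCLM s hs (hμ.projCLM s hs ψ) - hμ.projCLM s hs ψ) ψ : ℂ) = 0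
    rw [inner_sub_left, hsym, hsym, h1, hsym, sub_self]
  have h2 : hμ.projCLM s hs * hμ.projCLM s hs - hμ.projCLM s hs = 0 := by
    ext ψ
    exact LinearMap.congr_fun h0 ψ
  exact sub_eq_zero.1 h2

/-- By finite additivity the remainder is the projection of the part not yet covered. Its squared
norm is the μ ψ-measure of that part and tends to zero by countable additivity of μ ψ. -/
theorem IsSpectralFamily.hasSum_projCLM (hμ : IsSpectralFamily Φ μ) {s : ℕ → Set α}
    (hs : ∀ n, MeasurableSet (s n)) (hd : Pairwise fun m n => Disjoint (s m) (s n)) (ψ : H) :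
    HasSum (fun n => hμ.projCLM (s n) (hs n) ψ) (hμ.projCLM (⋃ n, s n) (.iUnion hs) ψ) := by
  have hfin : ∀ F : Finset ℕ, MeasurableSet (⋃ n ∈ F, s n) := fun F =>
    F.measurableSet_biUnion fun n _ => hs n
  have hadd : ∀ F : Finset ℕ, ∑ n ∈ F, calcVec Φ μ ((s n).indicator 1) ψ
      = calcVec Φ μ ((⋃ n ∈ F, s n).indicator 1) ψ := by
    intro F
    induction F using Finset.induction_on with
    | empty =>
      have h := hμ.norm_sq_indicator ψ MeasurableSet.empty
      simp only [measureReal_empty, sq_eq_zero_iff, norm_eq_zero] at h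
      simp [← h]
    | insert a F ha ih =>
      rw [Finset.sum_insert ha, ih, Finset.set_biUnion_insert, ← calcVec_add
        (memLp_indicator_one _ (hs a)) (memLp_indicator_one _ (hfin F))]
      congr 1
      refine (indicator_union_of_disjoint ?_ 1).symm
      simp only [disjoint_iUnion_right]
      exact fun n hn => hd fun h => ha (h ▸ hn)
  have hU := MeasurableSet.iUnion hs
  have hm : HasSum (fun n => (μ ψ).real (s n)) ((μ ψ).real (⋃ n, s n)) := by
    have h := measure_iUnion (μ := μ ψ) hd hs
    rw [Measure.real, h, ENNReal.tsum_toReal_eq fun n => measure_ne_top _ _]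
    refine Summable.hasSum (ENNReal.summable_toReal ?_)
    rw [← h]
    exact measure_ne_top _ _
  simp only [hμ.projCLM_apply]
  rw [HasSum, SummationFilter.unconditional_filter, tendsto_iff_norm_sub_tendsto_zero]
  have h1 : ∀ F : Finset ℕ, ‖∑ n ∈ F, calcVec Φ μ ((s n).indicator 1) ψ
      - calcVec Φ μ ((⋃ n, s n).indicator 1) ψ‖ ^ 2
      = (μ ψ).real (⋃ n, s n) - ∑ n ∈ F, (μ ψ).real (s n) := by
    intro F
    have hsub : (⋃ n ∈ F, s n) ⊆ ⋃ n, s n := iUnion₂_subset fun n _ => subset_iUnion s n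
    have h2 := measureReal_sdiff (μ := μ ψ) hsub (hfin F)
    have h3 : (μ ψ).real (⋃ n ∈ F, s n) = ∑ n ∈ F, (μ ψ).real (s n) :=
      measureReal_biUnion_finset (fun m _ n _ hmn => hd hmn) (fun n _ => hs n)
    rw [hadd, norm_sub_rev, ← calcVec_sub (memLp_indicator_one _ hU)
      (memLp_indicator_one _ (hfin F)), ← indicator_sdiff hsub,
      hμ.norm_sq_indicator ψ (hU.diff (hfin F)), h2, h3]
  have h4 : Tendsto (fun F : Finset ℕ => ‖∑ n ∈ F, calcVec Φ μ ((s n).indicator 1) ψ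
      - calcVec Φ μ ((⋃ n, s n).indicator 1) ψ‖ ^ 2) atTop (𝓝 0) := by
    simp only [h1]
    have := hm
    rw [HasSum, SummationFilter.unconditional_filter] at this
    simpa using this.const_sub ((μ ψ).real (⋃ n, s n))
  have h5 := (Real.continuous_sqrt.tendsto 0).comp h4
  simpa [Function.comp_def, Real.sqrt_sq (norm_nonneg _)] using h5

open Classical in
/-- The projection-valued measure of a representation of the bounded continuous functions. -/
def IsSpectralFamily.projMeasure (hμ : IsSpectralFamily Φ μ) : ProjMeasure α H where
  proj s := if hs : MeasurableSet s then hμ.projCLM s hs else 0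
  isStarProjection s hs := by rw [dif_pos hs]; exact hμ.isStarProjection_projCLM hs
  proj_univ := by
    rw [dif_pos MeasurableSet.univ]
    ext ψ
    have h : (univ : Set α).indicator (1 : α → ℂ) = ⇑(1 : α →ᵇ ℂ) := by
      rw [indicator_univ]
      rfl
    rw [hμ.projCLM_apply, h, hμ.calcVec_coe, map_one]
  hasSum_proj s hs hd ψ := by
    simp only [hs, MeasurableSet.iUnion hs, dite_true]
    exact hμ.hasSum_projCLM hs hd ψ

theorem IsSpectralFamily.measure_projMeasure (hμ : IsSpectralFamily Φ μ) (ψ : H) :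
    hμ.projMeasure.measure ψ = μ ψ := by
  ext s hs
  have h : hμ.projMeasure.proj s ψ = calcVec Φ μ (s.indicator 1) ψ := by
    simp only [projMeasure, hs, dite_true]
    rfl
  rw [ProjMeasure.measure_apply _ _ hs, h, hμ.norm_sq_indicator ψ hs, Measure.real,
    ENNReal.ofReal_toReal (measure_ne_top _ _)]

theorem IsSpectralFamily.isIntegral (hμ : IsSpectralFamily Φ μ) (f : α →ᵇ ℂ) :
    hμ.projMeasure.IsIntegral f (Φ f) := fun ψ => by
  rw [hμ.measure_projMeasure, hμ]

/-- The operator `Φ(h)`, for a measurable real function `h`, with its natural domain. -/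
def IsSpectralFamily.calcPMap (hμ : IsSpectralFamily Φ μ) (h : α → ℝ) (hh : Measurable h) :
    H →ₗ.[ℂ] H where
  domain :=
    { carrier := {ψ | MemLp (fun x => (h x : ℂ)) 2 (μ ψ)}
      add_mem' := fun h1 h2 => hμ.memLp_add h1 h2
      zero_mem' := by
        have h0 : μ 0 = 0 := by simpa using hμ.measure_smul 0 0
        rw [mem_ofPred_eq, h0]
        exact ⟨(Complex.measurable_ofReal.comp hh).aestronglyMeasurable, by simp⟩
      smul_mem' := fun c ψ h1 => hμ.memLp_smul h1 c }
  toFun :=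
    { toFun := fun ψ => calcVec Φ μ (fun x => (h x : ℂ)) ψ
      map_add' := fun φ ψ => hμ.calcVec_add_vec φ.2 ψ.2
      map_smul' := fun c ψ => hμ.calcVec_smul_vec ψ.2 c }

theorem IsSpectralFamily.mem_domain_calcPMap (hμ : IsSpectralFamily Φ μ) {h : α → ℝ}
    (hh : Measurable h) {ψ : H} :
    ψ ∈ (hμ.calcPMap h hh).domain ↔ MemLp (fun x => (h x : ℂ)) 2 (μ ψ) := Iff.rfl

theorem IsSpectralFamily.calcPMap_apply (hμ : IsSpectralFamily Φ μ) {h : α → ℝ}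
    (hh : Measurable h) (ψ : (hμ.calcPMap h hh).domain) :
    hμ.calcPMap h hh ψ = calcVec Φ μ (fun x => (h x : ℂ)) ψ := rfl

/-- The function 1/(h + c) is bounded and continuous, and h/(h + c) is bounded, so Φ(1/(h + c))φ
lies in the domain and solves the equation. The conditions on c say c = ±i and treat both signs at
once. -/
theorem IsSpectralFamily.exists_resolvent (hμ : IsSpectralFamily Φ μ) {h : α → ℝ}
    (hh : Continuous h) {c : ℂ} (hc : c.re = 0) (hc1 : ‖c‖ = 1) (φ : H) :
    ∃ ψ : (hμ.calcPMap h hh.measurable).domain,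
      hμ.calcPMap h hh.measurable ψ + c • (ψ : H) = φ := by
  have him : c.im ^ 2 = 1 := by
    have := Complex.sq_norm c
    rw [hc1, Complex.normSq_apply, hc] at this
    linarith
  have hn : ∀ x, ‖(h x : ℂ) + c‖ ^ 2 = h x ^ 2 + 1 := by
    intro x
    rw [Complex.sq_norm, Complex.normSq_apply]
    simp only [Complex.add_re, Complex.ofReal_re, Complex.add_im, Complex.ofReal_im, hc]
    linear_combination him
  have hne : ∀ x, (h x : ℂ) + c ≠ 0 := by
    intro x hx
    have := hn x
    rw [hx, norm_zero] at this
    nlinarith [sq_nonneg (h x)]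
  have hone : ∀ x, 1 ≤ ‖(h x : ℂ) + c‖ := fun x => by
    nlinarith [hn x, sq_nonneg (h x), norm_nonneg ((h x : ℂ) + c)]
  have hle : ∀ x, ‖(h x : ℂ)‖ ≤ ‖(h x : ℂ) + c‖ := fun x => by
    have := hn x
    refine le_of_sq_le_sq ?_ (norm_nonneg _)
    rw [this, Complex.norm_real, Real.norm_eq_abs, sq_abs]
    linarith
  let f : α →ᵇ ℂ := BoundedContinuousFunction.ofNormedAddCommGroup (fun x => ((h x : ℂ) + c)⁻¹)
    (Continuous.inv₀ (by fun_prop) hne) 1 (fun x => by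
      rw [norm_inv]; exact inv_le_one_of_one_le₀ (hone x))
  have hm : Measurable fun x => (h x : ℂ) := Complex.measurable_ofReal.comp hh.measurable
  have hg : MemLp (fun x => (h x : ℂ) * f x) 2 (μ φ) := by
    refine MemLp.of_bound (by fun_prop) 1 (Eventually.of_forall fun x => ?_)
    rw [norm_mul, BoundedContinuousFunction.coe_ofNormedAddCommGroup, norm_inv, ← div_eq_mul_inv]
    exact div_le_one_of_le₀ (hle x) (norm_nonneg _)
  refine ⟨⟨Φ f φ, hμ.memLp_apply_vec f φ hm hg⟩, ?_⟩
  rw [hμ.calcPMap_apply]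
  simp only
  have h1 : c • Φ f φ = calcVec Φ μ (⇑(c • f)) φ := by
    rw [hμ.calcVec_coe, map_smul]
    rfl
  rw [hμ.calcVec_apply_vec f φ hm hg, h1, ← calcVec_add hg (memLp_coe _ _)]
  have h2 : ((fun x => (h x : ℂ) * f x) + ⇑(c • f)) = ⇑(1 : α →ᵇ ℂ) := by
    ext x
    simp only [Pi.add_apply, BoundedContinuousFunction.coe_smul, smul_eq_mul,
      BoundedContinuousFunction.coe_one, Pi.one_apply]
    rw [← add_mul]
    exact mul_inv_cancel₀ (hne x)
  rw [h2, hμ.calcVec_coe, map_one]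
  rfl

theorem IsSpectralFamily.isSelfAdjoint_calcPMap (hμ : IsSpectralFamily Φ μ) {h : α → ℝ}
    (hh : Continuous h) : IsSelfAdjoint (hμ.calcPMap h hh.measurable) := by
  refine isSelfAdjoint_of_surjective _ (fun φ ψ => ?_) (fun φ => ?_) (fun φ => ?_)
  · rw [hμ.calcPMap_apply, hμ.calcPMap_apply, hμ.inner_calcVec_left φ.2 ψ.2]
    congr 2
    ext x
    simp
  · exact hμ.exists_resolvent hh Complex.I_re Complex.norm_I φ
  · obtain ⟨ψ, hψ⟩ := hμ.exists_resolvent hh (c := -Complex.I) (by simp) (by simp) φ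
    exact ⟨ψ, by rw [← hψ, neg_smul, sub_eq_add_neg]⟩

theorem IsSpectralFamily.isJointSpectralMeasure {Φ : (E3 →ᵇ ℂ) →⋆ₐ[ℂ] (Hs →L[ℂ] Hs)}
    {μ : Hs → Measure E3} [∀ ψ, IsFiniteMeasure (μ ψ)] (hμ : IsSpectralFamily Φ μ)
    (hc : ∀ j : Fin 3, Measurable fun y : E3 => y j) :
    IsJointSpectralMeasure hμ.projMeasure fun j => hμ.calcPMap (fun y => y j) (hc j) := by
  intro j
  refine ⟨fun ψ => ?_, fun ψ => ?_⟩
  · rw [hμ.mem_domain_calcPMap, hμ.measure_projMeasure,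
      ← memLp_two_iff_integrable_sq (hc j).aestronglyMeasurable]
    refine ⟨fun h => by simpa using h.re, fun h => h.ofReal⟩
  · rw [hμ.calcPMap_apply, hμ.inner_calcVec ψ.2, hμ.measure_projMeasure, integral_complex_ofReal]

end SpectralMeasure


/-! ### Spectral measures from the Riesz–Markov theorem -/

section ExistenceOfMeasures

open scoped CompactlySupported

variable {α : Type*} [MetricSpace α] {H : Type*} [NormedAddCommGroup H] [InnerProductSpace ℂ H]
  [CompleteSpace H]

/-- A compactly supported real function as a bounded continuous complex function. -/
def ccToBounded (f : C_c(α, ℝ)) : α →ᵇ ℂ :=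
  BoundedContinuousFunction.ofNormedAddCommGroup (fun x => (f x : ℂ))
    (Complex.continuous_ofReal.comp f.continuous)
    (f.hasCompactSupport.exists_bound_of_continuous f.continuous).choose
    (fun x => by
      simpa using (f.hasCompactSupport.exists_bound_of_continuous f.continuous).choose_spec x)

theorem ccToBounded_apply (f : C_c(α, ℝ)) (x : α) : ccToBounded f x = (f x : ℂ) := rfl

/-- A nonnegative bounded continuous function is ḡ g with g its square root, which is again bounded
and continuous. -/
theorem inner_real_nonneg (Φ : (α →ᵇ ℂ) →⋆ₐ[ℂ] (H →L[ℂ] H)) {f : α →ᵇ ℂ} {r : α → ℝ}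
    (hr : Continuous r) (h0 : ∀ x, 0 ≤ r x) (hf : ∀ x, f x = (r x : ℂ)) (ψ : H) :
    0 ≤ (inner ℂ ψ (Φ f ψ) : ℂ).re := by
  let g : α →ᵇ ℂ := BoundedContinuousFunction.ofNormedAddCommGroup
    (fun x => (Real.sqrt (r x) : ℂ)) (by fun_prop) (Real.sqrt ‖f‖) (fun x => by
      rw [Complex.norm_real, Real.norm_eq_abs, abs_of_nonneg (Real.sqrt_nonneg _)]
      refine Real.sqrt_le_sqrt ?_
      have := f.norm_coe_le_norm x
      rwa [hf, Complex.norm_real, Real.norm_eq_abs, abs_of_nonneg (h0 x)] at this)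
  have hfg : f = star g * g := by
    ext x
    simp only [hf, g, BoundedContinuousFunction.coe_mul, BoundedContinuousFunction.coe_star,
      Pi.mul_apply, Pi.star_apply, BoundedContinuousFunction.coe_ofNormedAddCommGroup,
      Complex.star_def, Complex.conj_ofReal]
    rw [← Complex.ofReal_mul, Real.mul_self_sqrt (h0 x)]
  rw [hfg, map_mul, mul_apply_eq_comp, ← inner_starAlgHom_apply]
  exact inner_self_nonneg (𝕜 := ℂ)

theorem inner_real_im (Φ : (α →ᵇ ℂ) →⋆ₐ[ℂ] (H →L[ℂ] H)) {f : α →ᵇ ℂ} {r : α → ℝ}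
    (hf : ∀ x, f x = (r x : ℂ)) (ψ : H) : (((inner ℂ ψ (Φ f ψ) : ℂ).re : ℝ) : ℂ)
      = inner ℂ ψ (Φ f ψ) := by
  have hs : star f = f := by
    ext x
    simp [hf]
  have h := inner_starAlgHom_apply Φ f ψ ψ
  rw [hs, ← inner_conj_symm] at h
  exact Complex.conj_eq_iff_re.1 h

/-- The positive functional `f ↦ ⟪ψ, Φ(f) ψ⟫`. -/
def stateFunctional (Φ : (α →ᵇ ℂ) →⋆ₐ[ℂ] (H →L[ℂ] H)) (ψ : H) : C_c(α, ℝ) →ₚ[ℝ] ℝ :=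
  PositiveLinearMap.mk₀
    { toFun := fun f => (inner ℂ ψ (Φ (ccToBounded f) ψ) : ℂ).re
      map_add' := fun f g => by
        have : ccToBounded (f + g) = ccToBounded f + ccToBounded g := by
          ext x
          simp [ccToBounded_apply]
        rw [this, map_add, add_apply, inner_add_right, Complex.add_re]
      map_smul' := fun c f => by
        have : ccToBounded (c • f) = (c : ℂ) • ccToBounded f := by
          ext x
          simp [ccToBounded_apply]
        rw [this, map_smul, smul_apply, inner_smul_right]
        simp }
    fun f hf => inner_real_nonneg Φ f.continuous (fun x => hf x) (ccToBounded_apply f) ψ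

theorem stateFunctional_apply (Φ : (α →ᵇ ℂ) →⋆ₐ[ℂ] (H →L[ℂ] H)) (ψ : H) (f : C_c(α, ℝ)) :
    stateFunctional Φ ψ f = (inner ℂ ψ (Φ (ccToBounded f) ψ) : ℂ).re := rfl

/-- Cutoff functions that exhaust the space and are carried by `Φ` to operators that converge
strongly to the identity. -/
structure IsExhausting (Φ : (α →ᵇ ℂ) →⋆ₐ[ℂ] (H →L[ℂ] H)) (χ : ℕ → C_c(α, ℝ)) : Prop where
  nonneg : ∀ n x, 0 ≤ χ n x
  le_one : ∀ n x, χ n x ≤ 1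
  tendsto_one : ∀ x, Tendsto (fun n => χ n x) atTop (𝓝 1)
  tendsto_apply : ∀ ψ, Tendsto (fun n => Φ (ccToBounded (χ n)) ψ) atTop (𝓝 ψ)

variable [ProperSpace α] [MeasurableSpace α] [BorelSpace α]

/-- Riesz–Markov sees compactly supported functions only, and mass could be lost at infinity. The
cutoffs exclude this: Fatou bounds the total mass by ‖ψ‖², and f χ n can be replaced by f in the
limit, by strong convergence on the operator side and dominated convergence on the measure side. -/
theorem exists_isSpectralFamily {Φ : (α →ᵇ ℂ) →⋆ₐ[ℂ] (H →L[ℂ] H)} {χ : ℕ → C_c(α, ℝ)}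
    (hχ : IsExhausting Φ χ) :
    ∃ μ : H → Measure α, (∀ ψ, IsFiniteMeasure (μ ψ)) ∧ IsSpectralFamily Φ μ := by
  refine ⟨fun ψ => RealRMK.rieszMeasure (stateFunctional Φ ψ), ?_⟩
  have hreg : ∀ ψ, (RealRMK.rieszMeasure (stateFunctional Φ ψ)).Regular := fun ψ =>
    RealRMK.regular_rieszMeasure _
  have hint : ∀ ψ (f : C_c(α, ℝ)), Integrable f (RealRMK.rieszMeasure (stateFunctional Φ ψ)) :=
    fun ψ f => f.continuous.integrable_of_hasCompactSupport f.hasCompactSupport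
  have hcc : ∀ ψ (f : C_c(α, ℝ)), ∫ x, (f x : ℂ) ∂(RealRMK.rieszMeasure (stateFunctional Φ ψ))
      = inner ℂ ψ (Φ (ccToBounded f) ψ) := by
    intro ψ f
    rw [integral_complex_ofReal, RealRMK.integral_rieszMeasure, stateFunctional_apply]
    exact inner_real_im Φ (ccToBounded_apply f) ψ
  have hfin : ∀ ψ, IsFiniteMeasure (RealRMK.rieszMeasure (stateFunctional Φ ψ)) := by
    intro ψ
    set ν := RealRMK.rieszMeasure (stateFunctional Φ ψ)
    have h1 : Tendsto (fun n => ∫ x, χ n x ∂ν) atTop (𝓝 (inner ℂ ψ ψ : ℂ).re) := by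
      have h2 := (Complex.continuous_re.tendsto _).comp
        ((tendsto_const_nhds (x := ψ)).inner (𝕜 := ℂ) (hχ.tendsto_apply ψ))
      refine h2.congr fun n => ?_
      rw [Function.comp_apply, ← hcc, integral_complex_ofReal, Complex.ofReal_re]
    have h3 : ∀ n, ∫⁻ x, ENNReal.ofReal (χ n x) ∂ν = ENNReal.ofReal (∫ x, χ n x ∂ν) := fun n =>
      (ofReal_integral_eq_lintegral_ofReal (hint ψ (χ n))
        (Eventually.of_forall (hχ.nonneg n))).symm
    -- Fatou for the cutoffs, whose integrals converge to ‖ψ‖².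
    have h4 := lintegral_liminf_le (u := atTop) (μ := ν) (f := fun n x => ENNReal.ofReal (χ n x))
      (fun n => (ENNReal.continuous_ofReal.comp (χ n).continuous).measurable)
    simp only [h3] at h4
    have h6 : Tendsto (fun n => ENNReal.ofReal (∫ x, χ n x ∂ν)) atTop
        (𝓝 (ENNReal.ofReal (inner ℂ ψ ψ : ℂ).re)) := (ENNReal.continuous_ofReal.tendsto _).comp h1
    rw [h6.liminf_eq] at h4
    have h5 : ∀ x, liminf (fun n => ENNReal.ofReal (χ n x)) atTop = 1 := fun x => by
      have := (((ENNReal.continuous_ofReal.tendsto _).comp (hχ.tendsto_one x))).liminf_eq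
      simpa [Function.comp_def] using this
    simp only [h5, lintegral_one] at h4
    exact ⟨h4.trans_lt ENNReal.ofReal_lt_top⟩
  refine ⟨hfin, fun ψ f => ?_⟩
  have := hfin ψ
  set ν := RealRMK.rieszMeasure (stateFunctional Φ ψ) with hν
  have h1 : Tendsto (fun n => (inner ℂ ψ (Φ (f * ccToBounded (χ n)) ψ) : ℂ)) atTop
      (𝓝 (inner ℂ ψ (Φ f ψ))) := by
    simp only [map_mul, mul_apply_eq_comp]
    exact tendsto_const_nhds.inner (((Φ f).continuous.tendsto _).comp (hχ.tendsto_apply ψ))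
  have h2 : ∀ n, (inner ℂ ψ (Φ (f * ccToBounded (χ n)) ψ) : ℂ) = ∫ x, f x * (χ n x : ℂ) ∂ν := by
    intro n
    let a : C_c(α, ℝ) := ⟨⟨fun x => (f x).re * χ n x, by fun_prop⟩,
      (χ n).hasCompactSupport.mul_left⟩
    let b : C_c(α, ℝ) := ⟨⟨fun x => (f x).im * χ n x, by fun_prop⟩,
      (χ n).hasCompactSupport.mul_left⟩
    have h3 : f * ccToBounded (χ n) = ccToBounded a + Complex.I • ccToBounded b := by
      ext x
      change f x * (χ n x : ℂ) = (((f x).re * χ n x : ℝ) : ℂ)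
        + Complex.I * (((f x).im * χ n x : ℝ) : ℂ)
      nth_rewrite 1 [← Complex.re_add_im (f x)]
      push_cast
      ring
    rw [h3, map_add, map_smul, add_apply, smul_apply,
      inner_add_right, inner_smul_right, ← hcc, ← hcc, ← integral_const_mul,
      ← integral_add (hint ψ a).ofReal ((hint ψ b).ofReal.const_mul _)]
    refine integral_congr_ae (Eventually.of_forall fun x => ?_)
    exact (DFunLike.congr_fun h3 x).symm
  refine tendsto_nhds_unique h1 ?_
  simp only [h2]
  refine tendsto_integral_of_dominated_convergence (fun _ => ‖f‖) (fun n => ?_)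
    (integrable_const _) (fun n => Eventually.of_forall fun x => ?_)
    (Eventually.of_forall fun x => ?_)
  · exact (f.continuous.mul (Complex.continuous_ofReal.comp (χ n).continuous)).aestronglyMeasurable
  · rw [norm_mul, Complex.norm_real, Real.norm_eq_abs, abs_of_nonneg (hχ.nonneg n x)]
    exact (mul_le_of_le_one_right (norm_nonneg _) (hχ.le_one n x)).trans (f.norm_coe_le_norm x)
  · simpa using (tendsto_const_nhds (x := f x)).mul
      ((Complex.continuous_ofReal.tendsto _).comp (hχ.tendsto_one x))

end ExistenceOfMeasures

/-! ### Uniqueness of the asymptotic operators -/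

section Uniqueness

theorem ProjMeasure.measure_univ {α : Type*} [MeasurableSpace α] {H : Type*} [NormedAddCommGroup H]
    [InnerProductSpace ℂ H] [CompleteSpace H] (P : ProjMeasure α H) (ψ : H) :
    P.measure ψ univ = ENNReal.ofReal (‖ψ‖ ^ 2) := by
  rw [P.measure_apply ψ MeasurableSet.univ, P.proj_univ]
  rfl

/-- Integrals of plane waves form the characteristic function of a spectral measure, and this
determines a finite measure. -/
theorem measure_eq_of_isIntegral_planeWave {P Q : ProjMeasure E3 Hs}
    (h : ∀ q, ∃ T, P.IsIntegral (planeWave q) T ∧ Q.IsIntegral (planeWave q) T) (ψ : Hs) :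
    P.measure ψ = Q.measure ψ := by
  have : IsFiniteMeasure (P.measure ψ) := ⟨by rw [P.measure_univ]; exact ENNReal.ofReal_lt_top⟩
  have : IsFiniteMeasure (Q.measure ψ) := ⟨by rw [Q.measure_univ]; exact ENNReal.ofReal_lt_top⟩
  refine Measure.ext_of_charFun ?_
  ext q
  obtain ⟨T, h1, h2⟩ := h q
  have h3 := (h1 ψ).symm.trans (h2 ψ)
  simp only [planeWave, BoundedContinuousFunction.coe_ofNormedAddCommGroup] at h3
  simp only [charFun_apply, real_inner_comm] at h3 ⊢
  exact h3

/-- The integrability condition fixes the domains. With equal measures the quadratic form of the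
difference S vanishes, so S is zero by polarization and density. -/
theorem IsJointSpectralMeasure.unique {P Q : ProjMeasure E3 Hs} {X Y : Fin 3 → Hs →ₗ.[ℂ] Hs}
    (hX : IsJointSpectralMeasure P X) (hY : IsJointSpectralMeasure Q Y)
    (hd : ∀ j, Dense ((X j).domain : Set Hs)) (h : ∀ ψ, P.measure ψ = Q.measure ψ) : Y = X := by
  funext j
  have hdom : ∀ ψ, ψ ∈ (Y j).domain ↔ ψ ∈ (X j).domain := fun ψ => by
    rw [(hX j).1, (hY j).1, h]
  have hD : (Y j).domain = (X j).domain := SetLike.ext hdom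
  let S : (X j).domain →ₗ[ℂ] Hs :=
    (X j).toFun - (Y j).toFun ∘ₗ Submodule.inclusion hD.ge
  have hS : ∀ ψ, S ψ = X j ψ - Y j ⟨ψ, (hdom _).2 ψ.2⟩ := fun ψ => rfl
  have h0 : ∀ ψ : (X j).domain, (inner ℂ (ψ : Hs) (S ψ) : ℂ) = 0 := by
    intro ψ
    have h1 := (hX j).2 ψ
    have h2 := (hY j).2 ⟨ψ, (hdom _).2 ψ.2⟩
    rw [hS, inner_sub_right, h1, h2, h, sub_self]
  have h1 : ∀ ψ θ : (X j).domain, (inner ℂ (θ : Hs) (S ψ) : ℂ) = 0 := by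
    intro ψ θ
    -- Polarization: ψ + θ and ψ + iθ together isolate ⟪θ, S ψ⟫.
    have e1 := h0 (ψ + θ)
    have e2 := h0 (ψ + Complex.I • θ)
    simp only [map_add, map_smul, Submodule.coe_add, Submodule.coe_smul, inner_add_left,
      inner_add_right, inner_smul_left, inner_smul_right, h0, Complex.conj_I] at e1 e2
    linear_combination (1 / 2 : ℂ) * e1 + (Complex.I / 2 : ℂ) * e2 +
      (1 / 2 : ℂ) * (inner ℂ (θ : Hs) (S ψ) - inner ℂ (ψ : Hs) (S θ)) * Complex.I_sq
  have h2 : ∀ ψ, S ψ = 0 := fun ψ =>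
    (hd j).eq_zero_of_inner_right ℂ fun v hv => h1 ψ ⟨v, hv⟩
  refine LinearPMap.ext hD fun x hx hx' => ?_
  have := h2 ⟨x, hx'⟩
  rw [hS, sub_eq_zero] at this
  exact this.symm

end Uniqueness

/-! ### Strong limits of representations -/

section StrongLimits

variable {α : Type*} [TopologicalSpace α] {H : Type*} [NormedAddCommGroup H]
  [InnerProductSpace ℂ H] [CompleteSpace H]

/-- The approximants for different ε need not be related, since only the Cauchy property is
transferred to F. -/
theorem exists_tendsto_of_approx {ι E : Type*} [NormedAddCommGroup E] [CompleteSpace E]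
    {l : Filter ι} [l.NeBot] {F : ι → E}
    (h : ∀ ε > 0, ∃ G : ι → E, (∃ v, Tendsto G l (𝓝 v)) ∧ ∀ᶠ t in l, ‖F t - G t‖ ≤ ε) :
    ∃ v, Tendsto F l (𝓝 v) := by
  rw [← cauchy_map_iff_exists_tendsto, Metric.cauchy_iff]
  refine ⟨inferInstance, fun ε hε => ?_⟩
  obtain ⟨G, ⟨v, hv⟩, hG⟩ := h (ε / 8) (by positivity)
  refine ⟨F '' {t | ‖F t - G t‖ ≤ ε / 8 ∧ dist (G t) v < ε / 8},
    image_mem_map (hG.and (Metric.tendsto_nhds.1 hv _ (by positivity))), ?_⟩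
  rintro _ ⟨t, ⟨h1, h2⟩, rfl⟩ _ ⟨s, ⟨h3, h4⟩, rfl⟩
  rw [← dist_eq_norm] at h1 h3
  calc dist (F t) (F s) ≤ dist (F t) v + dist (F s) v := dist_triangle_right _ _ _
    _ ≤ (dist (F t) (G t) + dist (G t) v) + (dist (F s) (G s) + dist (G s) v) :=
      add_le_add (dist_triangle _ _ _) (dist_triangle _ _ _)
    _ < ε := by linarith

/-- The strong limit of uniformly bounded representations is a representation. -/
theorem exists_strong_limit {ι : Type*} {l : Filter ι} [l.NeBot]
    (F : ι → (α →ᵇ ℂ) →⋆ₐ[ℂ] (H →L[ℂ] H)) (hF : ∀ t f ψ, ‖F t f ψ‖ ≤ ‖f‖ * ‖ψ‖)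
    (hlim : ∀ f ψ, ∃ v, Tendsto (fun t => F t f ψ) l (𝓝 v)) :
    ∃ Φ : (α →ᵇ ℂ) →⋆ₐ[ℂ] (H →L[ℂ] H), ∀ f ψ, Tendsto (fun t => F t f ψ) l (𝓝 (Φ f ψ)) := by
  choose L hL using hlim
  let T : (α →ᵇ ℂ) → H →L[ℂ] H := fun f => LinearMap.mkContinuous
    { toFun := L f
      map_add' := fun φ ψ => tendsto_nhds_unique (hL f (φ + ψ))
        (by simpa only [map_add] using (hL f φ).add (hL f ψ))
      map_smul' := fun c ψ => tendsto_nhds_unique (hL f (c • ψ))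
        (by simpa only [map_smul, RingHom.id_apply] using (hL f ψ).const_smul c) } ‖f‖
    fun ψ => le_of_tendsto (hL f ψ).norm (Eventually.of_forall fun t => hF t f ψ)
  have hT : ∀ f ψ, Tendsto (fun t => F t f ψ) l (𝓝 (T f ψ)) := hL
  have hmul : ∀ f g, T (f * g) = T f * T g := by
    intro f g
    ext ψ
    refine tendsto_nhds_unique (hT _ ψ) ?_
    have h1 := hT f (T g ψ)
    -- Strong limits multiply because F t f is bounded uniformly in t.
    have h2 : Tendsto (fun t => F t f (F t g ψ - T g ψ)) l (𝓝 0) := by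
      refine squeeze_zero_norm (fun t => hF t f _) ?_
      have := ((hT g ψ).sub_const (T g ψ)).norm.const_mul ‖f‖
      simpa using this
    have h3 := h1.add h2
    rw [add_zero] at h3
    refine h3.congr fun t => ?_
    rw [map_sub, map_mul, mul_apply_eq_comp]
    abel
  refine ⟨
    { toFun := T
      map_one' := ?_
      map_mul' := hmul
      map_zero' := ?_
      map_add' := ?_
      commutes' := ?_
      map_star' := ?_ }, hT⟩
  · ext ψ
    refine tendsto_nhds_unique (hT _ ψ) ?_
    simpa only [map_one] using tendsto_const_nhds
  · ext ψ
    refine tendsto_nhds_unique (hT _ ψ) ?_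
    simpa only [map_zero] using tendsto_const_nhds
  · intro f g
    ext ψ
    refine tendsto_nhds_unique (hT _ ψ) ?_
    simpa only [map_add, add_apply] using (hT f ψ).add (hT g ψ)
  · intro c
    ext ψ
    refine tendsto_nhds_unique (hT _ ψ) ?_
    simpa only [AlgHomClass.commutes] using tendsto_const_nhds
  · intro f
    refine ContinuousLinearMap.ext fun ψ => ext_inner_left ℂ fun φ => ?_
    rw [ContinuousLinearMap.star_eq_adjoint, ContinuousLinearMap.adjoint_inner_right]
    refine tendsto_nhds_unique (tendsto_const_nhds.inner (hT (star f) ψ)) ?_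
    have := (hT f φ).inner (𝕜 := ℂ) (tendsto_const_nhds (x := ψ))
    refine this.congr fun t => ?_
    rw [map_star, ContinuousLinearMap.star_eq_adjoint, ContinuousLinearMap.adjoint_inner_right]

end StrongLimits


/-! ### The representation by multiplication operators -/

section Multiplication

theorem coeFn_mulOp (f : E3 →ᵇ ℂ) (ψ : Hs) : mulOp f ψ =ᵐ[volume] fun x => f x * ψ x :=
  MemLp.coeFn_toLp _

theorem norm_mulOp_le (f : E3 →ᵇ ℂ) (ψ : Hs) : ‖mulOp f ψ‖ ≤ ‖f‖ * ‖ψ‖ := by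
  refine Lp.norm_le_mul_norm_of_ae_le_mul ?_
  filter_upwards [coeFn_mulOp f ψ] with x hx
  rw [hx, norm_mul]
  exact mul_le_mul_of_nonneg_right (f.norm_coe_le_norm x) (norm_nonneg _)

/-- Multiplication by a bounded continuous function as a bounded operator. -/
def mulCLM (f : E3 →ᵇ ℂ) : Hs →L[ℂ] Hs :=
  LinearMap.mkContinuous
    { toFun := mulOp f
      map_add' := fun φ ψ => by
        ext1
        filter_upwards [coeFn_mulOp f (φ + ψ), coeFn_mulOp f φ, coeFn_mulOp f ψ,
          Lp.coeFn_add φ ψ, Lp.coeFn_add (mulOp f φ) (mulOp f ψ)] with x h1 h2 h3 h4 h5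
        rw [h1, h5, h4, Pi.add_apply, Pi.add_apply, h2, h3, mul_add]
      map_smul' := fun c ψ => by
        ext1
        filter_upwards [coeFn_mulOp f (c • ψ), coeFn_mulOp f ψ, Lp.coeFn_smul c ψ,
          Lp.coeFn_smul c (mulOp f ψ)] with x h1 h2 h3 h4
        rw [h1, RingHom.id_apply, h4, h3, Pi.smul_apply, Pi.smul_apply, h2, smul_eq_mul,
          smul_eq_mul]
        ring } ‖f‖ (norm_mulOp_le f)

theorem mulCLM_apply (f : E3 →ᵇ ℂ) (ψ : Hs) : mulCLM f ψ = mulOp f ψ := rfl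

theorem inner_mulOp_left (f : E3 →ᵇ ℂ) (φ ψ : Hs) :
    (inner ℂ (mulOp f φ) ψ : ℂ) = inner ℂ φ (mulOp (star f) ψ) := by
  rw [L2.inner_def, L2.inner_def]
  refine integral_congr_ae ?_
  filter_upwards [coeFn_mulOp f φ, coeFn_mulOp (star f) ψ] with x h1 h2
  rw [h1, h2]
  simp only [RCLike.inner_apply, map_mul, BoundedContinuousFunction.coe_star, Pi.star_apply,
    Complex.star_def]
  ring

/-- The representation of the bounded continuous functions by multiplication operators. -/
def mulHom : (E3 →ᵇ ℂ) →⋆ₐ[ℂ] (Hs →L[ℂ] Hs) where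
  toFun := mulCLM
  map_one' := by
    ext1 ψ
    ext1
    filter_upwards [coeFn_mulOp 1 ψ] with x h1
    rw [mulCLM_apply, h1, BoundedContinuousFunction.coe_one, Pi.one_apply, one_mul]
    rfl
  map_mul' f g := by
    ext1 ψ
    ext1
    rw [mul_apply_eq_comp, mulCLM_apply, mulCLM_apply, mulCLM_apply]
    filter_upwards [coeFn_mulOp (f * g) ψ, coeFn_mulOp f (mulOp g ψ), coeFn_mulOp g ψ]
      with x h1 h2 h3
    rw [h1, h2, h3, BoundedContinuousFunction.coe_mul, Pi.mul_apply, mul_assoc]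
  map_zero' := by
    ext1 ψ
    ext1
    filter_upwards [coeFn_mulOp 0 ψ, Lp.coeFn_zero ℂ 2 (volume : Measure E3)] with x h1 h2
    rw [mulCLM_apply, h1, BoundedContinuousFunction.coe_zero, Pi.zero_apply, zero_mul]
    exact h2.symm
  map_add' f g := by
    ext1 ψ
    ext1
    rw [add_apply, mulCLM_apply, mulCLM_apply, mulCLM_apply]
    filter_upwards [coeFn_mulOp (f + g) ψ, coeFn_mulOp f ψ, coeFn_mulOp g ψ,
      Lp.coeFn_add (mulOp f ψ) (mulOp g ψ)] with x h1 h2 h3 h4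
    rw [h1, h4, Pi.add_apply, h2, h3, BoundedContinuousFunction.coe_add, Pi.add_apply, add_mul]
  commutes' c := by
    ext1 ψ
    ext1
    filter_upwards [coeFn_mulOp (algebraMap ℂ _ c) ψ, Lp.coeFn_smul c ψ] with x h1 h2
    rw [mulCLM_apply, h1, Algebra.algebraMap_eq_smul_one, Algebra.algebraMap_eq_smul_one,
      BoundedContinuousFunction.coe_smul, BoundedContinuousFunction.coe_one]
    change c • (1 : ℂ) * ψ x = (c • ψ : Hs) x
    rw [h2, Pi.smul_apply, smul_eq_mul, smul_eq_mul, mul_one]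
  map_star' f := by
    refine ContinuousLinearMap.ext fun ψ => ext_inner_left ℂ fun φ => ?_
    rw [ContinuousLinearMap.star_eq_adjoint, ContinuousLinearMap.adjoint_inner_right]
    exact (inner_mulOp_left f φ ψ).symm

end Multiplication

/-! ### Weak partial derivatives in L² -/

section WeakDerivatives

theorem integrable_mul_of_hasCompactSupport (ψ : Hs) {g : E3 → ℂ} (hg : Continuous g)
    (hc : HasCompactSupport g) : Integrable fun x => ψ x * g x :=
  MemLp.integrable_mul (p := 2) (q := 2) (Lp.memLp ψ) (hg.memLp_of_hasCompactSupport hc)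

theorem hasCompactSupport_fderiv_apply {g : E3 → ℂ} (hc : HasCompactSupport g) (v : E3) :
    HasCompactSupport fun x => fderiv ℝ g x v :=
  hc.fderiv_apply ℝ v

theorem contDiff_fderiv_const {g : E3 → ℂ} (hg : ContDiff ℝ ∞ g) (v : E3) :
    ContDiff ℝ ∞ fun x => fderiv ℝ g x v :=
  (hg.fderiv_right (by simp)).clm_apply contDiff_const

theorem ext_of_integral_mul {φ ψ : Hs} (h : ∀ g : E3 → ℂ, ContDiff ℝ ∞ g → HasCompactSupport g →
    ∫ x, φ x * g x = ∫ x, ψ x * g x) : φ = ψ := by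
  ext1
  refine ae_eq_of_integral_contDiff_smul_eq ((Lp.memLp φ).locallyIntegrable (by norm_num))
    ((Lp.memLp ψ).locallyIntegrable (by norm_num)) fun g hg hc => ?_
  have h1 := h (fun x => (g x : ℂ)) (Complex.ofRealCLM.contDiff.comp hg)
    (hc.comp_left Complex.ofReal_zero)
  simpa only [Complex.real_smul, mul_comm] using h1

theorem HasWeakPartial.unique {j : Fin 3} {ψ η ζ : Hs} (h1 : HasWeakPartial j ψ η)
    (h2 : HasWeakPartial j ψ ζ) : η = ζ :=
  ext_of_integral_mul fun g hg hc => neg_injective ((h1 g hg hc).symm.trans (h2 g hg hc))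

theorem HasWeakPartial.weakPartial_eq {j : Fin 3} {ψ η : Hs} (h : HasWeakPartial j ψ η) :
    weakPartial j ψ = η := by
  have h1 : ∃ η, HasWeakPartial j ψ η := ⟨η, h⟩
  rw [weakPartial, dif_pos h1]
  exact h1.choose_spec.unique h

theorem HasWeakPartial.add {j : Fin 3} {φ ψ η ζ : Hs} (h1 : HasWeakPartial j φ η)
    (h2 : HasWeakPartial j ψ ζ) : HasWeakPartial j (φ + ψ) (η + ζ) := by
  intro g hg hc
  have e1 : ∫ x, (φ + ψ) x * fderiv ℝ g x (EuclideanSpace.single j 1)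
      = ∫ x, (φ x * fderiv ℝ g x (EuclideanSpace.single j 1)
        + ψ x * fderiv ℝ g x (EuclideanSpace.single j 1)) := by
    refine integral_congr_ae ?_
    filter_upwards [Lp.coeFn_add φ ψ] with x hx
    rw [hx, Pi.add_apply, add_mul]
  have e2 : ∫ x, (η + ζ) x * g x = ∫ x, (η x * g x + ζ x * g x) := by
    refine integral_congr_ae ?_
    filter_upwards [Lp.coeFn_add η ζ] with x hx
    rw [hx, Pi.add_apply, add_mul]
  have hd := (contDiff_fderiv_const hg (EuclideanSpace.single j 1)).continuous
  have hs := hasCompactSupport_fderiv_apply hc (EuclideanSpace.single j 1)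
  rw [e1, e2, integral_add (integrable_mul_of_hasCompactSupport φ hd hs)
    (integrable_mul_of_hasCompactSupport ψ hd hs), integral_add
    (integrable_mul_of_hasCompactSupport η hg.continuous hc)
    (integrable_mul_of_hasCompactSupport ζ hg.continuous hc), h1 g hg hc, h2 g hg hc, neg_add]

theorem HasWeakPartial.smul {j : Fin 3} {ψ η : Hs} (h : HasWeakPartial j ψ η) (c : ℂ) :
    HasWeakPartial j (c • ψ) (c • η) := by
  intro g hg hc
  have e1 : ∫ x, (c • ψ) x * fderiv ℝ g x (EuclideanSpace.single j 1)
      = ∫ x, c * (ψ x * fderiv ℝ g x (EuclideanSpace.single j 1)) := by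
    refine integral_congr_ae ?_
    filter_upwards [Lp.coeFn_smul c ψ] with x hx
    rw [hx, Pi.smul_apply, smul_eq_mul, mul_assoc]
  have e2 : ∫ x, (c • η) x * g x = ∫ x, c * (η x * g x) := by
    refine integral_congr_ae ?_
    filter_upwards [Lp.coeFn_smul c η] with x hx
    rw [hx, Pi.smul_apply, smul_eq_mul, mul_assoc]
  rw [e1, e2, integral_const_mul, integral_const_mul, h g hg hc, mul_neg]

/-- Leibniz rule for a smooth factor. -/
theorem HasWeakPartial.mulOp {j : Fin 3} {ψ η : Hs} (h : HasWeakPartial j ψ η) {f f' : E3 →ᵇ ℂ}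
    (hf : ContDiff ℝ ∞ f) (hf' : ∀ x, fderiv ℝ f x (EuclideanSpace.single j 1) = f' x) :
    HasWeakPartial j (mulOp f ψ) (mulOp f' ψ + mulOp f η) := by
  intro g hg hc
  set v : E3 := EuclideanSpace.single j 1
  have hprod : ∀ x, fderiv ℝ (fun x => f x * g x) x v = f' x * g x + f x * fderiv ℝ g x v := by
    intro x
    rw [fderiv_fun_mul (hf.differentiable (by simp) x) (hg.differentiable (by simp) x)]
    simp only [add_apply, smul_apply, smul_eq_mul, hf']
    ring
  have h1 : ∫ x, ψ x * fderiv ℝ (fun x => f x * g x) x v = -∫ x, η x * (f x * g x) :=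
    h (fun x => f x * g x) (hf.mul hg) hc.mul_left
  simp only [hprod, mul_add] at h1
  have hd := (contDiff_fderiv_const hg v).continuous
  have hs := hasCompactSupport_fderiv_apply hc v
  have i1 : Integrable fun x => ψ x * (f' x * g x) :=
    integrable_mul_of_hasCompactSupport ψ (f'.continuous.mul hg.continuous)
    (hc.mul_left (f := f'))
  have i2 : Integrable fun x => ψ x * (f x * fderiv ℝ g x v) :=
    integrable_mul_of_hasCompactSupport ψ (f.continuous.mul hd) (hs.mul_left (f := f))
  have i3 : Integrable fun x => η x * (f x * g x) :=
    integrable_mul_of_hasCompactSupport η (f.continuous.mul hg.continuous)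
    (hc.mul_left (f := f))
  rw [integral_add i1 i2] at h1
  have e1 : ∫ x, OscScatt.mulOp f ψ x * fderiv ℝ g x v = ∫ x, ψ x * (f x * fderiv ℝ g x v) := by
    refine integral_congr_ae ?_
    filter_upwards [coeFn_mulOp f ψ] with x hx
    rw [hx]
    ring
  have e2 : ∫ x, (OscScatt.mulOp f' ψ + OscScatt.mulOp f η) x * g x
      = ∫ x, (ψ x * (f' x * g x) + η x * (f x * g x)) := by
    refine integral_congr_ae ?_
    filter_upwards [coeFn_mulOp f' ψ, coeFn_mulOp f η, Lp.coeFn_add (OscScatt.mulOp f' ψ)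
      (OscScatt.mulOp f η)] with x h1 h2 h3
    rw [h3, Pi.add_apply, h1, h2]
    ring
  rw [e1, e2, integral_add i1 i3]
  linear_combination h1

/-- Smooth functions of compact support are weakly differentiable. -/
theorem hasWeakPartial_toLp {g : E3 → ℂ} (hg : ContDiff ℝ ∞ g) (hc : HasCompactSupport g)
    (j : Fin 3) :
    HasWeakPartial j ((hg.continuous.memLp_of_hasCompactSupport hc (p := 2)).toLp)
      (((contDiff_fderiv_const hg (EuclideanSpace.single j 1)).continuous.memLp_of_hasCompactSupport
        (hasCompactSupport_fderiv_apply hc (EuclideanSpace.single j 1)) (p := 2)).toLp) := by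
  intro φ hφ hφc
  set v : E3 := EuclideanSpace.single j 1
  have hd := (contDiff_fderiv_const hg v).continuous
  have hd' := (contDiff_fderiv_const hφ v).continuous
  have h := integral_mul_fderiv_eq_neg_fderiv_mul_of_integrable (μ := (volume : Measure E3))
    (f := g) (g := φ) (v := v)
    ((hd.mul hφ.continuous).integrable_of_hasCompactSupport hφc.mul_left)
    ((hg.continuous.mul hd').integrable_of_hasCompactSupport hc.mul_right)
    ((hg.continuous.mul hφ.continuous).integrable_of_hasCompactSupport hc.mul_right)
    (fun x _ => hg.differentiable (by simp) x) (fun x _ => hφ.differentiable (by simp) x)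
  refine Eq.trans (integral_congr_ae ?_) (h.trans (congrArg _ (integral_congr_ae ?_)))
  · filter_upwards [MemLp.coeFn_toLp (hg.continuous.memLp_of_hasCompactSupport hc (p := 2)
      (μ := volume))] with x hx
    rw [hx]
  · filter_upwards [MemLp.coeFn_toLp (hd.memLp_of_hasCompactSupport
      (hasCompactSupport_fderiv_apply hc v) (p := 2) (μ := volume))] with x hx
    rw [hx]

end WeakDerivatives

/-! ### Weak derivatives through translations, and integration by parts -/

section Translations

/-- Translation of a square-integrable function. -/
def translate (v : E3) (ψ : Hs) : Hs :=
  Lp.compMeasurePreserving (fun x => x + v) (measurePreserving_add_right volume v) ψ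

theorem coeFn_translate (v : E3) (ψ : Hs) : translate v ψ =ᵐ[volume] fun x => ψ (x + v) :=
  Lp.coeFn_compMeasurePreserving ψ (measurePreserving_add_right volume v)

theorem translate_zero (ψ : Hs) : translate 0 ψ = ψ := by
  ext1
  filter_upwards [coeFn_translate 0 ψ] with x hx
  rw [hx, add_zero]

theorem continuous_translate (ψ : Hs) : Continuous fun v => translate v ψ := by
  have hg : Continuous fun v : E3 => (⟨fun x => x + v, by fun_prop⟩ : C(E3, E3)) := by
    refine ContinuousMap.continuous_of_continuous_uncurry _ ?_
    change Continuous fun p : E3 × E3 => p.2 + p.1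
    fun_prop
  exact Continuous.compMeasurePreservingLp (continuous_const (y := ψ)) hg
    (fun v => measurePreserving_add_right volume v) (by simp)

theorem inner_translate (v : E3) (φ ψ : Hs) :
    (inner ℂ (translate v φ) (translate v ψ) : ℂ) = inner ℂ φ ψ := by
  rw [L2.inner_def, L2.inner_def,
    ← integral_add_right_eq_self (fun x => (inner ℂ (φ x) (ψ x) : ℂ)) v]
  refine integral_congr_ae ?_
  filter_upwards [coeFn_translate v φ, coeFn_translate v ψ] with x h1 h2
  rw [h1, h2]

/-- Moving the translation to the test function makes the pairing a convolution of ψ with the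
reflected g, evaluated at s v. The derivative then falls on the smooth factor, and the definition of
the weak derivative moves it to ψ. -/
theorem HasWeakPartial.hasDerivAt_integral {j : Fin 3} {ψ η : Hs} (h : HasWeakPartial j ψ η)
    {g : E3 → ℂ} (hg : ContDiff ℝ ∞ g) (hc : HasCompactSupport g) (t : ℝ) :
    HasDerivAt (fun s : ℝ => ∫ x, translate (s • EuclideanSpace.single j 1) ψ x * g x)
      (∫ x, translate (t • EuclideanSpace.single j 1) η x * g x) t := by
  set v : E3 := EuclideanSpace.single j 1
  have htr : ∀ (s : ℝ) (θ : Hs), ∫ x, translate (s • v) θ x * g x = ∫ x, θ x * g (x - s • v) := by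
    intro s θ
    rw [← integral_add_right_eq_self (fun x => θ x * g (x - s • v)) (s • v)]
    refine integral_congr_ae ?_
    filter_upwards [coeFn_translate (s • v) θ] with x hx
    rw [hx, add_sub_cancel_right]
  simp only [htr]
  have hg' : ContDiff ℝ ∞ fun x => g (-x) := hg.comp contDiff_neg
  have hc' : HasCompactSupport fun x => g (-x) := hc.comp_homeomorph (Homeomorph.neg E3)
  have hloc : LocallyIntegrable ψ (volume : Measure E3) :=
    (Lp.memLp ψ).locallyIntegrable (by norm_num)
  have h1 := hc'.hasFDerivAt_convolution_right (ContinuousLinearMap.mul ℝ ℂ) hloc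
    (hg'.of_le (by simp)) (t • v)
  have h2 := h1.comp_hasDerivAt t ((hasDerivAt_id t).smul_const v)
  have hcont : Continuous (fderiv ℝ fun x => g (-x)) := hg'.continuous_fderiv (by simp)
  rw [one_smul, convolution_precompR_apply _ hloc (hc'.fderiv ℝ) hcont] at h2
  have e1 : ∀ s : ℝ, convolution (⇑ψ) (fun x => g (-x)) (ContinuousLinearMap.mul ℝ ℂ) volume (s • v)
      = ∫ x, ψ x * g (x - s • v) := by
    intro s
    rw [convolution_def]
    simp
  have e2 : convolution (⇑ψ) (fun a => fderiv ℝ (fun x => g (-x)) a v)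
      (ContinuousLinearMap.mul ℝ ℂ) volume (t • v) = ∫ x, η x * g (x - t • v) := by
    have h3 : ∫ x, ψ x * fderiv ℝ (fun x => g (x - t • v)) x v = -∫ x, η x * g (x - t • v) :=
      h (fun x => g (x - t • v)) (hg.comp (contDiff_id.sub contDiff_const))
      (hc.comp_homeomorph (Homeomorph.subRight (t • v)))
    simp only [fderiv_comp_sub] at h3
    rw [convolution_def, ← neg_neg (∫ x, η x * g (x - t • v)), ← h3, ← integral_neg]
    congr 1 with x
    have h4 : fderiv ℝ (fun x => g (-x)) (t • v - x) v = -fderiv ℝ g (x - t • v) v := by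
      have h5 := ((hg.differentiable (by simp) (-(t • v - x))).hasFDerivAt.comp (t • v - x)
        (hasFDerivAt_id (𝕜 := ℝ) _).neg).fderiv
      rw [Function.comp_def] at h5
      rw [h5, ← neg_sub x (t • v)]
      simp
    rw [h4, ContinuousLinearMap.mul_apply']
    ring
  rw [e2] at h2
  exact h2.congr_of_eventuallyEq (Eventually.of_forall fun s => (e1 s).symm)

theorem norm_le_of_dense_inner {H : Type*} [NormedAddCommGroup H] [InnerProductSpace ℂ H]
    {S : Set H} (hS : Dense S) {w : H} {C : ℝ} (hC : 0 ≤ C)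
    (h : ∀ G ∈ S, ‖(inner ℂ G w : ℂ)‖ ≤ C * ‖G‖) :
    ‖w‖ ≤ C := by
  have h1 : ∀ G, ‖(inner ℂ G w : ℂ)‖ ≤ C * ‖G‖ := fun G =>
    (isClosed_le (f := fun G => ‖(inner ℂ G w : ℂ)‖) (g := fun G => C * ‖G‖) (by fun_prop)
      (by fun_prop)).closure_subset_iff.2 h (hS G)
  have h2 := h1 w
  rw [inner_self_eq_norm_sq_to_K] at h2
  simp only [norm_pow, RCLike.norm_ofReal, abs_norm] at h2
  rcases eq_or_ne ‖w‖ 0 with h0 | h0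
  · rwa [h0]
  · have : 0 < ‖w‖ := lt_of_le_of_ne (norm_nonneg _) h0.symm
    nlinarith

/-- The weak derivative is the L² derivative of the translation group. Each scalar pairing obeys the
mean value inequality with a constant c‖G‖, where c comes from the continuity of translations of η
at 0 and not from G; duality over the dense set of test functions turns this into a norm estimate.
-/
theorem HasWeakPartial.hasDerivAt_translate {j : Fin 3} {ψ η : Hs} (h : HasWeakPartial j ψ η) :
    HasDerivAt (fun s : ℝ => translate (s • EuclideanSpace.single j 1) ψ) η 0 := by
  set v : E3 := EuclideanSpace.single j 1
  rw [hasDerivAt_iff_isLittleO, Asymptotics.isLittleO_iff]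
  intro c hc
  have hcont : Continuous fun s : ℝ => translate (s • v) η :=
    (continuous_translate η).comp (by fun_prop)
  obtain ⟨δ, hδ, hball⟩ := Metric.continuousAt_iff.1 (hcont.continuousAt (x := 0)) c hc
  filter_upwards [Metric.ball_mem_nhds (0 : ℝ) hδ] with s hs
  rw [zero_smul, translate_zero, sub_zero]
  refine norm_le_of_dense_inner
    (Lp.dense_hasCompactSupport_contDiff (F := ℂ) (μ := (volume : Measure E3)) (p := 2) (by simp))
    (by positivity) ?_
  rintro G ⟨g, hGg, hgc, hg⟩
  have hpair : ∀ θ : Hs, (inner ℂ G θ : ℂ) = ∫ x, θ x * starRingEnd ℂ (g x) := by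
    intro θ
    rw [L2.inner_def]
    refine integral_congr_ae ?_
    filter_upwards [hGg] with x hx
    rw [hx, RCLike.inner_apply]
  have hder : ∀ t, HasDerivAt (fun s : ℝ => (inner ℂ G (translate (s • v) ψ - s • η) : ℂ))
      (inner ℂ G (translate (t • v) η - η)) t := by
    intro t
    have h1 : HasDerivAt (fun s : ℝ => ∫ x, translate (s • v) ψ x * starRingEnd ℂ (g x))
        (∫ x, translate (t • v) η x * starRingEnd ℂ (g x)) t :=
      h.hasDerivAt_integral (g := fun x => starRingEnd ℂ (g x))
      (Complex.conjCLE.contDiff.comp hg) (hgc.comp_left (map_zero _)) t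
    have h2 := h1.sub ((hasDerivAt_id t).smul_const (inner ℂ G η : ℂ))
    simp only [inner_sub_right, hpair (translate _ _), one_smul] at h2 ⊢
    refine h2.congr_of_eventuallyEq (Eventually.of_forall fun s => ?_)
    have : (inner ℂ G (s • η) : ℂ) = s • inner ℂ G η :=
      (innerSL ℂ G).toLinearMap.map_smul_of_tower s η
    simp only [this, Pi.sub_apply, id]
  have hmvt := (convex_ball (0 : ℝ) δ).norm_image_sub_le_of_norm_hasDerivWithin_le
    (C := c * ‖G‖) (fun t _ => (hder t).hasDerivWithinAt) (fun t ht => ?_)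
    (Metric.mem_ball_self hδ) hs
  · rw [zero_smul, translate_zero, zero_smul, sub_zero, sub_zero, ← inner_sub_right] at hmvt
    have e : translate (s • v) ψ - ψ - s • η = translate (s • v) ψ - s • η - ψ := by abel
    rw [e]
    linarith
  · have h3 := (hball ht).le
    rw [zero_smul, translate_zero, dist_eq_norm] at h3
    calc ‖(inner ℂ G (translate (t • v) η - η) : ℂ)‖ ≤ ‖G‖ * ‖translate (t • v) η - η‖ :=
        norm_inner_le_norm _ _
      _ ≤ c * ‖G‖ := by rw [mul_comm]; gcongr

/-- Integration by parts for weakly differentiable functions. -/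
theorem HasWeakPartial.inner_eq {j : Fin 3} {φ φ' ψ ψ' : Hs} (h1 : HasWeakPartial j φ φ')
    (h2 : HasWeakPartial j ψ ψ') : (inner ℂ φ ψ' : ℂ) = -inner ℂ φ' ψ := by
  -- Translations preserve the inner product, so the derivative given by the product rule is that of
  -- a constant.
  have h3 := h1.hasDerivAt_translate.inner ℂ h2.hasDerivAt_translate
  simp only [inner_translate, zero_smul, translate_zero] at h3
  exact eq_neg_of_add_eq_zero_left (h3.unique (hasDerivAt_const _ _))

end Translations


/-! ### The form domain, the kinetic momentum and the form vector -/

section FormDomain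

/-- The form domain of the oscillator as a subspace. -/
def formDom : Submodule ℂ Hs where
  carrier := formDomain
  add_mem' := by
    intro φ ψ h1 h2 j
    obtain ⟨⟨η, hη⟩, h3⟩ := h1 j
    obtain ⟨⟨ζ, hζ⟩, h4⟩ := h2 j
    refine ⟨⟨_, hη.add hζ⟩, (h3.add h4).ae_eq ?_⟩
    filter_upwards [Lp.coeFn_add φ ψ] with x hx
    rw [hx, Pi.add_apply, Pi.add_apply, mul_add]
  zero_mem' := by
    intro j
    refine ⟨⟨0, fun g _ _ => ?_⟩, (MemLp.zero (ε := ℂ)).ae_eq ?_⟩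
    · rw [integral_eq_zero_of_ae, integral_eq_zero_of_ae, neg_zero]
      all_goals
        filter_upwards [Lp.coeFn_zero ℂ 2 (volume : Measure E3)] with x hx
        rw [hx]
        simp
    · filter_upwards [Lp.coeFn_zero ℂ 2 (volume : Measure E3)] with x hx
      rw [hx]
      simp
  smul_mem' := by
    intro c ψ h1 j
    obtain ⟨⟨η, hη⟩, h3⟩ := h1 j
    refine ⟨⟨_, hη.smul c⟩, (h3.const_smul c).ae_eq ?_⟩
    filter_upwards [Lp.coeFn_smul c ψ] with x hx
    rw [hx, Pi.smul_apply, Pi.smul_apply, smul_eq_mul, smul_eq_mul]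
    ring

theorem formDom.hasWeakPartial (ψ : formDom) (j : Fin 3) :
    HasWeakPartial j (ψ : Hs) (weakPartial j ψ) := by
  obtain ⟨η, hη⟩ := (ψ.2 j).1
  rwa [hη.weakPartial_eq]

/-- The weak partial derivative as a linear map on the form domain. -/
def partialOp (j : Fin 3) : formDom →ₗ[ℂ] Hs where
  toFun ψ := weakPartial j ψ
  map_add' φ ψ := ((formDom.hasWeakPartial φ j).add (formDom.hasWeakPartial ψ j)).weakPartial_eq
  map_smul' c ψ := ((formDom.hasWeakPartial ψ j).smul c).weakPartial_eq

theorem partialOp_eq {j : Fin 3} {ψ : formDom} {η : Hs} (h : HasWeakPartial j (ψ : Hs) η) :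
    partialOp j ψ = η := h.weakPartial_eq

theorem coeFn_posOp_aux (j : Fin 3) (ψ : formDom) :
    (ψ.2 j).2.toLp =ᵐ[volume] fun x : E3 => ((x j : ℝ) : ℂ) * (ψ : Hs) x :=
  MemLp.coeFn_toLp _

/-- Multiplication by a coordinate as a linear map on the form domain. -/
def posOp (j : Fin 3) : formDom →ₗ[ℂ] Hs where
  toFun ψ := (ψ.2 j).2.toLp
  map_add' φ ψ := by
    ext1
    filter_upwards [coeFn_posOp_aux j (φ + ψ), coeFn_posOp_aux j φ, coeFn_posOp_aux j ψ,
      Lp.coeFn_add (φ : Hs) ψ, Lp.coeFn_add (φ.2 j).2.toLp (ψ.2 j).2.toLp] with x h1 h2 h3 h4 h5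
    rw [h1, h5, Pi.add_apply, h2, h3, Submodule.coe_add, h4, Pi.add_apply, mul_add]
  map_smul' c ψ := by
    ext1
    filter_upwards [coeFn_posOp_aux j (c • ψ), coeFn_posOp_aux j ψ, Lp.coeFn_smul c (ψ : Hs),
      Lp.coeFn_smul c (ψ.2 j).2.toLp] with x h1 h2 h3 h4
    rw [h1, RingHom.id_apply, h4, Pi.smul_apply, h2, Submodule.coe_smul, h3, Pi.smul_apply,
      smul_eq_mul, smul_eq_mul]
    ring

theorem coeFn_posOp (j : Fin 3) (ψ : formDom) :
    posOp j ψ =ᵐ[volume] fun x : E3 => ((x j : ℝ) : ℂ) * (ψ : Hs) x :=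
  coeFn_posOp_aux j ψ

theorem norm_coord_le (v : E3) (j : Fin 3) : ‖((v j : ℝ) : ℂ)‖ ≤ ‖v‖ := by
  rw [Complex.norm_real]
  exact PiLp.norm_apply_le v j

variable {a b : E3 → E3}

theorem aestronglyMeasurable_coord (ha : AEStronglyMeasurable a (volume : Measure E3))
    (j : Fin 3) : AEStronglyMeasurable (fun x => ((a x j : ℝ) : ℂ)) (volume : Measure E3) := by
  have h1 : Continuous fun v : E3 => ((v j : ℝ) : ℂ) := by fun_prop
  exact h1.comp_aestronglyMeasurable ha

theorem memLp_coord_mul {α : ℝ} (ha : AEStronglyMeasurable a (volume : Measure E3))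
    (hα : ∀ᵐ x, ‖a x‖ ≤ α) (j : Fin 3) (ψ : Hs) :
    MemLp (fun x => ((a x j : ℝ) : ℂ) * ψ x) 2 (volume : Measure E3) := by
  refine (Lp.memLp ψ).of_le_mul (c := α)
    ((aestronglyMeasurable_coord ha j).mul (Lp.aestronglyMeasurable ψ)) ?_
  filter_upwards [hα] with x hx
  rw [norm_mul]
  exact mul_le_mul_of_nonneg_right ((norm_coord_le _ j).trans hx) (norm_nonneg _)

theorem ae_norm_le_of_memLp_top {β E : Type*} [MeasurableSpace β] [NormedAddCommGroup E]
    {μ : Measure β} {g : β → E} (hg : MemLp g ⊤ μ) :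
    ∀ᵐ x ∂μ, ‖g x‖ ≤ (eLpNorm g ⊤ μ).toReal := by
  have h := ae_le_eLpNormEssSup (f := g) (μ := μ)
  filter_upwards [h] with x hx
  rw [← toReal_enorm]
  exact ENNReal.toReal_mono hg.2.ne (by rwa [eLpNorm_exponent_top])

theorem memLp_pot (ha : MemLp a ⊤ (volume : Measure E3)) (j : Fin 3) (ψ : Hs) :
    MemLp (fun x => ((a x j : ℝ) : ℂ) * ψ x) 2 (volume : Measure E3) :=
  memLp_coord_mul ha.1 (ae_norm_le_of_memLp_top ha) j ψ

/-- Multiplication by a component of the bounded vector potential. -/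
def potOp (ha : MemLp a ⊤ (volume : Measure E3)) (j : Fin 3) : Hs →ₗ[ℂ] Hs where
  toFun ψ := (memLp_pot ha j ψ).toLp
  map_add' φ ψ := by
    ext1
    filter_upwards [(memLp_pot ha j (φ + ψ)).coeFn_toLp, (memLp_pot ha j φ).coeFn_toLp,
      (memLp_pot ha j ψ).coeFn_toLp, Lp.coeFn_add φ ψ,
      Lp.coeFn_add (memLp_pot ha j φ).toLp (memLp_pot ha j ψ).toLp] with x h1 h2 h3 h4 h5
    rw [h1, h5, Pi.add_apply, h2, h3, h4, Pi.add_apply, mul_add]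
  map_smul' c ψ := by
    ext1
    filter_upwards [(memLp_pot ha j (c • ψ)).coeFn_toLp, (memLp_pot ha j ψ).coeFn_toLp,
      Lp.coeFn_smul c ψ, Lp.coeFn_smul c (memLp_pot ha j ψ).toLp] with x h1 h2 h3 h4
    rw [h1, RingHom.id_apply, h4, Pi.smul_apply, h2, h3, Pi.smul_apply, smul_eq_mul, smul_eq_mul]
    ring

theorem coeFn_potOp (ha : MemLp a ⊤ (volume : Measure E3)) (j : Fin 3) (ψ : Hs) :
    potOp ha j ψ =ᵐ[volume] fun x => ((a x j : ℝ) : ℂ) * ψ x :=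
  (memLp_pot ha j ψ).coeFn_toLp

theorem inner_potOp (ha : MemLp a ⊤ (volume : Measure E3)) (j : Fin 3) (φ ψ : Hs) :
    (inner ℂ (potOp ha j φ) ψ : ℂ) = inner ℂ φ (potOp ha j ψ) := by
  rw [L2.inner_def, L2.inner_def]
  refine integral_congr_ae ?_
  filter_upwards [coeFn_potOp ha j φ, coeFn_potOp ha j ψ] with x h1 h2
  rw [h1, h2]
  simp only [RCLike.inner_apply, map_mul, Complex.conj_ofReal]
  ring

theorem potOp_mulOp (ha : MemLp a ⊤ (volume : Measure E3)) (j : Fin 3) (f : E3 →ᵇ ℂ) (ψ : Hs) :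
    potOp ha j (mulOp f ψ) = mulOp f (potOp ha j ψ) := by
  ext1
  filter_upwards [coeFn_potOp ha j (mulOp f ψ), coeFn_potOp ha j ψ, coeFn_mulOp f ψ,
    coeFn_mulOp f (potOp ha j ψ)] with x h1 h2 h3 h4
  rw [h1, h3, h4, h2]
  ring

/-- The kinetic momentum as a linear map on the form domain. -/
def kinOp (ha : MemLp a ⊤ (volume : Measure E3)) (j : Fin 3) : formDom →ₗ[ℂ] Hs :=
  (-Complex.I) • partialOp j - potOp ha j ∘ₗ formDom.subtype

theorem kinOp_apply (ha : MemLp a ⊤ (volume : Measure E3)) (j : Fin 3) (ψ : formDom) :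
    kinOp ha j ψ = (-Complex.I) • partialOp j ψ - potOp ha j ψ := rfl

theorem coeFn_kinOp (ha : MemLp a ⊤ (volume : Measure E3)) (j : Fin 3) (ψ : formDom) :
    kinOp ha j ψ =ᵐ[volume] kinMom a j ψ := by
  rw [kinOp_apply]
  filter_upwards [Lp.coeFn_sub ((-Complex.I) • partialOp j ψ) (potOp ha j ψ),
    Lp.coeFn_smul (-Complex.I) (partialOp j ψ), coeFn_potOp ha j (ψ : Hs)] with x h1 h2 h3
  rw [h1, Pi.sub_apply, h2, h3, Pi.smul_apply, smul_eq_mul]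
  rfl

/-- The vector `((p - a) ψ, x ψ)`. -/
def formVec (ha : MemLp a ⊤ (volume : Measure E3)) :
    formDom →ₗ[ℂ] PiLp 2 (fun _ : Fin 3 ⊕ Fin 3 => Hs) where
  toFun ψ := WithLp.toLp 2 (Sum.elim (fun j => kinOp ha j ψ) (fun j => posOp j ψ))
  map_add' φ ψ := by
    ext1 i
    cases i <;> simp
  map_smul' c ψ := by
    ext1 i
    cases i <;> simp

theorem inner_formVec (ha : MemLp a ⊤ (volume : Measure E3)) (φ ψ : formDom) :
    (inner ℂ (formVec ha φ) (formVec ha ψ) : ℂ)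
      = ∑ j, inner ℂ (kinOp ha j φ) (kinOp ha j ψ) + ∑ j, inner ℂ (posOp j φ) (posOp j ψ) := by
  rw [PiLp.inner_apply, Fintype.sum_sum_type]
  rfl

theorem norm_kinOp_le (ha : MemLp a ⊤ (volume : Measure E3)) (j : Fin 3) (ψ : formDom) :
    ‖kinOp ha j ψ‖ ≤ ‖formVec ha ψ‖ :=
  PiLp.norm_apply_le (formVec ha ψ) (Sum.inl j)

/-- Puts the form in the shape ½ V* V, with V depending affinely on a, for which the abstract energy
estimate is stated. -/
theorem hForm_eq_inner (ha : MemLp a ⊤ (volume : Measure E3)) (φ ψ : formDom) :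
    hForm a φ ψ = (1 / 2) * inner ℂ (formVec ha φ) (formVec ha ψ) := by
  rw [inner_formVec, hForm, mul_add]
  congr 2
  · refine Finset.sum_congr rfl fun j _ => ?_
    rw [L2.inner_def]
    refine integral_congr_ae ?_
    filter_upwards [coeFn_kinOp ha j φ, coeFn_kinOp ha j ψ] with x h1 h2
    rw [h1, h2, RCLike.inner_apply, mul_comm]
  · simp only [L2.inner_def]
    rw [← integral_finsetSum _ fun j _ => L2.integrable_inner (𝕜 := ℂ) (posOp j φ) (posOp j ψ)]
    refine integral_congr_ae ?_
    have h1 := ae_all_iff.2 fun j => coeFn_posOp j φ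
    have h2 := ae_all_iff.2 fun j => coeFn_posOp j ψ
    filter_upwards [h1, h2] with x h1 h2
    simp only [h1, h2, RCLike.inner_apply, map_mul, Complex.conj_ofReal]
    rw [EuclideanSpace.norm_sq_eq]
    push_cast
    rw [Finset.sum_mul]
    refine Finset.sum_congr rfl fun j _ => ?_
    rw [Real.norm_eq_abs, ← Complex.ofReal_pow, sq_abs]
    push_cast
    ring

/-- Only the three kinetic components involve the potential; their sum of squares gives √3, rounded
up to 2. -/
theorem norm_formVec_sub_le (ha : MemLp a ⊤ (volume : Measure E3))
    (hb : MemLp b ⊤ (volume : Measure E3)) {α : ℝ} (h0 : 0 ≤ α)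
    (hα : ∀ᵐ x, ‖a x - b x‖ ≤ α) (ψ : formDom) :
    ‖formVec ha ψ - formVec hb ψ‖ ≤ 2 * α * ‖(ψ : Hs)‖ := by
  have hk : ∀ j, ‖kinOp ha j ψ - kinOp hb j ψ‖ ≤ α * ‖(ψ : Hs)‖ := by
    intro j
    rw [kinOp_apply, kinOp_apply, sub_sub_sub_cancel_left]
    refine Lp.norm_le_mul_norm_of_ae_le_mul ?_
    filter_upwards [hα, Lp.coeFn_sub (potOp hb j ψ) (potOp ha j ψ), coeFn_potOp ha j ψ,
      coeFn_potOp hb j ψ] with x h1 h2 h3 h4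
    rw [h2, Pi.sub_apply, h3, h4, ← sub_mul, norm_mul, norm_sub_rev]
    refine mul_le_mul_of_nonneg_right (le_trans ?_ h1) (norm_nonneg _)
    have := norm_coord_le (a x - b x) j
    simpa using this
  have h1 : ‖formVec ha ψ - formVec hb ψ‖ ^ 2 ≤ 3 * (α * ‖(ψ : Hs)‖) ^ 2 := by
    rw [PiLp.norm_sq_eq_of_L2, Fintype.sum_sum_type]
    have e1 : ∀ j : Fin 3, (formVec ha ψ - formVec hb ψ) (Sum.inl j)
        = kinOp ha j ψ - kinOp hb j ψ := fun j => rfl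
    have e2 : ∀ j : Fin 3, (formVec ha ψ - formVec hb ψ) (Sum.inr j) = 0 := fun j => sub_self _
    simp only [e1, e2, norm_zero]
    have := fun j => pow_le_pow_left₀ (norm_nonneg _) (hk j) 2
    rw [Fin.sum_univ_three]
    simp only [ne_eq, OfNat.ofNat_ne_zero, not_false_eq_true, zero_pow, Finset.sum_const_zero,
      add_zero]
    linarith [this 0, this 1, this 2]
  refine le_of_sq_le_sq ?_ (by positivity)
  nlinarith [sq_nonneg (α * ‖(ψ : Hs)‖)]

end FormDomain

/-! ### The commutator of the hamiltonian with a smooth function -/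

section Commutator

/-- `f` is a smooth function, with bounded derivatives `f₁ j` and `f₂ j` of first and second order
in the coordinate directions. -/
structure SmoothMultiplier (f : E3 →ᵇ ℂ) (f₁ f₂ : Fin 3 → (E3 →ᵇ ℂ)) : Prop where
  contDiff : ContDiff ℝ ∞ f
  fderiv_eq : ∀ j x, fderiv ℝ f x (EuclideanSpace.single j 1) = f₁ j x
  fderiv_eq' : ∀ j x, fderiv ℝ (f₁ j) x (EuclideanSpace.single j 1) = f₂ j x

variable {f : E3 →ᵇ ℂ} {f₁ f₂ : Fin 3 → (E3 →ᵇ ℂ)}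

theorem SmoothMultiplier.contDiff_one (h : SmoothMultiplier f f₁ f₂) (j : Fin 3) :
    ContDiff ℝ ∞ (f₁ j) := by
  have e : ⇑(f₁ j) = fun x => fderiv ℝ f x (EuclideanSpace.single j 1) :=
    funext fun x => (h.fderiv_eq j x).symm
  rw [e]
  exact contDiff_fderiv_const h.contDiff _

theorem fderiv_star_apply {g : E3 →ᵇ ℂ} (hg : ContDiff ℝ ∞ g) (x v : E3) :
    fderiv ℝ (star g : E3 →ᵇ ℂ) x v = star (fderiv ℝ g x v) := by
  have h1 := (Complex.conjCLE.toContinuousLinearMap.hasFDerivAt.comp x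
    (hg.differentiable (by simp) x).hasFDerivAt).fderiv
  have h2 : ⇑(star g : E3 →ᵇ ℂ) = Complex.conjCLE.toContinuousLinearMap ∘ g := by
    ext y
    simp
  rw [h2, h1]
  simp

theorem SmoothMultiplier.star (h : SmoothMultiplier f f₁ f₂) :
    SmoothMultiplier (star f) (fun j => star (f₁ j)) (fun j => star (f₂ j)) where
  contDiff := by
    have h2 : ⇑(Star.star f : E3 →ᵇ ℂ) = Complex.conjCLE ∘ f := by
      ext y
      simp
    rw [h2]
    exact Complex.conjCLE.contDiff.comp h.contDiff
  fderiv_eq j x := by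
    rw [fderiv_star_apply h.contDiff, h.fderiv_eq]
    rfl
  fderiv_eq' j x := by
    rw [fderiv_star_apply (h.contDiff_one j), h.fderiv_eq']
    rfl

theorem SmoothMultiplier.mem_formDom (h : SmoothMultiplier f f₁ f₂) (ψ : formDom) :
    mulOp f ψ ∈ formDom := by
  intro j
  refine ⟨⟨_, (formDom.hasWeakPartial ψ j).mulOp h.contDiff (h.fderiv_eq j)⟩, ?_⟩
  refine (memLp_mul f (posOp j ψ)).ae_eq ?_
  filter_upwards [coeFn_posOp j ψ, coeFn_mulOp f ψ] with x h1 h2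
  rw [h1, h2]
  ring

/-- The product of a smooth multiplier and an element of the form domain. -/
def SmoothMultiplier.mul (h : SmoothMultiplier f f₁ f₂) (ψ : formDom) : formDom :=
  ⟨mulOp f ψ, h.mem_formDom ψ⟩

theorem SmoothMultiplier.posOp_mul (h : SmoothMultiplier f f₁ f₂) (j : Fin 3) (ψ : formDom) :
    posOp j (h.mul ψ) = mulOp f (posOp j ψ) := by
  ext1
  have h3 : (h.mul ψ : Hs) = mulOp f ψ := rfl
  filter_upwards [coeFn_posOp j ψ, coeFn_mulOp f ψ, coeFn_posOp j (h.mul ψ),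
    coeFn_mulOp f (posOp j ψ)] with x h1 h2 h4 h5
  rw [h4, h5, h1, h3, h2]
  ring

variable {a : E3 → E3}

theorem SmoothMultiplier.kinOp_mul (h : SmoothMultiplier f f₁ f₂)
    (ha : MemLp a ⊤ (volume : Measure E3)) (j : Fin 3) (ψ : formDom) :
    kinOp ha j (h.mul ψ) = mulOp f (kinOp ha j ψ) - Complex.I • mulOp (f₁ j) ψ := by
  have h1 : partialOp j (h.mul ψ) = mulOp (f₁ j) ψ + mulOp f (partialOp j ψ) :=
    partialOp_eq ((formDom.hasWeakPartial ψ j).mulOp h.contDiff (h.fderiv_eq j))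
  have h2 : potOp ha j (h.mul ψ) = mulOp f (potOp ha j ψ) := potOp_mulOp ha j f ψ
  rw [kinOp_apply, kinOp_apply, h1, h2]
  simp only [← mulCLM_apply, map_sub, map_smul, map_neg, smul_add, neg_smul]
  abel

theorem inner_kinOp_left {ha : MemLp a ⊤ (volume : Measure E3)} {j : Fin 3} (φ : formDom)
    {χ χ' : Hs} (hχ : HasWeakPartial j χ χ') :
    (inner ℂ (kinOp ha j φ) χ : ℂ) = inner ℂ (φ : Hs) ((-Complex.I) • χ' - potOp ha j χ) := by
  have h1 : (inner ℂ (φ : Hs) χ' : ℂ) = -inner ℂ (partialOp j φ) χ :=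
    (formDom.hasWeakPartial φ j).inner_eq hχ
  rw [kinOp_apply, inner_sub_left, inner_sub_right, inner_potOp, inner_smul_left, inner_smul_right,
    h1]
  simp

/-- The form version of [D², f] = −2i (∂f) D − ∂²f with D = p_j − a_j. Taking the commutator between
forms avoids placing f ψ in the operator domain. One integration by parts removes all derivatives
from φ. -/
theorem SmoothMultiplier.inner_kinOp (h : SmoothMultiplier f f₁ f₂)
    (ha : MemLp a ⊤ (volume : Measure E3)) (j : Fin 3) (φ ψ : formDom) :
    (inner ℂ (kinOp ha j φ) (kinOp ha j (h.mul ψ)) : ℂ)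
      - inner ℂ (kinOp ha j (h.star.mul φ)) (kinOp ha j ψ)
      = -(2 * Complex.I) * inner ℂ (φ : Hs) (mulOp (f₁ j) (kinOp ha j ψ))
        - inner ℂ (φ : Hs) (mulOp (f₂ j) ψ) := by
  have h1 := inner_kinOp_left (ha := ha) φ
    ((formDom.hasWeakPartial ψ j).mulOp (h.contDiff_one j) (h.fderiv_eq' j))
  have h2 : (-Complex.I) • (mulOp (f₂ j) ψ + mulOp (f₁ j) (weakPartial j ψ))
      - potOp ha j (mulOp (f₁ j) ψ)
      = mulOp (f₁ j) (kinOp ha j ψ) - Complex.I • mulOp (f₂ j) (ψ : Hs) := by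
    rw [kinOp_apply, potOp_mulOp]
    simp only [← mulCLM_apply, map_sub, map_smul, map_neg, smul_add, neg_smul]
    change -_ + -(Complex.I • mulCLM (f₁ j) (partialOp j ψ)) - _ = _
    abel
  rw [h2, inner_sub_right, inner_smul_right] at h1
  rw [h.kinOp_mul, h.star.kinOp_mul, inner_sub_right, inner_sub_left, inner_smul_right,
    inner_smul_left, inner_mulOp_left, inner_mulOp_left, star_star, star_star, h1,
    Complex.conj_I]
  linear_combination inner ℂ (φ : Hs) (mulOp (f₂ j) ψ) * Complex.I_sq

theorem SmoothMultiplier.inner_formVec (h : SmoothMultiplier f f₁ f₂)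
    (ha : MemLp a ⊤ (volume : Measure E3)) (φ ψ : formDom) :
    (inner ℂ (formVec ha φ) (formVec ha (h.mul ψ)) : ℂ)
      - inner ℂ (formVec ha (h.star.mul φ)) (formVec ha ψ)
      = ∑ j, (-(2 * Complex.I) * inner ℂ (φ : Hs) (mulOp (f₁ j) (kinOp ha j ψ))
        - inner ℂ (φ : Hs) (mulOp (f₂ j) ψ)) := by
  simp only [OscScatt.inner_formVec, ← h.inner_kinOp ha _ φ ψ, Finset.sum_sub_distrib]
  -- Multiplication by x commutes with f, so the position components cancel.
  have h1 : ∑ j, (inner ℂ (posOp j φ) (posOp j (h.mul ψ)) : ℂ)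
      = ∑ j, inner ℂ (posOp j (h.star.mul φ)) (posOp j ψ) := by
    refine Finset.sum_congr rfl fun j _ => ?_
    rw [h.posOp_mul, h.star.posOp_mul, inner_mulOp_left, star_star]
  rw [h1]
  ring

/-- The vector φ enters through its L² norm alone. This is what later allows duality over a dense
set of vectors φ. -/
theorem SmoothMultiplier.norm_inner_formVec_le (h : SmoothMultiplier f f₁ f₂)
    (ha : MemLp a ⊤ (volume : Measure E3)) (φ ψ : formDom) :
    ‖(inner ℂ (formVec ha φ) (formVec ha (h.mul ψ)) : ℂ)
      - inner ℂ (formVec ha (h.star.mul φ)) (formVec ha ψ)‖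
      ≤ ‖(φ : Hs)‖ * (2 * (∑ j, ‖f₁ j‖) * ‖formVec ha ψ‖ + (∑ j, ‖f₂ j‖) * ‖(ψ : Hs)‖) := by
  rw [h.inner_formVec]
  refine (norm_sum_le _ _).trans ?_
  have h1 : ‖(φ : Hs)‖ * (2 * (∑ j, ‖f₁ j‖) * ‖formVec ha ψ‖ + (∑ j, ‖f₂ j‖) * ‖(ψ : Hs)‖)
      = ∑ j, (2 * (‖(φ : Hs)‖ * (‖f₁ j‖ * ‖formVec ha ψ‖))
        + ‖(φ : Hs)‖ * (‖f₂ j‖ * ‖(ψ : Hs)‖)) := by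
    rw [Finset.sum_add_distrib, ← Finset.mul_sum, ← Finset.mul_sum, ← Finset.mul_sum,
      ← Finset.sum_mul, ← Finset.sum_mul]
    ring
  rw [h1]
  refine Finset.sum_le_sum fun j _ => (norm_sub_le _ _).trans (add_le_add ?_ ?_)
  · rw [norm_mul]
    have h2 : ‖-(2 * Complex.I)‖ = 2 := by simp
    rw [h2]
    refine mul_le_mul_of_nonneg_left ((norm_inner_le_norm _ _).trans ?_) zero_le_two
    gcongr
    refine (norm_mulOp_le _ _).trans ?_
    gcongr
    exact norm_kinOp_le ha j ψ
  · refine (norm_inner_le_norm _ _).trans ?_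
    gcongr
    exact norm_mulOp_le _ _

end Commutator

/-! ### Test functions lie in the domain of the free oscillator -/

section Density

theorem toLp_mem_formDom {g : E3 → ℂ} (hg : ContDiff ℝ ∞ g) (hc : HasCompactSupport g) :
    (hg.continuous.memLp_of_hasCompactSupport hc (p := 2) (μ := volume)).toLp ∈ formDom := by
  intro j
  refine ⟨⟨_, hasWeakPartial_toLp hg hc j⟩, ?_⟩
  have h1 : Continuous fun x : E3 => ((x j : ℝ) : ℂ) * g x :=
    Continuous.mul (by fun_prop) hg.continuous
  refine (h1.memLp_of_hasCompactSupport hc.mul_left (p := 2) (μ := volume)).ae_eq ?_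
  filter_upwards [(hg.continuous.memLp_of_hasCompactSupport hc (p := 2) (μ := volume)).coeFn_toLp]
    with x hx
  rw [hx]

theorem toLp_mem_domH0 {g : E3 → ℂ} (hg : ContDiff ℝ ∞ g) (hc : HasCompactSupport g) :
    (hg.continuous.memLp_of_hasCompactSupport hc (p := 2) (μ := volume)).toLp ∈ domH0 := by
  have h0 : MemLp (0 : E3 → E3) ⊤ (volume : Measure E3) := MemLp.zero
  have hd := fun j : Fin 3 => contDiff_fderiv_const hg (EuclideanSpace.single j 1)
  have hcd := fun j : Fin 3 => hasCompactSupport_fderiv_apply hc (EuclideanSpace.single j 1)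
  have hx : ∀ j : Fin 3, MemLp (fun x : E3 => ((x j : ℝ) : ℂ) * (((x j : ℝ) : ℂ) * g x)) 2
      (volume : Measure E3) := fun j =>
    Continuous.memLp_of_hasCompactSupport (by have := hg.continuous; fun_prop)
      hc.mul_left.mul_left
  set G : formDom := ⟨_, toLp_mem_formDom hg hc⟩
  have hpos : ∀ (j : Fin 3) (φ : formDom), (inner ℂ (posOp j φ) (posOp j G) : ℂ)
      = inner ℂ (φ : Hs) (hx j).toLp := by
    intro j φ
    rw [L2.inner_def, L2.inner_def]
    refine integral_congr_ae ?_
    filter_upwards [coeFn_posOp j φ, coeFn_posOp j G, (hx j).coeFn_toLp,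
      (hg.continuous.memLp_of_hasCompactSupport hc (p := 2) (μ := volume)).coeFn_toLp]
      with x h1 h2 h3 h4
    rw [h1, h2, h3]
    simp only [G, h4, RCLike.inner_apply, map_mul, Complex.conj_ofReal]
    ring
  have hw : ∀ j, HasWeakPartial j (partialOp j G) _ := fun j => by
    have := hasWeakPartial_toLp (hd j) (hcd j) j
    rwa [← partialOp_eq (ψ := G) (hasWeakPartial_toLp hg hc j)] at this
  -- The value of h₀ on G is ½ Σ (−∂ⱼ²G + xⱼ²G).
  refine ⟨(1 / 2 : ℂ) • ∑ j, (-(weakPartial j (partialOp j G)) + (hx j).toLp), G.2,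
    fun φ hφ => ?_⟩
  have h1 := hForm_eq_inner h0 ⟨φ, hφ⟩ G
  refine h1.trans ?_
  rw [inner_formVec, inner_smul_right, inner_sum, ← Finset.sum_add_distrib]
  congr 1
  refine Finset.sum_congr rfl fun j _ => ?_
  rw [hpos, inner_add_right]
  congr 1
  have hp0 : ∀ ψ : Hs, potOp h0 j ψ = 0 := by
    intro ψ
    ext1
    filter_upwards [coeFn_potOp h0 j ψ, Lp.coeFn_zero ℂ 2 (volume : Measure E3)] with x h1 h2
    rw [h1, h2]
    simp
  have h2 := (formDom.hasWeakPartial ⟨φ, hφ⟩ j).inner_eq (hw j)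
  rw [(hw j).weakPartial_eq, inner_neg_right, h2, kinOp_apply, kinOp_apply, hp0, hp0, sub_zero,
    sub_zero, inner_smul_left, inner_smul_right, neg_neg]
  simp only [map_neg, Complex.conj_I, neg_neg]
  rw [← mul_assoc, mul_neg, Complex.I_mul_I, neg_neg, one_mul]
  rfl

theorem dense_domH0 : Dense domH0 := by
  refine (Lp.dense_hasCompactSupport_contDiff (F := ℂ) (μ := (volume : Measure E3)) (p := 2)
    (by simp)).mono ?_
  rintro ψ ⟨g, hψ, hc, hg⟩
  have h1 : ψ = (hg.continuous.memLp_of_hasCompactSupport hc (p := 2) (μ := volume)).toLp := by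
    ext1
    exact hψ.trans (MemLp.coeFn_toLp _).symm
  rw [h1]
  exact toLp_mem_domH0 hg hc

end Density


/-! ### Abstract energy estimate for a form that varies in time -/

section EnergyEstimate

/-- For q ≥ 0 the map q ↦ √(κ² + q²) is increasing and 1-Lipschitz. A positive κ will regularize the
square root of the energy where the energy vanishes. -/
theorem sqrt_add_sq_le {κ p q d : ℝ} (hd : 0 ≤ d) (hq : 0 ≤ q) (hpq : p ≤ q + d) (hp : 0 ≤ p) :
    √(κ ^ 2 + p ^ 2) ≤ √(κ ^ 2 + q ^ 2) + d := by
  have h1 : q ≤ √(κ ^ 2 + q ^ 2) := Real.le_sqrt_of_sq_le (by nlinarith [sq_nonneg κ])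
  refine Real.sqrt_le_iff.2 ⟨by positivity, ?_⟩
  rw [add_sq, Real.sq_sqrt (by positivity)]
  nlinarith

theorem continuousOn_of_monotone_of_le {A : ℝ → ℝ} {S : Set ℝ}
    (hm : ∀ t ∈ S, ∀ t' ∈ S, t ≤ t' → A t ≤ A t')
    (hl : ∃ L, ∀ t ∈ S, ∀ t' ∈ S, t ≤ t' → A t' - A t ≤ L * (t' - t)) : ContinuousOn A S := by
  obtain ⟨L, hL⟩ := hl
  have h1 : LipschitzOnWith (Real.toNNReal L) A S := by
    refine LipschitzOnWith.of_dist_le_mul fun t ht t' ht' => ?_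
    rw [Real.dist_eq, Real.dist_eq]
    have h2 : ∀ x, L * |x| ≤ (Real.toNNReal L : ℝ) * |x| := fun x =>
      mul_le_mul_of_nonneg_right (Real.le_coe_toNNReal L) (abs_nonneg x)
    refine le_trans ?_ (h2 _)
    rcases le_total t t' with h3 | h3
    · rw [abs_sub_comm, abs_of_nonneg (sub_nonneg.2 (hm t ht t' ht' h3)), abs_sub_comm,
        abs_of_nonneg (sub_nonneg.2 h3)]
      exact hL t ht t' ht' h3
    · rw [abs_of_nonneg (sub_nonneg.2 (hm t' ht' t ht h3)), abs_of_nonneg (sub_nonneg.2 h3)]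
      exact hL t' ht' t ht h3
  exact h1.continuousOn

variable {H K : Type*} [NormedAddCommGroup H] [InnerProductSpace ℂ H]
  [NormedAddCommGroup K] [InnerProductSpace ℂ K] {D : Submodule ℂ H}

/-- A curve in the form domain that solves `∂ₜ ψ = i s η` with `η = ½ V* V ψ` weakly, where the
form vectors `V t` vary in time with rate controlled by `A`. -/
structure IsFormSolution (V : ℝ → D →ₗ[ℂ] K) (A : ℝ → ℝ) (s : ℝ) (ψ : ℝ → D) (η : ℝ → H)
    (S : Set ℝ) : Prop where
  mono : ∀ t ∈ S, ∀ t' ∈ S, t ≤ t' → A t ≤ A t'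
  lip : ∃ L, ∀ t ∈ S, ∀ t' ∈ S, t ≤ t' → A t' - A t ≤ L * (t' - t)
  vary : ∀ t ∈ S, ∀ t' ∈ S, t ≤ t' → ∀ φ, ‖V t' φ - V t φ‖ ≤ (A t' - A t) * ‖(φ : H)‖
  weak : ∀ t ∈ S, ∀ φ, (1 / 2) * (inner ℂ (V t φ) (V t (ψ t)) : ℂ) = inner ℂ (φ : H) (η t)
  cont : ContinuousOn η S
  deriv : ∀ t ∈ S, HasDerivAt (fun t => (ψ t : H)) ((s * Complex.I) • η t) t

variable {V : ℝ → D →ₗ[ℂ] K} {A : ℝ → ℝ} {s : ℝ} {ψ : ℝ → D} {η : ℝ → H} {S : Set ℝ} {c : ℝ}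

theorem IsFormSolution.norm_sq (h : IsFormSolution V A s ψ η S) {t : ℝ} (ht : t ∈ S) :
    ‖V t (ψ t)‖ ^ 2 = 2 * (inner ℂ (ψ t : H) (η t) : ℂ).re := by
  have h1 := h.weak t ht (ψ t)
  rw [← h1, inner_self_eq_norm_sq_to_K]
  have h2 : (1 / 2 : ℂ) * ((‖V t (ψ t)‖ : ℝ) : ℂ) ^ 2 = ((1 / 2 * ‖V t (ψ t)‖ ^ 2 : ℝ) : ℂ) := by
    push_cast
    rfl
  change _ = 2 * ((1 / 2 : ℂ) * ((‖V t (ψ t)‖ : ℝ) : ℂ) ^ 2).re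
  rw [h2, Complex.ofReal_re]
  ring

/-- Continuity in the form norm is not assumed. The weak equation gives ‖Vψ‖² = 2 Re ⟪ψ, η⟫, and ψ
and η are continuous in H. -/
theorem IsFormSolution.continuousOn (h : IsFormSolution V A s ψ η S) :
    ContinuousOn (fun t => ‖V t (ψ t)‖) S := by
  have h1 : ContinuousOn (fun t => (ψ t : H)) S := fun t ht =>
    (h.deriv t ht).continuousAt.continuousWithinAt
  have h2 : ContinuousOn (fun t => √(2 * (inner ℂ (ψ t : H) (η t) : ℂ).re)) S :=
    (continuousOn_const.mul (Complex.continuous_re.comp_continuousOn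
      (ContinuousOn.inner (𝕜 := ℂ) h1 h.cont))).sqrt
  refine h2.congr fun t ht => ?_
  change _ = √(2 * (inner ℂ (ψ t : H) (η t) : ℂ).re)
  rw [← h.norm_sq ht, Real.sqrt_sq (norm_nonneg _)]

theorem IsFormSolution.continuousOn_rate (h : IsFormSolution V A s ψ η S) : ContinuousOn A S :=
  continuousOn_of_monotone_of_le h.mono h.lip

/-- The energy with respect to the form frozen at time `x` is stationary at time `x`. -/
theorem IsFormSolution.eventually_norm_sq_sub_le {a b : ℝ}
    (h : IsFormSolution V A s ψ η (Icc a b)) (hc : ∀ t ∈ Icc a b, ‖(ψ t : H)‖ ≤ c) {x : ℝ}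
    (hx : x ∈ Ico a b) {ρ : ℝ} (hρ : 0 < ρ) :
    ∀ᶠ z in 𝓝[>] x, ‖V x (ψ z)‖ ^ 2 - ‖V x (ψ x)‖ ^ 2 ≤ ρ * (z - x) := by
  have hxI : x ∈ Icc a b := Ico_subset_Icc_self hx
  have hc0 : 0 ≤ c := (norm_nonneg _).trans (hc x hxI)
  obtain ⟨L', hL'⟩ := h.lip
  obtain ⟨L, hL0, hL⟩ : ∃ L, 0 ≤ L ∧ ∀ t ∈ Icc a b, ∀ t' ∈ Icc a b, t ≤ t' →
      A t' - A t ≤ L * (t' - t) :=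
    ⟨max L' 0, le_max_right _ _, fun t ht t' ht' htt => (hL' t ht t' ht' htt).trans
      (mul_le_mul_of_nonneg_right (le_max_left _ _) (sub_nonneg.2 htt))⟩
  set v : H := (s * Complex.I) • η x with hv
  set M : ℝ := ‖v‖ + 1
  set Y : ℝ := ‖V x (ψ x)‖ + 1
  have hM : 0 < M := by positivity
  have hY : 0 < Y := by positivity
  -- The coefficient of ρ₁ (z − x) obtained when all the error terms below are added up; ρ₁ is then
  -- taken so small that ρ₁ C ≤ ρ.
  set C : ℝ := 4 * ‖η x‖ + 4 * M + 2 * L * M * Y + L ^ 2 * c ^ 2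
  have hC : 0 ≤ C := by positivity
  obtain ⟨ρ₁, hρ0, hρ1, hρC⟩ : ∃ ρ₁ > 0, ρ₁ ≤ 1 ∧ ρ₁ * C ≤ ρ := by
    refine ⟨min 1 (ρ / (C + 1)), by positivity, min_le_left _ _, ?_⟩
    calc min 1 (ρ / (C + 1)) * C ≤ ρ / (C + 1) * C :=
        mul_le_mul_of_nonneg_right (min_le_right _ _) hC
      _ ≤ ρ := by
        rw [div_mul_eq_mul_div, div_le_iff₀ (by positivity)]
        nlinarith
  have hIcc : Icc a b ∈ 𝓝[>] x :=
    mem_of_superset (Ioo_mem_nhdsGT hx.2) fun z hz => ⟨hx.1.trans hz.1.le, hz.2.le⟩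
  have hle : 𝓝[>] x ≤ 𝓝[Icc a b] x :=
    le_inf (nhdsWithin_le_nhds) (le_principal_iff.2 hIcc)
  have e1 : ∀ᶠ z in 𝓝[>] x, ‖(ψ z : H) - ψ x - (z - x) • v‖ ≤ ρ₁ * ‖z - x‖ :=
    nhdsWithin_le_nhds ((hasDerivAt_iff_isLittleO.1 (h.deriv x hxI)).bound hρ0)
  have e2 : ∀ᶠ z in 𝓝[>] x, ‖η z - η x‖ < ρ₁ := by
    have := hle (Metric.tendsto_nhds.1 (h.cont x hxI) ρ₁ hρ0)
    filter_upwards [this] with z hz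
    rwa [dist_eq_norm] at hz
  have e3 : ∀ᶠ z in 𝓝[>] x, ‖V z (ψ z)‖ < Y :=
    hle ((h.continuousOn x hxI).eventually_lt continuousWithinAt_const (lt_add_one _))
  have e4 : ∀ᶠ z in 𝓝[>] x, z < x + ρ₁ :=
    nhdsWithin_le_nhds (eventually_lt_nhds (lt_add_of_pos_right x hρ0))
  filter_upwards [e1, e2, e3, e4, hIcc, self_mem_nhdsWithin] with z h1 h2 h3 h4 hz hxz
  have hxz' : x < z := hxz
  have hε : 0 < z - x := sub_pos.2 hxz'
  rw [Real.norm_eq_abs, abs_of_pos hε] at h1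
  set ε : ℝ := z - x
  set δ : D := ψ z - ψ x
  have hδ : ((δ : D) : H) = (ψ z : H) - ψ x := rfl
  rw [← hδ] at h1
  have hδM : ‖(δ : H)‖ ≤ M * ε := by
    have : ‖(δ : H)‖ ≤ ‖(δ : H) - ε • v‖ + ‖ε • v‖ := by
      simpa using norm_add_le ((δ : H) - ε • v) (ε • v)
    rw [norm_smul, Real.norm_eq_abs, abs_of_pos hε] at this
    have h5 : ρ₁ * ε ≤ 1 * ε := mul_le_mul_of_nonneg_right hρ1 hε.le
    calc ‖(δ : H)‖ ≤ ρ₁ * ε + ε * ‖v‖ := this.trans (add_le_add_left h1 _)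
      _ ≤ M * ε := by simp only [M]; linarith
  set α : ℝ := A z - A x
  have hα0 : 0 ≤ α := sub_nonneg.2 (h.mono x hxI z hz hxz'.le)
  have hα : α ≤ L * ε := hL x hxI z hz hxz'.le
  -- the linear term
  have hlin : (inner ℂ (V x (ψ x)) (V x δ) : ℂ).re ≤ 2 * (ρ₁ * ε) * ‖η x‖ := by
    have i1 := h.weak x hxI δ
    have i2 : (inner ℂ (V x (ψ x)) (V x δ) : ℂ).re = 2 * (inner ℂ (δ : H) (η x) : ℂ).re := by
      rw [← i1, ← inner_conj_symm, Complex.conj_re]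
      simp only [Complex.mul_re]
      norm_num
      ring
    -- The velocity v is an imaginary multiple of η x, so the energy has no first-order variation.
    have i3 : (inner ℂ (ε • v) (η x) : ℂ).re = 0 := by
      have : (ε • v : H) = ((ε * s : ℝ) * Complex.I : ℂ) • η x := by
        rw [hv, ← Complex.coe_smul, smul_smul]
        push_cast
        ring_nf
      rw [this, inner_smul_left, inner_self_eq_norm_sq_to_K]
      simp [← Complex.ofReal_pow]
    have i4 : (inner ℂ (δ : H) (η x) : ℂ).re = (inner ℂ ((δ : H) - ε • v) (η x) : ℂ).re := by
      rw [inner_sub_left, Complex.sub_re, i3, sub_zero]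
    rw [i2, i4]
    have i5 := (Complex.re_le_norm _).trans (norm_inner_le_norm (𝕜 := ℂ) ((δ : H) - ε • v) (η x))
    have i6 := mul_le_mul_of_nonneg_right h1 (norm_nonneg (η x))
    linarith
  -- the quadratic term
  set w : ℝ := ‖V x δ‖
  have hquad : w ^ 2 ≤ 2 * (M * ε * ρ₁) + α * (M * ε) * Y + w * (α * c) := by
    have j0 : V x δ = V x (ψ z) - V x (ψ x) := map_sub _ _ _
    -- Exchanging the form at time x for the one at time z gives access to the weak equation at z.
    -- Each exchange costs a factor A z − A x, and the main term 2⟪δ, η z − η x⟫ is small by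
    -- continuity of η.
    have j1 : (inner ℂ (V x δ) (V x (ψ z)) : ℂ) = inner ℂ (V z δ) (V z (ψ z))
        - inner ℂ (V z δ - V x δ) (V z (ψ z)) - inner ℂ (V x δ) (V z (ψ z) - V x (ψ z)) := by
      simp only [inner_sub_left, inner_sub_right]
      ring
    have j2 : (inner ℂ (V x δ) (V x δ) : ℂ) = 2 * inner ℂ (δ : H) (η z - η x)
        - inner ℂ (V z δ - V x δ) (V z (ψ z)) - inner ℂ (V x δ) (V z (ψ z) - V x (ψ z)) := by
      nth_rewrite 2 [j0]
      have j4 := h.weak z hz δ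
      have j5 := h.weak x hxI δ
      rw [inner_sub_right, j1, inner_sub_right (δ : H)]
      linear_combination 2 * j4 - 2 * j5
    have j3 : w ^ 2 = ‖(inner ℂ (V x δ) (V x δ) : ℂ)‖ := by
      rw [inner_self_eq_norm_sq_to_K]
      simp [w]
    rw [j3, j2]
    have hvz := h.vary x hxI z hz hxz'.le
    refine (norm_sub_le _ _).trans (add_le_add ((norm_sub_le _ _).trans (add_le_add ?_ ?_)) ?_)
    · rw [norm_mul]
      have : ‖(2 : ℂ)‖ = 2 := by simp
      rw [this]
      refine mul_le_mul_of_nonneg_left ((norm_inner_le_norm _ _).trans ?_) zero_le_two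
      exact mul_le_mul hδM h2.le (norm_nonneg _) (by positivity)
    · refine (norm_inner_le_norm _ _).trans ?_
      refine mul_le_mul ((hvz δ).trans ?_) h3.le (norm_nonneg _) (by positivity)
      exact mul_le_mul_of_nonneg_left hδM hα0
    · refine (norm_inner_le_norm _ _).trans ?_
      refine mul_le_mul_of_nonneg_left ((hvz (ψ z)).trans ?_) (norm_nonneg _)
      exact mul_le_mul_of_nonneg_left (hc z hz) hα0
  -- The term w α c is absorbed through 2 w α c ≤ w² + (α c)².
  have hw : w ^ 2 ≤ 4 * (M * ε * ρ₁) + 2 * (α * (M * ε) * Y) + (α * c) ^ 2 := by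
    nlinarith [sq_nonneg (w - α * c)]
  have hsplit : ‖V x (ψ z)‖ ^ 2 - ‖V x (ψ x)‖ ^ 2
      = 2 * (inner ℂ (V x (ψ x)) (V x δ) : ℂ).re + w ^ 2 := by
    have k1 : V x (ψ z) = V x (ψ x) + V x δ := by
      rw [← map_add]
      congr 1
      simp [δ]
    have k2 := norm_add_sq (𝕜 := ℂ) (V x (ψ x)) (V x δ)
    rw [← k1] at k2
    simp only [RCLike.re_to_complex] at k2
    linarith
  rw [hsplit]
  have hε1 : ε ≤ ρ₁ := by simp only [ε]; linarith
  have m1 : α * (M * ε) * Y ≤ L * M * Y * (ρ₁ * ε) := by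
    calc α * (M * ε) * Y ≤ (L * ε) * (M * ε) * Y := by gcongr
      _ = L * M * Y * (ε * ε) := by ring
      _ ≤ L * M * Y * (ρ₁ * ε) := by gcongr
  have m2 : (α * c) ^ 2 ≤ L ^ 2 * c ^ 2 * (ρ₁ * ε) := by
    calc (α * c) ^ 2 ≤ (L * ε * c) ^ 2 := by gcongr
      _ = L ^ 2 * c ^ 2 * (ε * ε) := by ring
      _ ≤ L ^ 2 * c ^ 2 * (ρ₁ * ε) := by gcongr
  have m3 : ρ₁ * C * ε ≤ ρ * ε := mul_le_mul_of_nonneg_right hρC hε.le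
  have m4 : ρ₁ * C * ε = 4 * ‖η x‖ * (ρ₁ * ε) + 4 * (M * ε * ρ₁)
      + 2 * (L * M * Y * (ρ₁ * ε)) + L ^ 2 * c ^ 2 * (ρ₁ * ε) := by
    simp only [C]
    ring
  linarith

/-- The growth of the energy is controlled by the variation of the form. -/
theorem IsFormSolution.norm_le {a b : ℝ} (h : IsFormSolution V A s ψ η (Icc a b))
    (hc : ∀ t ∈ Icc a b, ‖(ψ t : H)‖ ≤ c) {t : ℝ} (ht : t ∈ Icc a b) :
    ‖V t (ψ t)‖ ≤ ‖V a (ψ a)‖ + c * (A t - A a) := by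
  have haI : a ∈ Icc a b := ⟨le_rfl, ht.1.trans ht.2⟩
  have hc0 : 0 ≤ c := (norm_nonneg _).trans (hc a haI)
  -- The regularized form norm minus c A is nonincreasing from a, by the criterion on right slopes.
  -- With κ = 0 the square root could fail to be differentiable at zero energy.
  have key : ∀ κ > 0, √(κ ^ 2 + ‖V t (ψ t)‖ ^ 2) - c * A t
      ≤ √(κ ^ 2 + ‖V a (ψ a)‖ ^ 2) - c * A a := by
    intro κ hκ
    refine image_le_of_liminf_slope_right_le_deriv_boundary
      (f := fun t => √(κ ^ 2 + ‖V t (ψ t)‖ ^ 2) - c * A t)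
      (B := fun _ => √(κ ^ 2 + ‖V a (ψ a)‖ ^ 2) - c * A a) (B' := fun _ => 0)
      (((continuousOn_const.add (h.continuousOn.pow 2)).sqrt).sub
        (continuousOn_const.mul h.continuousOn_rate)) le_rfl continuousOn_const
      (fun x _ => hasDerivWithinAt_const _ _ _) (fun x hx r hr => ?_) ht
    have hxI : x ∈ Icc a b := Ico_subset_Icc_self hx
    have hIcc : Icc a b ∈ 𝓝[>] x :=
      mem_of_superset (Ioo_mem_nhdsGT hx.2) fun z hz => ⟨hx.1.trans hz.1.le, hz.2.le⟩
    refine Eventually.frequently ?_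
    -- The tolerance r κ on squares becomes less than r on square roots, because the sum of the two
    -- roots is at least 2κ.
    filter_upwards [h.eventually_norm_sq_sub_le hc hx (ρ := r * κ) (by positivity), hIcc,
      self_mem_nhdsWithin] with z h1 hz hxz
    have hxz' : x < z := hxz
    have hε : 0 < z - x := sub_pos.2 hxz'
    rw [slope_def_field, div_lt_iff₀ hε]
    have hα0 : 0 ≤ A z - A x := sub_nonneg.2 (h.mono x hxI z hz hxz'.le)
    have h2 : ‖V z (ψ z)‖ ≤ ‖V x (ψ z)‖ + (A z - A x) * c := by
      have h3 : ‖V z (ψ z)‖ ≤ ‖V x (ψ z)‖ + ‖V z (ψ z) - V x (ψ z)‖ := by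
        simpa using norm_add_le (V x (ψ z)) (V z (ψ z) - V x (ψ z))
      exact h3.trans (add_le_add_right ((h.vary x hxI z hz hxz'.le (ψ z)).trans
        (mul_le_mul_of_nonneg_left (hc z hz) hα0)) _)
    have h4 := sqrt_add_sq_le (κ := κ) (mul_nonneg hα0 hc0) (norm_nonneg _) h2 (norm_nonneg _)
    set p := ‖V x (ψ z)‖
    set q := ‖V x (ψ x)‖
    have hP : 0 ≤ √(κ ^ 2 + p ^ 2) := Real.sqrt_nonneg _
    have hQ : κ ≤ √(κ ^ 2 + q ^ 2) := Real.le_sqrt_of_sq_le (by nlinarith [sq_nonneg q])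
    have hP' : κ ≤ √(κ ^ 2 + p ^ 2) := Real.le_sqrt_of_sq_le (by nlinarith [sq_nonneg p])
    have hP2 : √(κ ^ 2 + p ^ 2) ^ 2 = κ ^ 2 + p ^ 2 := Real.sq_sqrt (by positivity)
    have hQ2 : √(κ ^ 2 + q ^ 2) ^ 2 = κ ^ 2 + q ^ 2 := Real.sq_sqrt (by positivity)
    have h5 : √(κ ^ 2 + p ^ 2) - √(κ ^ 2 + q ^ 2) < r * (z - x) := by
      by_contra hcon
      push Not at hcon
      have h6 : 0 < r * (z - x) := mul_pos hr hε
      nlinarith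
    linarith
  have hlim : ∀ x : ℝ, 0 ≤ x → Tendsto (fun κ : ℝ => √(κ ^ 2 + x ^ 2)) (𝓝[>] 0) (𝓝 x) := by
    intro x hx
    have : Continuous fun κ : ℝ => √(κ ^ 2 + x ^ 2) := by fun_prop
    have h1 := (this.tendsto 0).mono_left (nhdsWithin_le_nhds (s := Ioi 0))
    simpa [Real.sqrt_sq hx] using h1
  have := le_of_tendsto_of_tendsto ((hlim _ (norm_nonneg (V t (ψ t)))).sub_const (c * A t))
    ((hlim _ (norm_nonneg (V a (ψ a)))).sub_const (c * A a))
    (eventually_nhdsWithin_of_forall fun κ hκ => key κ hκ)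
  linarith

/-- Time reversal changes the sign of the equation, which is why `IsFormSolution` carries the factor
s. It gives the estimate towards the past. -/
theorem IsFormSolution.reverse {a b : ℝ} (h : IsFormSolution V A s ψ η (Icc a b)) :
    IsFormSolution (fun t => V (-t)) (fun t => -A (-t)) (-s) (fun t => ψ (-t)) (fun t => η (-t))
      (Icc (-b) (-a)) := by
  have hm : ∀ t ∈ Icc (-b) (-a), -t ∈ Icc a b := fun t ht =>
    ⟨le_neg_of_le_neg ht.2, neg_le_of_neg_le ht.1⟩
  refine ⟨fun t ht t' ht' htt => neg_le_neg (h.mono _ (hm t' ht') _ (hm t ht) (neg_le_neg htt)),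
    ?_, fun t ht t' ht' htt φ => ?_, fun t ht => h.weak _ (hm t ht), ?_, fun t ht => ?_⟩
  · obtain ⟨L, hL⟩ := h.lip
    refine ⟨L, fun t ht t' ht' htt => ?_⟩
    have := hL _ (hm t' ht') _ (hm t ht) (neg_le_neg htt)
    linarith
  · have := h.vary _ (hm t' ht') _ (hm t ht) (neg_le_neg htt) φ
    have e : -A (-t') - -A (-t) = A (-t) - A (-t') := by ring
    rw [norm_sub_rev, e]
    exact this
  · exact h.cont.comp continuous_neg.continuousOn hm
  · have := (h.deriv _ (hm t ht)).scomp t (hasDerivAt_neg t)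
    have e : ((-s : ℝ) * Complex.I : ℂ) • η (-t) = (-1 : ℝ) • ((s * Complex.I : ℂ) • η (-t)) := by
      simp [neg_mul, neg_smul]
    rw [e]
    exact this

theorem IsFormSolution.norm_le' {a b : ℝ} (h : IsFormSolution V A s ψ η (Icc a b))
    (hc : ∀ t ∈ Icc a b, ‖(ψ t : H)‖ ≤ c) {t : ℝ} (ht : t ∈ Icc a b) :
    ‖V t (ψ t)‖ ≤ ‖V b (ψ b)‖ + c * (A b - A t) := by
  have h1 := h.reverse.norm_le (c := c) (t := -t)
    (fun t ht => hc (-t) ⟨le_neg_of_le_neg ht.2, neg_le_of_neg_le ht.1⟩)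
    ⟨neg_le_neg ht.2, neg_le_neg ht.1⟩
  simp only [neg_neg] at h1
  linarith

end EnergyEstimate


/-! ### Energy growth and time regularity of functions of the position -/

section DominatedPotential

/-- The time-dependent bounded vector potential `a` varies in time with a rate dominated by the
locally Lipschitz function `A`, which is integrable up to the ends of the time interval. -/
structure IsDominatedPotential (a : ℝ → E3 → E3) (A : ℝ → ℝ) : Prop where
  memLp : ∀ τ ∈ timeInt, MemLp (a τ) ⊤ (volume : Measure E3)
  mono : ∀ σ ∈ timeInt, ∀ τ ∈ timeInt, σ ≤ τ → A σ ≤ A τ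
  lip : ∀ α β, Icc α β ⊆ timeInt → ∃ L, ∀ σ ∈ Icc α β, ∀ τ ∈ Icc α β, σ ≤ τ →
    A τ - A σ ≤ L * (τ - σ)
  norm_sub_le : ∀ σ ∈ timeInt, ∀ τ ∈ timeInt, σ ≤ τ → ∀ᵐ x, ‖a τ x - a σ x‖ ≤ A τ - A σ
  integrableOn : IntegrableOn (fun τ => |A τ - A 0|) timeInt

theorem zero_mem_timeInt : (0 : ℝ) ∈ timeInt :=
  ⟨neg_lt_zero.2 Real.pi_div_two_pos, Real.pi_div_two_pos⟩

theorem isOpen_timeInt : IsOpen timeInt := isOpen_Ioo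

theorem Icc_subset_timeInt {σ τ : ℝ} (hσ : σ ∈ timeInt) (hτ : τ ∈ timeInt) :
    Icc σ τ ⊆ timeInt :=
  fun _ ht => ⟨hσ.1.trans_le ht.1, ht.2.trans_lt hτ.2⟩

theorem continuousOn_timeInt {A : ℝ → ℝ}
    (hm : ∀ σ ∈ timeInt, ∀ τ ∈ timeInt, σ ≤ τ → A σ ≤ A τ)
    (hl : ∀ α β, Icc α β ⊆ timeInt → ∃ L, ∀ σ ∈ Icc α β, ∀ τ ∈ Icc α β, σ ≤ τ →
      A τ - A σ ≤ L * (τ - σ)) : ContinuousOn A timeInt := by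
  intro t ht
  obtain ⟨α, hα1, hα2⟩ := exists_between ht.1
  obtain ⟨β, hβ1, hβ2⟩ := exists_between ht.2
  have hs : Icc α β ⊆ timeInt := fun x hx => ⟨hα1.trans_le hx.1, hx.2.trans_lt hβ2⟩
  have h1 := continuousOn_of_monotone_of_le (S := Icc α β)
    (fun t ht t' ht' => hm t (hs ht) t' (hs ht')) (hl α β hs)
  exact (h1.continuousAt (Icc_mem_nhds hα2 hβ1)).continuousWithinAt

open Classical in
/-- The vector `((p - a(τ)) ψ, x ψ)`. -/
def potVec (a : ℝ → E3 → E3) (τ : ℝ) : formDom →ₗ[ℂ] PiLp 2 (fun _ : Fin 3 ⊕ Fin 3 => Hs) :=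
  if h : MemLp (a τ) ⊤ (volume : Measure E3) then formVec h else 0

theorem potVec_eq {a : ℝ → E3 → E3} {τ : ℝ} (h : MemLp (a τ) ⊤ (volume : Measure E3)) :
    potVec a τ = formVec h := dif_pos h

open Classical in
/-- The curve `τ ↦ u(τ, 0) ψ` in the form domain. -/
def orbit (u : ℝ → ℝ → Hs ≃ₗᵢ[ℂ] Hs) (ψ : Hs) (τ : ℝ) : formDom :=
  if h : u τ 0 ψ ∈ formDom then ⟨u τ 0 ψ, h⟩ else 0

variable {a : ℝ → E3 → E3} {A : ℝ → ℝ} {u : ℝ → ℝ → Hs ≃ₗᵢ[ℂ] Hs} {ψ φ : Hs} {τ σ : ℝ}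

theorem IsPropagator.coe_orbit (hu : IsPropagator a u) (hψ : ψ ∈ domH0) (hτ : τ ∈ timeInt) :
    (orbit u ψ τ : Hs) = u τ 0 ψ := by
  obtain ⟨η, h1, -⟩ := hu.deriv_left ψ hψ τ hτ 0 zero_mem_timeInt
  have h2 : u τ 0 ψ ∈ formDom := h1.1
  rw [orbit, dif_pos h2]

/-- The vector `h(τ) u(τ, 0) ψ`. -/
def hamOrbit (u : ℝ → ℝ → Hs ≃ₗᵢ[ℂ] Hs) (ψ : Hs) (τ : ℝ) : Hs :=
  Complex.I • deriv (fun τ' => u τ' 0 ψ) τ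

theorem IsPropagator.hasDerivAt_orbit (hu : IsPropagator a u) (hψ : ψ ∈ domH0)
    (hτ : τ ∈ timeInt) : IsHam (a τ) (u τ 0 ψ) (hamOrbit u ψ τ) ∧
      HasDerivAt (fun τ' => u τ' 0 ψ) (-Complex.I • hamOrbit u ψ τ) τ := by
  obtain ⟨η, h1, h2⟩ := hu.deriv_left ψ hψ τ hτ 0 zero_mem_timeInt
  have h3 : hamOrbit u ψ τ = η := by
    rw [hamOrbit, h2.deriv, smul_smul]
    simp
  rw [h3]
  exact ⟨h1, h2⟩

/-- Defining h(τ)u(τ,0)ψ as i times the time derivative reduces this to the C¹ property of the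
propagator; no continuity of h(τ) in τ is involved. -/
theorem IsPropagator.continuousOn_hamOrbit (hu : IsPropagator a u) (hψ : ψ ∈ domH0) :
    ContinuousOn (hamOrbit u ψ) timeInt := by
  have h1 : ContDiffOn ℝ 1 (fun τ => u τ 0 ψ) timeInt :=
    (hu.contDiff ψ hψ).comp (f := fun τ : ℝ => (τ, (0 : ℝ)))
      (contDiff_id.prodMk contDiff_const).contDiffOn fun τ hτ => ⟨hτ, zero_mem_timeInt⟩
  exact (h1.continuousOn_deriv_of_isOpen isOpen_timeInt le_rfl).const_smul Complex.I

theorem IsPropagator.weak (hu : IsPropagator a u) (ha : IsDominatedPotential a A)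
    (hψ : ψ ∈ domH0) (hτ : τ ∈ timeInt) (χ : formDom) :
    (1 / 2) * (inner ℂ (potVec a τ χ) (potVec a τ (orbit u ψ τ)) : ℂ)
      = inner ℂ (χ : Hs) (hamOrbit u ψ τ) := by
  rw [potVec_eq (ha.memLp τ hτ), ← hForm_eq_inner, hu.coe_orbit hψ hτ]
  exact (hu.hasDerivAt_orbit hψ hτ).1.2 χ χ.2

theorem IsPropagator.isFormSolution (hu : IsPropagator a u) (ha : IsDominatedPotential a A)
    (hψ : ψ ∈ domH0) {α β : ℝ} (hs : Icc α β ⊆ timeInt) :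
    IsFormSolution (potVec a) (fun τ => 2 * A τ) (-1) (orbit u ψ) (hamOrbit u ψ) (Icc α β) where
  mono t ht t' ht' htt := by linarith [ha.mono t (hs ht) t' (hs ht') htt]
  lip := by
    obtain ⟨L, hL⟩ := ha.lip α β hs
    exact ⟨2 * L, fun t ht t' ht' htt => by linarith [hL t ht t' ht' htt]⟩
  vary t ht t' ht' htt χ := by
    rw [potVec_eq (ha.memLp t (hs ht)), potVec_eq (ha.memLp t' (hs ht')), ← mul_sub]
    exact norm_formVec_sub_le _ _ (sub_nonneg.2 (ha.mono t (hs ht) t' (hs ht') htt))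
      (ha.norm_sub_le t (hs ht) t' (hs ht') htt) χ
  weak t ht χ := hu.weak ha hψ (hs ht) χ
  cont := (hu.continuousOn_hamOrbit hψ).mono hs
  deriv t ht := by
    have h1 := (hu.hasDerivAt_orbit hψ (hs ht)).2
    have e : (((-1 : ℝ) : ℂ) * Complex.I) = -Complex.I := by simp
    rw [e]
    refine h1.congr_of_eventuallyEq ?_
    filter_upwards [isOpen_timeInt.mem_nhds (hs ht)] with x hx
    exact hu.coe_orbit hψ hx

/-- The abstract estimate forwards and backwards from time 0, with the constant c = ‖ψ‖ supplied by
unitarity. -/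
theorem IsPropagator.norm_potVec_le (hu : IsPropagator a u) (ha : IsDominatedPotential a A)
    (hψ : ψ ∈ domH0) (hτ : τ ∈ timeInt) :
    ‖potVec a τ (orbit u ψ τ)‖
      ≤ ‖potVec a 0 (orbit u ψ 0)‖ + 2 * ‖ψ‖ * |A τ - A 0| := by
  have hc : ∀ t ∈ timeInt, ‖(orbit u ψ t : Hs)‖ ≤ ‖ψ‖ := fun t ht => by
    rw [hu.coe_orbit hψ ht, LinearIsometryEquiv.norm_map]
  rcases le_total 0 τ with h | h
  · have hs := Icc_subset_timeInt zero_mem_timeInt hτ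
    have h1 := (hu.isFormSolution ha hψ hs).norm_le (fun t ht => hc t (hs ht)) ⟨h, le_rfl⟩
    rw [abs_of_nonneg (sub_nonneg.2 (ha.mono 0 zero_mem_timeInt τ hτ h))]
    linarith
  · have hs := Icc_subset_timeInt hτ zero_mem_timeInt
    have h1 := (hu.isFormSolution ha hψ hs).norm_le' (fun t ht => hc t (hs ht)) ⟨le_rfl, h⟩
    rw [abs_of_nonpos (sub_nonpos.2 (ha.mono τ hτ 0 zero_mem_timeInt h))]
    linarith

/-- The `*`-representation `f ↦ f(x̃(τ))`. -/
def heisHom (u : ℝ → ℝ → Hs ≃ₗᵢ[ℂ] Hs) (τ : ℝ) : (E3 →ᵇ ℂ) →⋆ₐ[ℂ] (Hs →L[ℂ] Hs) :=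
  ((u τ 0).symm.conjStarAlgEquiv : (Hs →L[ℂ] Hs) →⋆ₐ[ℂ] (Hs →L[ℂ] Hs)).comp mulHom

theorem heisHom_apply (u : ℝ → ℝ → Hs ≃ₗᵢ[ℂ] Hs) (τ : ℝ) (f : E3 →ᵇ ℂ) (ψ : Hs) :
    heisHom u τ f ψ = (u τ 0).symm (mulOp f (u τ 0 ψ)) := rfl

theorem norm_heisHom_le (u : ℝ → ℝ → Hs ≃ₗᵢ[ℂ] Hs) (τ : ℝ) (f : E3 →ᵇ ℂ) (ψ : Hs) :
    ‖heisHom u τ f ψ‖ ≤ ‖f‖ * ‖ψ‖ := by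
  rw [heisHom_apply, LinearIsometryEquiv.norm_map]
  exact (norm_mulOp_le _ _).trans_eq (by rw [LinearIsometryEquiv.norm_map])

theorem inner_heisHom (u : ℝ → ℝ → Hs ≃ₗᵢ[ℂ] Hs) (τ : ℝ) (f : E3 →ᵇ ℂ) (φ ψ : Hs) :
    (inner ℂ φ (heisHom u τ f ψ) : ℂ) = inner ℂ (u τ 0 φ) (mulOp f (u τ 0 ψ)) := by
  rw [heisHom_apply, ← LinearIsometryEquiv.inner_map_map (u τ 0),
    LinearIsometryEquiv.apply_symm_apply]

/-- `heisHom` uses the inverse of u(τ,0) so as to be a *-representation for every real τ; inside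
`timeInt` this inverse is u(0,τ). -/
theorem IsPropagator.heisenberg_eq (hu : IsPropagator a u) (hτ : τ ∈ timeInt) (f : E3 →ᵇ ℂ)
    (ψ : Hs) : heisenberg u f τ ψ = heisHom u τ f ψ := by
  rw [heisHom_apply, heisenberg, LinearIsometryEquiv.eq_symm_apply,
    hu.comp τ hτ 0 zero_mem_timeInt τ hτ, hu.refl τ hτ]

variable {f : E3 →ᵇ ℂ} {f₁ f₂ : Fin 3 → (E3 →ᵇ ℂ)}

/-- Both orbits satisfy the weak equation, and the products with f and f̄ serve as its test vectors,
so membership in the form domain is all that is required of them. -/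
theorem IsPropagator.hasDerivAt_inner (hu : IsPropagator a u) (ha : IsDominatedPotential a A)
    (hf : SmoothMultiplier f f₁ f₂) (hφ : φ ∈ domH0) (hψ : ψ ∈ domH0) (hτ : τ ∈ timeInt) :
    HasDerivAt (fun t => (inner ℂ (u t 0 φ) (mulOp f (u t 0 ψ)) : ℂ))
      (Complex.I / 2 * (inner ℂ (potVec a τ (orbit u φ τ)) (potVec a τ (hf.mul (orbit u ψ τ)))
        - inner ℂ (potVec a τ (hf.star.mul (orbit u φ τ))) (potVec a τ (orbit u ψ τ)))) τ := by
  have h1 := (hu.hasDerivAt_orbit hφ hτ).2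
  have h2 := ((mulCLM f).restrictScalars ℝ).hasFDerivAt.comp_hasDerivAt τ
    (hu.hasDerivAt_orbit hψ hτ).2
  have h3 := HasDerivAt.inner ℂ h1 h2
  have w1 := hu.weak ha hφ hτ (hf.mul (orbit u ψ τ))
  have w2 := hu.weak ha hψ hτ (hf.star.mul (orbit u φ τ))
  have w3 := congrArg (starRingEnd ℂ) w1
  rw [map_mul, inner_conj_symm, inner_conj_symm] at w3
  have c1 : (hf.mul (orbit u ψ τ) : Hs) = mulOp f (u τ 0 ψ) := by
    rw [← hu.coe_orbit hψ hτ]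
    rfl
  have c2 : (hf.star.mul (orbit u φ τ) : Hs) = mulOp (star f) (u τ 0 φ) := by
    rw [← hu.coe_orbit hφ hτ]
    rfl
  rw [c1] at w3
  rw [c2, inner_mulOp_left, star_star] at w2
  refine h3.congr_deriv ?_
  simp only [ContinuousLinearMap.coe_restrictScalars', Function.comp_apply, mulCLM_apply,
    map_smul, inner_smul_left, inner_smul_right, map_neg, Complex.conj_I, neg_neg]
  rw [← w2, ← w3]
  simp only [map_div₀, map_one, map_ofNat]
  ring

theorem IsPropagator.norm_deriv_inner_le (hu : IsPropagator a u)
    (ha : IsDominatedPotential a A)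
    (hf : SmoothMultiplier f f₁ f₂) (hφ : φ ∈ domH0) (hψ : ψ ∈ domH0) (hτ : τ ∈ timeInt) :
    ‖Complex.I / 2 * (inner ℂ (potVec a τ (orbit u φ τ)) (potVec a τ (hf.mul (orbit u ψ τ)))
        - inner ℂ (potVec a τ (hf.star.mul (orbit u φ τ))) (potVec a τ (orbit u ψ τ)))‖
      ≤ ‖φ‖ * (∑ j, ‖f₁ j‖ + ∑ j, ‖f₂ j‖)
        * (‖potVec a 0 (orbit u ψ 0)‖ + 2 * ‖ψ‖ * |A τ - A 0| + ‖ψ‖) := by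
  have h0 := hu.norm_potVec_le ha hψ hτ
  have h1 := hf.norm_inner_formVec_le (ha.memLp τ hτ) (orbit u φ τ) (orbit u ψ τ)
  rw [← potVec_eq (ha.memLp τ hτ), hu.coe_orbit hφ hτ, hu.coe_orbit hψ hτ,
    LinearIsometryEquiv.norm_map, LinearIsometryEquiv.norm_map] at h1
  rw [norm_mul]
  have h2 : ‖Complex.I / 2‖ = 1 / 2 := by simp
  rw [h2]
  have hS1 : 0 ≤ ∑ j, ‖f₁ j‖ := Finset.sum_nonneg fun j _ => norm_nonneg _
  have hS2 : 0 ≤ ∑ j, ‖f₂ j‖ := Finset.sum_nonneg fun j _ => norm_nonneg _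
  set S₁ := ∑ j, ‖f₁ j‖
  set S₂ := ∑ j, ‖f₂ j‖
  set v := ‖potVec a τ (orbit u ψ τ)‖
  set B := ‖potVec a 0 (orbit u ψ 0)‖ + 2 * ‖ψ‖ * |A τ - A 0|
  have hv : 0 ≤ v := norm_nonneg _
  have hψ0 := norm_nonneg ψ
  calc _ ≤ 1 / 2 * (‖φ‖ * (2 * S₁ * v + S₂ * ‖ψ‖)) := by gcongr
    _ ≤ ‖φ‖ * ((S₁ + S₂) * (v + ‖ψ‖)) := by
      rw [mul_left_comm]
      refine mul_le_mul_of_nonneg_left ?_ (norm_nonneg _)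
      nlinarith [mul_nonneg hS1 hψ0, mul_nonneg hS2 hv, mul_nonneg hS2 hψ0]
    _ ≤ ‖φ‖ * ((S₁ + S₂) * (B + ‖ψ‖)) := by gcongr
    _ = _ := by ring

/-- The modulus of continuity in time of smooth functions of the position. -/
theorem IsPropagator.exists_modulus (hu : IsPropagator a u) (ha : IsDominatedPotential a A)
    (hψ : ψ ∈ domH0) : ∃ K : ℝ → ℝ, Continuous K ∧
      ∀ (f : E3 →ᵇ ℂ) (f₁ f₂ : Fin 3 → (E3 →ᵇ ℂ)), SmoothMultiplier f f₁ f₂ →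
      ∀ σ ∈ timeInt, ∀ τ ∈ timeInt, σ ≤ τ →
        ‖heisHom u τ f ψ - heisHom u σ f ψ‖ ≤ (∑ j, ‖f₁ j‖ + ∑ j, ‖f₂ j‖) * (K τ - K σ) := by
  set k : ℝ → ℝ := fun t => ‖potVec a 0 (orbit u ψ 0)‖ + 2 * ‖ψ‖ * |A t - A 0| + ‖ψ‖
  have hk0 : ∀ t, 0 ≤ k t := fun t => by positivity
  have hvol : volume timeInt < ⊤ := by simp [timeInt]
  have hki : IntegrableOn k timeInt :=
    ((integrableOn_const (by exact hvol.ne)).add (ha.integrableOn.const_mul _)).add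
      (integrableOn_const (by exact hvol.ne))
  have hki' : Integrable (timeInt.indicator k) :=
    hki.integrable_indicator isOpen_timeInt.measurableSet
  have hkc : ContinuousOn k timeInt := by
    have := continuousOn_timeInt ha.mono ha.lip
    fun_prop
  -- The primitive of the derivative bound. Since k is integrable on all of `timeInt`, K is
  -- continuous on ℝ, in particular at ±π/2; this is where the decay of the field acts. K depends on
  -- ψ but not on f.
  set K : ℝ → ℝ := fun t => ∫ ρ in (0 : ℝ)..t, timeInt.indicator k ρ
  have hKd : ∀ t ∈ timeInt, HasDerivAt K (k t) t := by
    intro t ht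
    have h1 : ContinuousAt (timeInt.indicator k) t := by
      refine (hkc.continuousAt (isOpen_timeInt.mem_nhds ht)).congr ?_
      filter_upwards [isOpen_timeInt.mem_nhds ht] with x hx
      rw [indicator_of_mem hx]
    have h2 := intervalIntegral.integral_hasDerivAt_right (a := 0) (b := t)
      hki'.intervalIntegrable hki'.1.stronglyMeasurableAtFilter h1
    rwa [indicator_of_mem ht] at h2
  refine ⟨K, intervalIntegral.continuous_primitive (fun _ _ => hki'.intervalIntegrable) 0,
    fun f f₁ f₂ hf σ hσ τ hτ hστ => ?_⟩
  have hS : 0 ≤ ∑ j, ‖f₁ j‖ + ∑ j, ‖f₂ j‖ := by positivity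
  have hs := Icc_subset_timeInt hσ hτ
  have hest : ∀ φ ∈ domH0, ∀ t ∈ Icc σ τ,
      ‖(inner ℂ (u t 0 φ) (mulOp f (u t 0 ψ)) : ℂ) - inner ℂ (u σ 0 φ) (mulOp f (u σ 0 ψ))‖
        ≤ ‖φ‖ * (∑ j, ‖f₁ j‖ + ∑ j, ‖f₂ j‖) * (K t - K σ) := by
    intro φ hφ t ht
    refine image_norm_le_of_norm_deriv_right_le_deriv_boundary'
      (f := fun t => (inner ℂ (u t 0 φ) (mulOp f (u t 0 ψ)) : ℂ)
        - inner ℂ (u σ 0 φ) (mulOp f (u σ 0 ψ)))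
      (B := fun t => ‖φ‖ * (∑ j, ‖f₁ j‖ + ∑ j, ‖f₂ j‖) * (K t - K σ))
      (B' := fun t => ‖φ‖ * (∑ j, ‖f₁ j‖ + ∑ j, ‖f₂ j‖) * k t)
      (fun x hx => ((hu.hasDerivAt_inner ha hf hφ hψ (hs hx)).sub_const
        _).continuousAt.continuousWithinAt)
      (fun x hx => ((hu.hasDerivAt_inner ha hf hφ hψ
        (hs (Ico_subset_Icc_self hx))).sub_const _).hasDerivWithinAt) (by simp)
      (fun x hx => (((hKd x (hs hx)).sub_const _).const_mul _).continuousAt.continuousWithinAt)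
      (fun x hx => (((hKd x (hs (Ico_subset_Icc_self hx))).sub_const _).const_mul
        _).hasDerivWithinAt)
      (fun x hx => hu.norm_deriv_inner_le ha hf hφ hψ (hs (Ico_subset_Icc_self hx))) ht
  have hKm : 0 ≤ K τ - K σ := by
    have hKmono : MonotoneOn K (Icc σ τ) := monotoneOn_of_deriv_nonneg (convex_Icc _ _)
      (fun x hx => (hKd x (hs hx)).continuousAt.continuousWithinAt)
      (fun x hx => (hKd x (hs (interior_subset hx))).differentiableAt.differentiableWithinAt)
      (fun x hx => by
        rw [(hKd x (hs (interior_subset hx))).deriv]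
        exact hk0 x)
    exact sub_nonneg.2 (hKmono (left_mem_Icc.2 hστ) (right_mem_Icc.2 hστ) hστ)
  -- The vector φ had to lie in the domain for differentiation, but the bound involves ‖φ‖ only, so
  -- duality gives the norm.
  refine norm_le_of_dense_inner dense_domH0 (mul_nonneg hS hKm) fun φ hφ => ?_
  rw [inner_sub_right, inner_heisHom, inner_heisHom]
  refine (hest φ hφ τ ⟨hστ, le_rfl⟩).trans_eq ?_
  ring

end DominatedPotential

open scoped CompactlySupported

/-! ### Smooth cutoff functions at growing scale -/

section Cutoff

theorem exists_smoothMultiplier {g : E3 → ℂ} (hg : ContDiff ℝ ∞ g) (hc : HasCompactSupport g) :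
    ∃ (f : E3 →ᵇ ℂ) (f₁ f₂ : Fin 3 → (E3 →ᵇ ℂ)), ⇑f = g ∧ SmoothMultiplier f f₁ f₂ := by
  have hbc : ∀ {w : E3 → ℂ}, ContDiff ℝ ∞ w → HasCompactSupport w → ∃ f : E3 →ᵇ ℂ, ⇑f = w := by
    intro w hw hwc
    obtain ⟨C, hC⟩ := hwc.exists_bound_of_continuous hw.continuous
    exact ⟨BoundedContinuousFunction.ofNormedAddCommGroup w hw.continuous C hC, rfl⟩
  have hd := fun j : Fin 3 => contDiff_fderiv_const hg (EuclideanSpace.single j 1)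
  have hcd := fun j : Fin 3 => hasCompactSupport_fderiv_apply hc (EuclideanSpace.single j 1)
  obtain ⟨f, hf⟩ := hbc hg hc
  choose f₁ hf₁ using fun j => hbc (hd j) (hcd j)
  choose f₂ hf₂ using fun j => hbc (contDiff_fderiv_const (hd j) (EuclideanSpace.single j 1))
    (hasCompactSupport_fderiv_apply (hcd j) (EuclideanSpace.single j 1))
  refine ⟨f, f₁, f₂, hf, ?_, fun j x => ?_, fun j x => ?_⟩
  · rwa [hf]
  · rw [hf, hf₁]
  · rw [hf₁, hf₂]

/-- The dilated function `x ↦ f (c x)`. -/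
def dilate (c : ℝ) (f : E3 →ᵇ ℂ) : E3 →ᵇ ℂ :=
  f.compContinuous ⟨fun x => c • x, continuous_const_smul c⟩

theorem dilate_apply (c : ℝ) (f : E3 →ᵇ ℂ) (x : E3) : dilate c f x = f (c • x) := rfl

theorem norm_dilate_le (c : ℝ) (f : E3 →ᵇ ℂ) : ‖dilate c f‖ ≤ ‖f‖ := f.norm_compContinuous_le _

theorem fderiv_dilate (c : ℝ) (f : E3 →ᵇ ℂ) (x : E3) :
    fderiv ℝ (dilate c f) x = c • fderiv ℝ f (c • x) :=
  fderiv_comp_smul c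

theorem SmoothMultiplier.dilate {f : E3 →ᵇ ℂ} {f₁ f₂ : Fin 3 → (E3 →ᵇ ℂ)}
    (h : SmoothMultiplier f f₁ f₂) (c : ℝ) :
    SmoothMultiplier (dilate c f) (fun j => (c : ℂ) • dilate c (f₁ j))
      (fun j => ((c ^ 2 : ℝ) : ℂ) • dilate c (f₂ j)) where
  contDiff := h.contDiff.comp (contDiff_const_smul c)
  fderiv_eq j x := by
    rw [fderiv_dilate, smul_apply, h.fderiv_eq]
    simp [dilate_apply]
  fderiv_eq' j x := by
    have h1 : ⇑((c : ℂ) • OscScatt.dilate c (f₁ j)) = (c : ℂ) • ⇑(OscScatt.dilate c (f₁ j)) := rfl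
    have h2 : DifferentiableAt ℝ (OscScatt.dilate c (f₁ j)) x :=
      ((h.contDiff_one j).comp (contDiff_const_smul c)).differentiable (by simp) x
    rw [h1, fderiv_const_smul h2, fderiv_dilate, smul_apply, smul_apply, h.fderiv_eq']
    simp [dilate_apply]
    ring

/-- A smooth cutoff function at scale one. -/
def unitBump : ContDiffBump (0 : E3) := ⟨1, 2, one_pos, one_lt_two⟩

/-- The smooth cutoff function at scale `n + 1`. -/
def cutoff (n : ℕ) : C_c(E3, ℝ) where
  toFun x := unitBump (((n : ℝ) + 1)⁻¹ • x)
  continuous_toFun := unitBump.continuous.comp (continuous_const_smul _)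
  hasCompactSupport' := unitBump.hasCompactSupport.comp_homeomorph
    (Homeomorph.smulOfNeZero (((n : ℝ) + 1)⁻¹) (by positivity))

theorem cutoff_apply (n : ℕ) (x : E3) : cutoff n x = unitBump (((n : ℝ) + 1)⁻¹ • x) := rfl

theorem cutoff_eq_one {n : ℕ} {x : E3} (h : ‖x‖ ≤ n + 1) : cutoff n x = 1 := by
  rw [cutoff_apply]
  refine unitBump.one_of_mem_closedBall ?_
  rw [mem_closedBall_zero_iff, norm_smul, norm_inv, Real.norm_eq_abs, abs_of_pos (by positivity)]
  change _ ≤ (1 : ℝ)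
  rw [inv_mul_le_iff₀ (by positivity)]
  linarith

theorem norm_cutoff_le (n : ℕ) : ‖ccToBounded (cutoff n)‖ ≤ 1 := by
  refine (BoundedContinuousFunction.norm_le zero_le_one).2 fun x => ?_
  rw [ccToBounded_apply, Complex.norm_real, Real.norm_eq_abs, cutoff_apply,
    abs_of_nonneg unitBump.nonneg]
  exact unitBump.le_one

/-- Dilation by c = 1/(n + 1) multiplies first derivatives by c and second ones by c² ≤ c. -/
theorem exists_smoothMultiplier_cutoff : ∃ C : ℝ, ∀ n : ℕ, ∃ f₁ f₂ : Fin 3 → (E3 →ᵇ ℂ),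
    SmoothMultiplier (ccToBounded (cutoff n)) f₁ f₂ ∧
      ∑ j, ‖f₁ j‖ + ∑ j, ‖f₂ j‖ ≤ C * ((n : ℝ) + 1)⁻¹ := by
  have hg : ContDiff ℝ ∞ fun x => ((unitBump x : ℝ) : ℂ) :=
    Complex.ofRealCLM.contDiff.comp unitBump.contDiff
  have hc : HasCompactSupport fun x => ((unitBump x : ℝ) : ℂ) :=
    unitBump.hasCompactSupport.comp_left Complex.ofReal_zero
  obtain ⟨f, f₁, f₂, hf, h⟩ := exists_smoothMultiplier hg hc
  refine ⟨∑ j, ‖f₁ j‖ + ∑ j, ‖f₂ j‖, fun n => ?_⟩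
  set c : ℝ := ((n : ℝ) + 1)⁻¹
  have hc0 : 0 ≤ c := by positivity
  have hc1 : c ≤ 1 := inv_le_one_of_one_le₀ (by simp)
  have e : ccToBounded (cutoff n) = dilate c f := by
    ext x
    rw [dilate_apply, hf]
    rfl
  refine ⟨_, _, e ▸ h.dilate c, ?_⟩
  rw [add_mul, Finset.sum_mul, Finset.sum_mul]
  refine add_le_add (Finset.sum_le_sum fun j _ => ?_) (Finset.sum_le_sum fun j _ => ?_)
  · rw [norm_smul, Complex.norm_real, Real.norm_eq_abs, abs_of_nonneg hc0, mul_comm]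
    exact mul_le_mul_of_nonneg_right (norm_dilate_le _ _) hc0
  · rw [norm_smul, Complex.norm_real, Real.norm_eq_abs, abs_of_nonneg (by positivity), mul_comm]
    exact mul_le_mul (norm_dilate_le _ _) (by nlinarith) (by positivity) (norm_nonneg _)

theorem tendsto_apply_of_dense {H : Type*} [NormedAddCommGroup H] [NormedSpace ℂ H]
    {T : ℕ → H →L[ℂ] H} (hT : ∀ n ψ, ‖T n ψ‖ ≤ ‖ψ‖) {S : Set H} (hS : Dense S)
    (h : ∀ ψ ∈ S, Tendsto (fun n => T n ψ) atTop (𝓝 ψ)) (ψ : H) :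
    Tendsto (fun n => T n ψ) atTop (𝓝 ψ) := by
  rw [Metric.tendsto_atTop]
  intro ε hε
  obtain ⟨χ, hχ, hd⟩ := Metric.dense_iff.1 hS ψ (ε / 3) (by positivity)
  rw [Metric.mem_ball, dist_eq_norm] at hχ
  obtain ⟨N, hN⟩ := Metric.tendsto_atTop.1 (h χ hd) (ε / 3) (by positivity)
  refine ⟨N, fun n hn => ?_⟩
  have h1 := hN n hn
  rw [dist_eq_norm] at h1 ⊢
  have h2 : T n ψ - ψ = -T n (χ - ψ) + (T n χ - χ) + (χ - ψ) := by
    rw [map_sub]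
    abel
  rw [h2]
  have h3 := norm_add₃_le (a := -T n (χ - ψ)) (b := T n χ - χ) (c := χ - ψ)
  have h4 := hT n (χ - ψ)
  rw [norm_neg] at h3
  linarith

theorem tendsto_mulOp_cutoff (ψ : Hs) :
    Tendsto (fun n => mulOp (ccToBounded (cutoff n)) ψ) atTop (𝓝 ψ) := by
  refine tendsto_apply_of_dense (T := fun n => mulCLM (ccToBounded (cutoff n)))
    (fun n φ => (norm_mulOp_le _ _).trans
      (mul_le_of_le_one_left (norm_nonneg _) (norm_cutoff_le n)))
    (Lp.dense_hasCompactSupport_contDiff (F := ℂ) (μ := (volume : Measure E3)) (p := 2)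
      (by simp)) ?_ ψ
  rintro φ ⟨g, hφ, hc, -⟩
  obtain ⟨R, hR⟩ := hc.isBounded.subset_closedBall 0
  obtain ⟨N, hN⟩ := exists_nat_ge R
  refine tendsto_const_nhds.congr' ?_
  filter_upwards [eventually_ge_atTop N] with n hn
  ext1
  filter_upwards [coeFn_mulOp (ccToBounded (cutoff n)) φ, hφ] with x h1 h2
  rw [mulCLM_apply, h1, ccToBounded_apply]
  by_cases hx : x ∈ tsupport g
  · have h3 : ‖x‖ ≤ R := mem_closedBall_zero_iff.1 (hR hx)
    have h4 : (N : ℝ) ≤ n := Nat.cast_le.2 hn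
    rw [cutoff_eq_one (by linarith)]
    simp
  · rw [h2, image_eq_zero_of_notMem_tsupport hx, mul_zero]

end Cutoff

/-! ### Existence of the strong limits -/

section Limit

variable {a : ℝ → E3 → E3} {A : ℝ → ℝ} {u : ℝ → ℝ → Hs ≃ₗᵢ[ℂ] Hs} {l : Filter ℝ} {c : ℝ}

theorem IsPropagator.exists_modulus' (hu : IsPropagator a u) (ha : IsDominatedPotential a A)
    {ψ : Hs} (hψ : ψ ∈ domH0) : ∃ K : ℝ → ℝ, Continuous K ∧
      ∀ (f : E3 →ᵇ ℂ) (f₁ f₂ : Fin 3 → (E3 →ᵇ ℂ)), SmoothMultiplier f f₁ f₂ →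
      ∀ σ ∈ timeInt, ∀ τ ∈ timeInt,
        ‖heisHom u τ f ψ - heisHom u σ f ψ‖ ≤ (∑ j, ‖f₁ j‖ + ∑ j, ‖f₂ j‖) * |K τ - K σ| := by
  obtain ⟨K, hK, h⟩ := hu.exists_modulus ha hψ
  refine ⟨K, hK, fun f f₁ f₂ hf σ hσ τ hτ => ?_⟩
  have hS : 0 ≤ ∑ j, ‖f₁ j‖ + ∑ j, ‖f₂ j‖ := by positivity
  rcases le_total σ τ with hle | hle
  · exact (h f f₁ f₂ hf σ hσ τ hτ hle).trans (mul_le_mul_of_nonneg_left (le_abs_self _) hS)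
  · rw [norm_sub_rev, abs_sub_comm]
    exact (h f f₁ f₂ hf τ hτ σ hσ hle).trans (mul_le_mul_of_nonneg_left (le_abs_self _) hS)

/-- The modulus K is continuous at the endpoint c, so the values at any two times near c are close.
-/
theorem IsPropagator.tendsto_of_smooth (hu : IsPropagator a u) (ha : IsDominatedPotential a A)
    [l.NeBot] (hl : timeInt ∈ l) (hc : l ≤ 𝓝 c) {f : E3 →ᵇ ℂ} {f₁ f₂ : Fin 3 → (E3 →ᵇ ℂ)}
    (hf : SmoothMultiplier f f₁ f₂) {ψ : Hs} (hψ : ψ ∈ domH0) :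
    ∃ v, Tendsto (fun t => heisHom u t f ψ) l (𝓝 v) := by
  obtain ⟨K, hK, h⟩ := hu.exists_modulus' ha hψ
  refine cauchy_map_iff_exists_tendsto.1 (Metric.cauchy_iff.2 ⟨inferInstance, fun ε hε => ?_⟩)
  set S := ∑ j, ‖f₁ j‖ + ∑ j, ‖f₂ j‖
  have hS : 0 ≤ S := by positivity
  set δ := ε / (2 * (S + 1))
  have hδ : 0 < δ := by positivity
  have h1 : ∀ᶠ t in l, |K t - K c| < δ := by
    have := Metric.tendsto_nhds.1 ((hK.tendsto c).mono_left hc) δ hδ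
    simpa only [Real.dist_eq] using this
  refine ⟨_, image_mem_map (inter_mem hl h1), ?_⟩
  rintro _ ⟨t, ⟨ht, ht'⟩, rfl⟩ _ ⟨s, ⟨hs, hs'⟩, rfl⟩
  have h3 : |K t - K c| < δ := ht'
  have h4 : |K s - K c| < δ := hs'
  rw [dist_eq_norm]
  have h5 : |K t - K s| ≤ 2 * δ := by
    have := abs_sub_le (K t) (K c) (K s)
    rw [abs_sub_comm (K c)] at this
    linarith
  refine (h f f₁ f₂ hf s hs t ht).trans_lt ?_
  calc S * |K t - K s| ≤ S * (2 * δ) := mul_le_mul_of_nonneg_left h5 hS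
    _ < (S + 1) * (2 * δ) := by nlinarith
    _ = ε := by
      simp only [δ]
      field_simp

/-- Tightness. At time 0 the cutoffs tend to the identity. Their derivatives are O(1/n) and K is
bounded on the closed interval, so the deviation from time 0 is O(1/n) at all times at once. This
uniformity survives the limit in τ. -/
theorem IsPropagator.eventually_norm_cutoff_sub_le (hu : IsPropagator a u)
    (ha : IsDominatedPotential a A) {ψ : Hs} (hψ : ψ ∈ domH0) {ε : ℝ} (hε : 0 < ε) :
    ∀ᶠ n in atTop, ∀ τ ∈ timeInt, ‖heisHom u τ (ccToBounded (cutoff n)) ψ - ψ‖ ≤ ε := by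
  obtain ⟨K, hK, h⟩ := hu.exists_modulus' ha hψ
  obtain ⟨C, hC⟩ := exists_smoothMultiplier_cutoff
  obtain ⟨M, hM⟩ :=
    (isCompact_Icc (a := -(Real.pi / 2)) (b := Real.pi / 2)).exists_bound_of_continuousOn
    (f := fun t => K t - K 0) (by fun_prop)
  have h0 : ∀ n, heisHom u 0 (ccToBounded (cutoff n)) ψ = mulOp (ccToBounded (cutoff n)) ψ := by
    intro n
    have e := hu.refl 0 zero_mem_timeInt
    rw [← hu.heisenberg_eq zero_mem_timeInt, heisenberg, e, e]
  have h1 : Tendsto (fun n : ℕ => C * ((n : ℝ) + 1)⁻¹ * M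
      + ‖mulOp (ccToBounded (cutoff n)) ψ - ψ‖) atTop (𝓝 0) := by
    have t1 : Tendsto (fun n : ℕ => ((n : ℝ) + 1)⁻¹) atTop (𝓝 0) := by
      simpa using tendsto_one_div_add_atTop_nhds_zero_nat (𝕜 := ℝ)
    have t2 := (tendsto_mulOp_cutoff ψ).sub_const ψ
    rw [sub_self] at t2
    simpa using ((t1.const_mul C).mul_const M).add t2.norm
  filter_upwards [h1.eventually_le_const hε] with n hn τ hτ
  obtain ⟨f₁, f₂, hf, hb⟩ := hC n
  have h2 := h _ f₁ f₂ hf 0 zero_mem_timeInt τ hτ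
  rw [h0] at h2
  have h3 := hM τ ⟨hτ.1.le, hτ.2.le⟩
  rw [Real.norm_eq_abs] at h3
  have hS : 0 ≤ ∑ j, ‖f₁ j‖ + ∑ j, ‖f₂ j‖ := by positivity
  have h4 := h2.trans (mul_le_mul hb h3 (abs_nonneg _) (hS.trans hb))
  have h5 := norm_sub_le_norm_sub_add_norm_sub (heisHom u τ (ccToBounded (cutoff n)) ψ)
    (mulOp (ccToBounded (cutoff n)) ψ) ψ
  linarith

/-- Three approximations, each uniform in time: smooth functions for compactly supported f, cutoffs
and tightness for bounded f, density of `domH0` for general vectors. -/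
theorem IsPropagator.exists_tendsto_heisHom (hu : IsPropagator a u)
    (ha : IsDominatedPotential a A) [l.NeBot] (hl : timeInt ∈ l) (hc : l ≤ 𝓝 c)
    (f : E3 →ᵇ ℂ) (ψ : Hs) : ∃ v, Tendsto (fun t => heisHom u t f ψ) l (𝓝 v) := by
  have hcomp : ∀ f : E3 →ᵇ ℂ, HasCompactSupport f → ∀ ψ ∈ domH0,
      ∃ v, Tendsto (fun t => heisHom u t f ψ) l (𝓝 v) := by
    intro f hfc ψ hψ
    refine exists_tendsto_of_approx fun ε hε => ?_
    set δ := ε / (‖ψ‖ + 1)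
    have hδ : 0 < δ := by positivity
    obtain ⟨g, hg, hfg, hgs⟩ := f.continuous.exists_contDiff_approx ⊤ (ε := fun _ => δ)
      (by fun_prop) (fun _ => hδ)
    have hgc : HasCompactSupport g := hfc.mono hgs
    obtain ⟨f', f₁, f₂, hf', hs⟩ := exists_smoothMultiplier hg hgc
    refine ⟨fun t => heisHom u t f' ψ, hu.tendsto_of_smooth ha hl hc hs hψ,
      Eventually.of_forall fun t => ?_⟩
    have h1 : ‖f - f'‖ ≤ δ := by
      refine (BoundedContinuousFunction.norm_le hδ.le).2 fun x => ?_
      rw [BoundedContinuousFunction.coe_sub, Pi.sub_apply, hf', norm_sub_rev, ← dist_eq_norm]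
      exact (hfg x).le
    have h2 := norm_heisHom_le u t (f - f') ψ
    rw [map_sub, sub_apply] at h2
    refine h2.trans ?_
    calc ‖f - f'‖ * ‖ψ‖ ≤ δ * (‖ψ‖ + 1) := by gcongr; linarith
      _ = ε := by
        simp only [δ]
        field_simp
  have hdom : ∀ ψ ∈ domH0, ∃ v, Tendsto (fun t => heisHom u t f ψ) l (𝓝 v) := by
    intro ψ hψ
    refine exists_tendsto_of_approx fun ε hε => ?_
    set δ := ε / (‖f‖ + 1)
    have hδ : 0 < δ := by positivity
    obtain ⟨n, hn⟩ := (hu.eventually_norm_cutoff_sub_le ha hψ hδ).exists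
    have hfc : HasCompactSupport (f * ccToBounded (cutoff n) : E3 →ᵇ ℂ) := by
      rw [BoundedContinuousFunction.coe_mul]
      exact ((cutoff n).hasCompactSupport.comp_left Complex.ofReal_zero).mul_left
    refine ⟨_, hcomp _ hfc ψ hψ, ?_⟩
    filter_upwards [hl] with t ht
    rw [map_mul, mul_apply_eq_comp, ← map_sub]
    refine (norm_heisHom_le _ _ _ _).trans ?_
    rw [norm_sub_rev]
    calc ‖f‖ * _ ≤ (‖f‖ + 1) * δ :=
        mul_le_mul (by linarith) (hn t ht) (norm_nonneg _) (by positivity)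
      _ = ε := by
        simp only [δ]
        field_simp
  refine exists_tendsto_of_approx fun ε hε => ?_
  set δ := ε / (‖f‖ + 1)
  have hδ : 0 < δ := by positivity
  obtain ⟨χ, hχ, hd⟩ := Metric.dense_iff.1 dense_domH0 ψ δ hδ
  rw [Metric.mem_ball, dist_eq_norm, norm_sub_rev] at hχ
  refine ⟨_, hdom χ hd, Eventually.of_forall fun t => ?_⟩
  rw [← map_sub]
  refine (norm_heisHom_le _ _ _ _).trans ?_
  calc ‖f‖ * _ ≤ (‖f‖ + 1) * δ :=
      mul_le_mul (by linarith) hχ.le (norm_nonneg _) (by positivity)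
    _ = ε := by
      simp only [δ]
      field_simp

/-- The bounded continuous functions of the position converge strongly to a representation that is
given by spectral measures. -/
theorem IsPropagator.exists_limit (hu : IsPropagator a u)
    (ha : IsDominatedPotential a A) [l.NeBot] (hl : timeInt ∈ l) (hc : l ≤ 𝓝 c) :
    ∃ (Φ : (E3 →ᵇ ℂ) →⋆ₐ[ℂ] (Hs →L[ℂ] Hs)) (μ : Hs → Measure E3),
      (∀ ψ, IsFiniteMeasure (μ ψ)) ∧ IsSpectralFamily Φ μ ∧
      ∀ f ψ, Tendsto (fun t => heisenberg u f t ψ) l (𝓝 (Φ f ψ)) := by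
  obtain ⟨Φ, hΦ⟩ := exists_strong_limit (l := l) (heisHom u) (norm_heisHom_le u)
    (hu.exists_tendsto_heisHom ha hl hc)
  have hcontr : ∀ n ψ, ‖Φ (ccToBounded (cutoff n)) ψ‖ ≤ ‖ψ‖ := fun n ψ =>
    le_of_tendsto (hΦ _ ψ).norm (Eventually.of_forall fun t => (norm_heisHom_le _ _ _ _).trans
      (mul_le_of_le_one_left (norm_nonneg _) (norm_cutoff_le n)))
  have hex : IsExhausting Φ cutoff := by
    refine ⟨fun n x => unitBump.nonneg, fun n x => unitBump.le_one, fun x => ?_,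
      fun ψ => tendsto_apply_of_dense hcontr dense_domH0 (fun φ hφ => ?_) ψ⟩
    · obtain ⟨N, hN⟩ := exists_nat_ge ‖x‖
      refine tendsto_const_nhds.congr' ?_
      filter_upwards [eventually_ge_atTop N] with n hn
      have h4 : (N : ℝ) ≤ n := Nat.cast_le.2 hn
      rw [cutoff_eq_one (by linarith)]
    · rw [Metric.tendsto_nhds]
      intro ε hε
      filter_upwards [hu.eventually_norm_cutoff_sub_le ha hφ (half_pos hε)] with n hn
      rw [dist_eq_norm]
      refine lt_of_le_of_lt (le_of_tendsto ((hΦ _ φ).sub_const φ).norm ?_) (half_lt_self hε)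
      filter_upwards [hl] with t ht
      exact hn t ht
  obtain ⟨μ, hμ, hs⟩ := exists_isSpectralFamily hex
  refine ⟨Φ, μ, hμ, hs, fun f ψ => (hΦ f ψ).congr' ?_⟩
  filter_upwards [hl] with t ht
  rw [hu.heisenberg_eq ht]

end Limit


/-! ### Essential suprema of the sections of a function of two variables -/

section SectionNorm

variable {α β E : Type*} [MeasurableSpace α] [MeasurableSpace β] [NormedAddCommGroup E]
  {μ : Measure α} {ν : Measure β} [SFinite ν]

/-- The essential supremum is at most c exactly where the section of {c < ‖g‖} is a null set, and
measures of sections depend measurably on the parameter. -/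
theorem measurable_eLpNorm_top {g : α × β → E} (hg : StronglyMeasurable g) :
    Measurable fun ρ => eLpNorm (fun x => g (ρ, x)) ⊤ ν := by
  refine measurable_of_Iic fun c => ?_
  have h1 : MeasurableSet {z | c < ‖g z‖ₑ} := measurableSet_lt measurable_const hg.enorm
  have h2 : (fun ρ => eLpNorm (fun x => g (ρ, x)) ⊤ ν) ⁻¹' Iic c
      = (fun ρ => ν (Prod.mk ρ ⁻¹' {z | c < ‖g z‖ₑ})) ⁻¹' {0} := by
    ext ρ
    simp only [mem_preimage, mem_Iic, mem_singleton_iff, eLpNorm_exponent_top]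
    have h3 : (ν (Prod.mk ρ ⁻¹' {z | c < ‖g z‖ₑ}) = 0) ↔ ∀ᵐ x ∂ν, ‖g (ρ, x)‖ₑ ≤ c := by
      rw [ae_iff]
      simp only [not_le]
      rfl
    rw [h3]
    exact ⟨fun h => (ae_le_eLpNormEssSup (f := fun x => g (ρ, x)) (μ := ν)).mono
      fun x hx => hx.trans h, fun h => essSup_le_of_ae_le c h⟩
  rw [h2]
  exact measurable_measure_prodMk_left h1 (measurableSet_singleton 0)

variable {e : α → β → E}

theorem aemeasurable_eLpNorm_top
    (he : AEStronglyMeasurable (fun z : α × β => e z.1 z.2) (μ.prod ν)) :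
    AEMeasurable (fun ρ => eLpNorm (e ρ) ⊤ ν) μ := by
  refine (measurable_eLpNorm_top (ν := ν) he.stronglyMeasurable_mk).aemeasurable.congr ?_
  filter_upwards [Measure.ae_ae_of_ae_prod he.ae_eq_mk] with ρ hρ
  exact (eLpNorm_congr_ae hρ).symm

theorem ae_eLpNorm_top_le (he : MemLp (fun z : α × β => e z.1 z.2) ⊤ (μ.prod ν)) :
    ∀ᵐ ρ ∂μ, eLpNorm (e ρ) ⊤ ν
      ≤ ENNReal.ofReal (eLpNorm (fun z : α × β => e z.1 z.2) ⊤ (μ.prod ν)).toReal := by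
  filter_upwards [Measure.ae_ae_of_ae_prod (ae_norm_le_of_memLp_top he)] with ρ hρ
  rw [eLpNorm_exponent_top]
  exact eLpNormEssSup_le_of_ae_bound hρ

variable [SFinite μ]

/-- The time integral at fixed x needs the quantifiers in this order. Exchanging them requires a
measurable exceptional set, hence the passage to a strongly measurable representative. -/
theorem ae_ae_norm_le_eLpNorm_top (he : MemLp (fun z : α × β => e z.1 z.2) ⊤ (μ.prod ν)) :
    ∀ᵐ x ∂ν, ∀ᵐ ρ ∂μ, ‖e ρ x‖ ≤ (eLpNorm (e ρ) ⊤ ν).toReal := by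
  set g := he.1.mk
  have hg : StronglyMeasurable g := he.1.stronglyMeasurable_mk
  have heq : ∀ᵐ z ∂μ.prod ν, e z.1 z.2 = g z := he.1.ae_eq_mk
  have h1 : ∀ᵐ x ∂ν, ∀ᵐ ρ ∂μ, ‖g (ρ, x)‖ₑ ≤ eLpNorm (fun x => g (ρ, x)) ⊤ ν := by
    refine (Measure.ae_ae_comm (μ := μ) (ν := ν) (measurableSet_le hg.enorm
      ((measurable_eLpNorm_top hg).comp measurable_fst))).1 (Eventually.of_forall fun ρ => ?_)
    rw [eLpNorm_exponent_top]
    exact ae_le_eLpNormEssSup (f := fun x => g (ρ, x))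
  have h2 : ∀ᵐ x ∂ν, ∀ᵐ ρ ∂μ, e ρ x = g (ρ, x) :=
    Measure.ae_ae_of_ae_prod (p := fun z : β × α => e z.2 z.1 = g (z.2, z.1))
      (Measure.measurePreserving_swap.quasiMeasurePreserving.ae heq)
  have h3 : ∀ᵐ ρ ∂μ, eLpNorm (e ρ) ⊤ ν = eLpNorm (fun x => g (ρ, x)) ⊤ ν := by
    filter_upwards [Measure.ae_ae_of_ae_prod heq] with ρ hρ
    exact eLpNorm_congr_ae hρ
  filter_upwards [h1, h2] with x h1 h2
  filter_upwards [h1, h2, h3, ae_eLpNorm_top_le he] with ρ h1 h2 h3 h4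
  rw [← toReal_enorm, h2]
  refine ENNReal.toReal_mono (h4.trans_lt ENNReal.ofReal_lt_top).ne ?_
  rwa [h3]

end SectionNorm

/-! ### The decay condition dominates the vector potential -/

section FieldNorm

variable {a₀ : E3 → E3} {e : ℝ → E3 → E3} {σ τ : ℝ}

/-- The essential supremum of the field at time `ρ`. -/
def fieldNorm (e : ℝ → E3 → E3) (ρ : ℝ) : ℝ := (eLpNorm (e ρ) ⊤ (volume : Measure E3)).toReal

theorem fieldNorm_nonneg (e : ℝ → E3 → E3) (ρ : ℝ) : 0 ≤ fieldNorm e ρ := ENNReal.toReal_nonneg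

theorem AdmissibleField.aemeasurable_eLpNorm (hae : AdmissibleField a₀ e) :
    AEMeasurable (fun ρ => eLpNorm (e ρ) ⊤ (volume : Measure E3)) (volume.restrict timeInt) := by
  -- Admissibility speaks of compact intervals only, so `timeInt` is exhausted by them.
  set δ : ℕ → ℝ := fun n => Real.pi / 2 * (1 / ((n : ℝ) + 1))
  have hδ : ∀ n, 0 < δ n := fun n => by positivity
  have hU : timeInt = ⋃ n, Icc (-(Real.pi / 2) + δ n) (Real.pi / 2 - δ n) := by
    ext t
    rw [mem_iUnion]
    constructor
    · intro ht
      have h1 : 0 < min (t + Real.pi / 2) (Real.pi / 2 - t) :=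
        lt_min (by linarith [ht.1]) (by linarith [ht.2])
      obtain ⟨n, hn⟩ := exists_nat_one_div_lt (div_pos h1 Real.pi_div_two_pos)
      rw [lt_div_iff₀ Real.pi_div_two_pos, mul_comm] at hn
      have hn' : δ n < min (t + Real.pi / 2) (Real.pi / 2 - t) := hn
      exact ⟨n, by linarith [min_le_left (t + Real.pi / 2) (Real.pi / 2 - t)],
        by linarith [min_le_right (t + Real.pi / 2) (Real.pi / 2 - t)]⟩
    · rintro ⟨n, hn⟩
      exact ⟨by linarith [hn.1, hδ n], by linarith [hn.2, hδ n]⟩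
  rw [hU, aemeasurable_iUnion_iff]
  intro n
  refine aemeasurable_eLpNorm_top (hae.field_bdd _ _ ?_).1
  rw [hU]
  exact subset_iUnion (fun n => Icc (-(Real.pi / 2) + δ n) (Real.pi / 2 - δ n)) n

theorem AdmissibleField.exists_fieldNorm_le (hae : AdmissibleField a₀ e)
    (h : Icc σ τ ⊆ timeInt) : ∃ C, ∀ᵐ ρ ∂volume.restrict (Icc σ τ), fieldNorm e ρ ≤ C := by
  refine ⟨(eLpNorm (fun z : ℝ × E3 => e z.1 z.2) ⊤
    ((volume.restrict (Icc σ τ)).prod (volume : Measure E3))).toReal, ?_⟩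
  filter_upwards [ae_eLpNorm_top_le (hae.field_bdd σ τ h)] with ρ hρ
  exact ENNReal.toReal_le_of_le_ofReal ENNReal.toReal_nonneg hρ

theorem AdmissibleField.integrableOn_fieldNorm (hae : AdmissibleField a₀ e)
    (h : Icc σ τ ⊆ timeInt) : IntegrableOn (fieldNorm e) (Icc σ τ) := by
  obtain ⟨C, hC⟩ := hae.exists_fieldNorm_le h
  have h1 : AEMeasurable (fieldNorm e) (volume.restrict (Icc σ τ)) :=
    (hae.aemeasurable_eLpNorm.mono_measure (Measure.restrict_mono h le_rfl)).ennreal_toReal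
  refine Integrable.of_bound h1.aestronglyMeasurable C ?_
  filter_upwards [hC] with ρ hρ
  rwa [Real.norm_eq_abs, abs_of_nonneg (fieldNorm_nonneg e ρ)]

theorem AdmissibleField.intervalIntegrable_fieldNorm (hae : AdmissibleField a₀ e)
    (hσ : σ ∈ timeInt) (hτ : τ ∈ timeInt) : IntervalIntegrable (fieldNorm e) volume σ τ := by
  rcases le_total σ τ with h | h
  · exact (intervalIntegrable_iff_integrableOn_Icc_of_le h).2
      (hae.integrableOn_fieldNorm (Icc_subset_timeInt hσ hτ))
  · exact ((intervalIntegrable_iff_integrableOn_Icc_of_le h).2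
      (hae.integrableOn_fieldNorm (Icc_subset_timeInt hτ hσ))).symm

theorem AdmissibleField.ae_norm_le (hae : AdmissibleField a₀ e) (hσ : σ ∈ timeInt)
    (hτ : τ ∈ timeInt) (h : σ ≤ τ) : ∀ᵐ x, IntervalIntegrable (fun ρ => e ρ x) volume σ τ ∧
      ‖∫ ρ in σ..τ, e ρ x‖ ≤ ∫ ρ in σ..τ, fieldNorm e ρ := by
  have hs := Icc_subset_timeInt hσ hτ
  have hb := hae.field_bdd σ τ hs
  filter_upwards [ae_ae_norm_le_eLpNorm_top hb, hb.1.prod_swap.prodMk_left] with x h1 h2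
  refine ⟨(intervalIntegrable_iff_integrableOn_Icc_of_le h).2
    ((hae.integrableOn_fieldNorm hs).mono' h2 h1), ?_⟩
  refine intervalIntegral.norm_integral_le_of_norm_le h ?_
    (hae.intervalIntegrable_fieldNorm hσ hτ)
  have h3 := (ae_restrict_iff' measurableSet_Icc).1 h1
  filter_upwards [h3] with ρ hρ hm
  exact hρ (Ioc_subset_Icc_self hm)

theorem AdmissibleField.memLp_integral (hae : AdmissibleField a₀ e) (hσ : σ ∈ timeInt)
    (hτ : τ ∈ timeInt) (h : σ ≤ τ) :
    MemLp (fun x => ∫ ρ in σ..τ, e ρ x) ⊤ (volume : Measure E3) := by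
  refine memLp_top_of_bound ?_ _ ((hae.ae_norm_le hσ hτ h).mono fun x hx => hx.2)
  have h1 := (hae.field_bdd σ τ (Icc_subset_timeInt hσ hτ)).1.prod_swap.integral_prod_right'
  refine h1.congr (Eventually.of_forall fun x => ?_)
  change ∫ ρ in Icc σ τ, e ρ x = ∫ ρ in σ..τ, e ρ x
  rw [intervalIntegral.integral_of_le h, integral_Icc_eq_integral_Ioc]

theorem AdmissibleField.memLp_vecPot (hae : AdmissibleField a₀ e) (hτ : τ ∈ timeInt) :
    MemLp (vecPot a₀ e τ) ⊤ (volume : Measure E3) := by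
  rcases le_total 0 τ with h | h
  · exact hae.pot_bdd.sub (hae.memLp_integral zero_mem_timeInt hτ h)
  · refine (hae.pot_bdd.add (hae.memLp_integral hτ zero_mem_timeInt h)).ae_eq
      (Eventually.of_forall fun x => ?_)
    simp only [vecPot, Pi.add_apply]
    rw [intervalIntegral.integral_symm τ 0, sub_neg_eq_add]

theorem AdmissibleField.ae_norm_vecPot_sub_le (hae : AdmissibleField a₀ e) (hσ : σ ∈ timeInt)
    (hτ : τ ∈ timeInt) (h : σ ≤ τ) :
    ∀ᵐ x, ‖vecPot a₀ e τ x - vecPot a₀ e σ x‖ ≤ ∫ ρ in σ..τ, fieldNorm e ρ := by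
  have h0 : ∀ t ∈ timeInt, ∀ᵐ x, IntervalIntegrable (fun ρ => e ρ x) volume 0 t := by
    intro t ht
    rcases le_total 0 t with h1 | h1
    · exact (hae.ae_norm_le zero_mem_timeInt ht h1).mono fun x hx => hx.1
    · exact (hae.ae_norm_le ht zero_mem_timeInt h1).mono fun x hx => hx.1.symm
  filter_upwards [hae.ae_norm_le hσ hτ h, h0 σ hσ, h0 τ hτ] with x h1 h2 h3
  rw [vecPot, vecPot, sub_sub_sub_cancel_left, norm_sub_rev,
    intervalIntegral.integral_interval_sub_left h3 h2]
  exact h1.2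

/-- Tonelli on the region |ρ| ≤ |τ|. For fixed ρ the admissible τ fill two intervals of length π/2 −
|ρ|; ignoring that ρ and τ have equal signs avoids a case distinction and costs the factor 2. -/
theorem AdmissibleField.lintegral_le (hae : AdmissibleField a₀ e) :
    ∫⁻ τ in timeInt, ‖∫ ρ in (0 : ℝ)..τ, fieldNorm e ρ‖ₑ
      ≤ 2 * ∫⁻ τ in timeInt,
        ENNReal.ofReal (Real.pi / 2 - |τ|) * eLpNorm (e τ) ⊤ (volume : Measure E3) := by
  set n : ℝ → ℝ≥0∞ := fun ρ => eLpNorm (e ρ) ⊤ (volume : Measure E3)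
  set T : Set (ℝ × ℝ) := {z | |z.2| ≤ |z.1|}
  have hT : MeasurableSet T := measurableSet_le (by fun_prop) (by fun_prop)
  have h1 : ∀ τ ∈ timeInt, ‖∫ ρ in (0 : ℝ)..τ, fieldNorm e ρ‖ₑ
      ≤ ∫⁻ ρ in timeInt, T.indicator (fun z => n z.2) (τ, ρ) := by
    intro τ hτ
    have hsub : uIoc 0 τ ⊆ timeInt ∩ {ρ | |ρ| ≤ |τ|} := by
      intro ρ hρ
      have h2 : |ρ| ≤ |τ| := by
        rcases le_total 0 τ with h | h
        · rw [uIoc_of_le h] at hρ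
          rw [abs_of_nonneg hρ.1.le, abs_of_nonneg h]
          exact hρ.2
        · rw [uIoc_of_ge h] at hρ
          rw [abs_of_nonpos hρ.2, abs_of_nonpos h]
          linarith [hρ.1]
      exact ⟨abs_lt.1 (h2.trans_lt (abs_lt.2 hτ)), h2⟩
    have hm : MeasurableSet {ρ : ℝ | |ρ| ≤ |τ|} := measurableSet_le (by fun_prop) (by fun_prop)
    calc ‖∫ ρ in (0 : ℝ)..τ, fieldNorm e ρ‖ₑ = ‖∫ ρ in uIoc 0 τ, fieldNorm e ρ‖ₑ := by
          rw [← ofReal_norm, intervalIntegral.norm_intervalIntegral_eq, ofReal_norm]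
      _ ≤ ∫⁻ ρ in uIoc 0 τ, ‖fieldNorm e ρ‖ₑ := enorm_integral_le_lintegral_enorm _
      _ ≤ ∫⁻ ρ in uIoc 0 τ, n ρ := by
          refine lintegral_mono fun ρ => ?_
          rw [← ofReal_norm, Real.norm_eq_abs, abs_of_nonneg (fieldNorm_nonneg e ρ)]
          exact ENNReal.ofReal_toReal_le
      _ ≤ ∫⁻ ρ in {ρ | |ρ| ≤ |τ|} ∩ timeInt, n ρ :=
          lintegral_mono_set (hsub.trans (inter_comm _ _).subset)
      _ = ∫⁻ ρ in timeInt, T.indicator (fun z => n z.2) (τ, ρ) := by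
          rw [← Measure.restrict_restrict hm, ← lintegral_indicator hm]
          rfl
  have hmeas : AEMeasurable (Function.uncurry fun τ ρ => T.indicator (fun z => n z.2) (τ, ρ))
      ((volume.restrict timeInt).prod (volume.restrict timeInt)) :=
    hae.aemeasurable_eLpNorm.comp_snd.indicator hT
  calc ∫⁻ τ in timeInt, ‖∫ ρ in (0 : ℝ)..τ, fieldNorm e ρ‖ₑ
      ≤ ∫⁻ τ in timeInt, ∫⁻ ρ in timeInt, T.indicator (fun z => n z.2) (τ, ρ) :=
        setLIntegral_mono' isOpen_timeInt.measurableSet h1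
    _ = ∫⁻ ρ in timeInt, ∫⁻ τ in timeInt, T.indicator (fun z => n z.2) (τ, ρ) :=
        lintegral_lintegral_swap hmeas
    _ ≤ ∫⁻ ρ in timeInt, 2 * (ENNReal.ofReal (Real.pi / 2 - |ρ|) * n ρ) := by
        refine setLIntegral_mono' isOpen_timeInt.measurableSet fun ρ hρ => ?_
        have hρ' : |ρ| < Real.pi / 2 := abs_lt.2 hρ
        have hm : MeasurableSet {τ : ℝ | |ρ| ≤ |τ|} := measurableSet_le (by fun_prop) (by fun_prop)
        have e1 : ∀ τ, T.indicator (fun z => n z.2) (τ, ρ)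
            = {τ : ℝ | |ρ| ≤ |τ|}.indicator (fun _ => n ρ) τ := fun τ => rfl
        simp only [e1]
        rw [lintegral_indicator hm, setLIntegral_const, Measure.restrict_apply hm, mul_comm,
          ← mul_assoc]
        refine mul_le_mul_left ?_ _
        have hsub : {τ : ℝ | |ρ| ≤ |τ|} ∩ timeInt
            ⊆ Icc |ρ| (Real.pi / 2) ∪ Icc (-(Real.pi / 2)) (-|ρ|) := by
          rintro τ ⟨h2, h3⟩
          rcases le_abs.1 (show |ρ| ≤ |τ| from h2) with h4 | h4
          · exact Or.inl ⟨h4, h3.2.le⟩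
          · exact Or.inr ⟨h3.1.le, by linarith⟩
        refine (measure_mono hsub).trans ((measure_union_le _ _).trans_eq ?_)
        rw [Real.volume_Icc, Real.volume_Icc, two_mul]
        congr 2
        ring
    _ = _ := lintegral_const_mul' _ _ (by simp)

/-- The vector potential of an admissible field that satisfies the decay condition. -/
theorem AdmissibleField.isDominatedPotential (hae : AdmissibleField a₀ e)
    (hint : ∫⁻ τ in timeInt,
      ENNReal.ofReal (Real.pi / 2 - |τ|) * eLpNorm (e τ) ⊤ (volume : Measure E3) < ⊤) :
    IsDominatedPotential (vecPot a₀ e) fun τ => ∫ ρ in (0 : ℝ)..τ, fieldNorm e ρ := by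
  have hsub : ∀ σ ∈ timeInt, ∀ τ ∈ timeInt, (∫ ρ in (0 : ℝ)..τ, fieldNorm e ρ)
      - ∫ ρ in (0 : ℝ)..σ, fieldNorm e ρ = ∫ ρ in σ..τ, fieldNorm e ρ := fun σ hσ τ hτ =>
    intervalIntegral.integral_interval_sub_left
      (hae.intervalIntegrable_fieldNorm zero_mem_timeInt hτ)
      (hae.intervalIntegrable_fieldNorm zero_mem_timeInt hσ)
  have hmono : ∀ σ ∈ timeInt, ∀ τ ∈ timeInt, σ ≤ τ → (∫ ρ in (0 : ℝ)..σ, fieldNorm e ρ)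
      ≤ ∫ ρ in (0 : ℝ)..τ, fieldNorm e ρ := fun σ hσ τ hτ h => by
    rw [← sub_nonneg, hsub σ hσ τ hτ]
    exact intervalIntegral.integral_nonneg h fun ρ _ => fieldNorm_nonneg e ρ
  have hlip : ∀ α β, Icc α β ⊆ timeInt → ∃ L, ∀ σ ∈ Icc α β, ∀ τ ∈ Icc α β, σ ≤ τ →
      (∫ ρ in (0 : ℝ)..τ, fieldNorm e ρ) - ∫ ρ in (0 : ℝ)..σ, fieldNorm e ρ ≤ L * (τ - σ) := by
    intro α β hs
    obtain ⟨C, hC⟩ := hae.exists_fieldNorm_le hs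
    refine ⟨C, fun σ hσ τ hτ h => ?_⟩
    rw [hsub σ (hs hσ) τ (hs hτ)]
    have h1 := (ae_restrict_iff' measurableSet_Icc).1 hC
    have h2 : (∫ ρ in σ..τ, fieldNorm e ρ) ≤ ∫ _ in σ..τ, C := by
      refine intervalIntegral.integral_mono_ae_restrict h
        (hae.intervalIntegrable_fieldNorm (hs hσ) (hs hτ)) (by simp) ?_
      refine (ae_restrict_iff' measurableSet_Icc).2 ?_
      filter_upwards [h1] with ρ hρ hm
      exact hρ ⟨hσ.1.trans hm.1, hm.2.trans hτ.2⟩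
    rwa [intervalIntegral.integral_const, smul_eq_mul, mul_comm] at h2
  refine ⟨fun τ hτ => hae.memLp_vecPot hτ, hmono, hlip, fun σ hσ τ hτ h => ?_, ?_⟩
  · rw [hsub σ hσ τ hτ]
    exact hae.ae_norm_vecPot_sub_le hσ hτ h
  · have hcont : ContinuousOn (fun τ => ∫ ρ in (0 : ℝ)..τ, fieldNorm e ρ) timeInt :=
      continuousOn_timeInt hmono hlip
    simp only [intervalIntegral.integral_same, sub_zero]
    refine ⟨(hcont.abs).aestronglyMeasurable isOpen_timeInt.measurableSet, ?_⟩
    simp only [HasFiniteIntegral, ← Real.norm_eq_abs, enorm_norm]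
    exact hae.lintegral_le.trans_lt (ENNReal.mul_lt_top (by simp) hint)

end FieldNorm


/-! ### Passage to the Schrödinger picture -/

section Niederer

theorem ae_comp_smul {c : ℝ} (hc : c ≠ 0) {p : E3 → Prop} (h : ∀ᵐ x, p x) :
    ∀ᵐ x : E3, p (c • x) := by
  have hq : Measure.QuasiMeasurePreserving (fun x : E3 => c • x) volume volume := by
    refine ⟨measurable_const_smul c, ?_⟩
    have h1 := Measure.map_addHaar_smul (volume : Measure E3) hc
    change Measure.map (c • ·) volume ≪ volume
    rw [h1]
    exact Measure.smul_absolutelyContinuous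
  exact hq.ae h

theorem niederer_zero (χ : Hs) : niederer 0 χ = χ := by
  ext1
  refine (MemLp.coeFn_toLp _).trans (Eventually.of_forall fun x => ?_)
  simp [bracket]

theorem niedererAdj_zero (ψ : Hs) : niedererAdj 0 ψ = ψ := by
  ext1
  refine (MemLp.coeFn_toLp _).trans (Eventually.of_forall fun x => ?_)
  simp [bracket]

theorem coeFn_niederer (t : ℝ) (χ : Hs) : niederer t χ =ᵐ[volume] fun x =>
    ((bracket t ^ (-(3 / 2) : ℝ) : ℝ) : ℂ) *
      Complex.exp (((t / 2 * (‖x‖ / bracket t) ^ 2 : ℝ) : ℂ) * Complex.I) *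
        χ ((bracket t)⁻¹ • x) :=
  MemLp.coeFn_toLp _

theorem coeFn_niedererAdj (t : ℝ) (ψ : Hs) : niedererAdj t ψ =ᵐ[volume] fun y =>
    ((bracket t ^ (3 / 2 : ℝ) : ℝ) : ℂ) *
      Complex.exp (((-(t / 2 * ‖y‖ ^ 2) : ℝ) : ℂ) * Complex.I) * ψ (bracket t • y) :=
  MemLp.coeFn_toLp _

/-- The phases and the powers of ⟨t⟩ cancel pointwise and the dilation rescales the plane wave. The
identity is exact, so the limit in t is the limit in τ = arctan t without any error term. -/
theorem niedererAdj_mulOp_niederer (t : ℝ) (q : E3) (χ : Hs) :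
    niedererAdj t (mulOp (planeWave ((bracket t)⁻¹ • q)) (niederer t χ))
      = mulOp (planeWave q) χ := by
  have hb := bracket_pos t
  ext1
  filter_upwards [coeFn_niedererAdj t (mulOp (planeWave ((bracket t)⁻¹ • q)) (niederer t χ)),
    ae_comp_smul hb.ne' (coeFn_mulOp (planeWave ((bracket t)⁻¹ • q)) (niederer t χ)),
    ae_comp_smul hb.ne' (coeFn_niederer t χ), coeFn_mulOp (planeWave q) χ] with y h1 h2 h3 h4
  rw [h1, h2, h3, h4, inv_smul_smul₀ hb.ne', norm_smul, Real.norm_eq_abs, abs_of_pos hb,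
    mul_div_cancel_left₀ _ hb.ne']
  have e1 : planeWave ((bracket t)⁻¹ • q) (bracket t • y) = planeWave q y := by
    change Complex.exp _ = Complex.exp _
    rw [real_inner_smul_left, real_inner_smul_right, inv_mul_cancel_left₀ hb.ne']
  have e2 : ((bracket t ^ (3 / 2 : ℝ) : ℝ) : ℂ) * ((bracket t ^ (-(3 / 2) : ℝ) : ℝ) : ℂ) = 1 := by
    rw [← Complex.ofReal_mul, ← Real.rpow_add hb]
    simp
  have e3 : Complex.exp (((-(t / 2 * ‖y‖ ^ 2) : ℝ) : ℂ) * Complex.I)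
      * Complex.exp (((t / 2 * ‖y‖ ^ 2 : ℝ) : ℂ) * Complex.I) = 1 := by
    rw [← Complex.exp_add, Complex.ofReal_neg, neg_mul, neg_add_cancel, Complex.exp_zero]
  rw [e1]
  linear_combination (planeWave q y * χ y) * e2 + (((bracket t ^ (3 / 2 : ℝ) : ℝ) : ℂ)
    * ((bracket t ^ (-(3 / 2) : ℝ) : ℝ) : ℂ)) * (planeWave q y * χ y) * e3

theorem schrEvol_mulOp_schrEvol (u : ℝ → ℝ → Hs ≃ₗᵢ[ℂ] Hs) (t : ℝ) (q : E3) (ψ : Hs) :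
    schrEvol u 0 t (mulOp (planeWave ((bracket t)⁻¹ • q)) (schrEvol u t 0 ψ))
      = heisenberg u (planeWave q) (Real.arctan t) ψ := by
  simp only [schrEvol, niederer_zero, niedererAdj_zero, niedererAdj_mulOp_niederer,
    Real.arctan_zero, heisenberg]

end Niederer

/-! ### Assembly of the theorem -/

section AsymptoticPosition

theorem IsPropagator.hasAsymptoticPosition {a : ℝ → E3 → E3} {A : ℝ → ℝ}
    {u : ℝ → ℝ → Hs ≃ₗᵢ[ℂ] Hs} (hu : IsPropagator a u) (ha : IsDominatedPotential a A)
    {l l' : Filter ℝ} [l.NeBot] {c : ℝ} (hl : timeInt ∈ l) (hc : l ≤ 𝓝 c)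
    (hl' : Tendsto Real.arctan l' l) : HasAsymptoticPosition u l l' := by
  obtain ⟨Φ, μ, hfin, hμ, hlim⟩ := hu.exists_limit ha hl hc
  have hm : ∀ j, Continuous fun y : E3 => y j := fun j => by fun_prop
  have hsa := fun j => hμ.isSelfAdjoint_calcPMap (hm j)
  have hX := hμ.isJointSpectralMeasure fun j => (hm j).measurable
  refine ⟨fun j => hμ.calcPMap (fun y => y j) (hm j).measurable, hμ.projMeasure,
    ⟨hsa, hX, fun q => ⟨Φ (planeWave q), hμ.isIntegral _, hlim _⟩⟩, fun Y Q hY => ?_,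
    fun f => ⟨Φ f.toBoundedContinuousFunction, hμ.isIntegral _, hlim _⟩,
    fun q => ⟨Φ (planeWave q), hμ.isIntegral _, fun ψ => ?_⟩⟩
  · refine hX.unique hY.2.1 (fun j => (hsa j).dense_domain)
      (measure_eq_of_isIntegral_planeWave fun q => ?_)
    obtain ⟨T, hT, hTlim⟩ := hY.2.2 q
    -- Strong limits are unique, so a competing spectral measure integrates each plane wave to the
    -- same operator.
    have e : T = Φ (planeWave q) := by
      ext1 ψ
      exact tendsto_nhds_unique (hTlim ψ) (hlim _ ψ)
    exact ⟨T, e ▸ hμ.isIntegral _, hT⟩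
  · simp only [schrEvol_mulOp_schrEvol]
    exact (hlim (planeWave q) ψ).comp hl'

theorem timeInt_mem_nhdsLT : timeInt ∈ 𝓝[<] (Real.pi / 2) :=
  Ioo_mem_nhdsLT (by linarith [Real.pi_pos])

theorem timeInt_mem_nhdsGT : timeInt ∈ 𝓝[>] (-(Real.pi / 2)) :=
  Ioo_mem_nhdsGT (by linarith [Real.pi_pos])

end AsymptoticPosition

end OscScatt

end

open OscScatt in
theorem theorem6p1 (a₀ : E3 → E3) (e : ℝ → E3 → E3) (hae : AdmissibleField a₀ e)
    (hint : ∫⁻ τ in timeInt,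
      ENNReal.ofReal (Real.pi / 2 - |τ|) * eLpNorm (e τ) ⊤ (volume : Measure E3) < ⊤)
    (u : ℝ → ℝ → Hs ≃ₗᵢ[ℂ] Hs) (hu : IsPropagator (vecPot a₀ e) u) :
    HasAsymptoticPosition u (𝓝[<] (Real.pi / 2)) atTop ∧
      HasAsymptoticPosition u (𝓝[>] (-(Real.pi / 2))) atBot :=
  have ha := hae.isDominatedPotential hint
  ⟨hu.hasAsymptoticPosition ha timeInt_mem_nhdsLT nhdsWithin_le_nhds Real.tendsto_arctan_atTop,
    hu.hasAsymptoticPosition ha timeInt_mem_nhdsGT nhdsWithin_le_nhds Real.tendsto_arctan_atBot⟩
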